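/- A translation surface is a (Hausdorff, second countable) topological surface with an atlas whose transition maps, off a closed discrete set of singular points, are locally translations of $\mathbb R^2$. An affine homeomorphism of a translation surface $Y$ is a self-homeomorphism which preserves the singular points and is, in translation charts, locally of the form $v\mapsto Av+b$ with a fixed $A\in GL_2^+(\mathbb R)$, its derivative. $\mathrm{Aff}(Y)$ denotes the group of affine homeomorphisms, and the Veech group of $Y$ is the group of all derivatives of elements of $\mathrm{Aff}(Y)$. For $k=0,1,2,\dots$ let $$I_k^0=[1-2^{-k},1-2^{-k-1}]\times\{0\},\qquad I_k^1=[2^{-k-1},2^{-k}]\times\{1\},$$ $$J_k^0=\{0\}\times[1-2^{-k},1-2^{-k-1}],\qquad J_k^1=\{1\}\times[2^{-k-1},2^{-k}].$$ Let $Q$ be the closed unit square $[0,1]^2$ with the corners $(0,1),(1,0)$ and the end points of all these segments removed. The Chamanara surface $X$ is the quotient of $Q$ in which, for every $k$, $I_k^0$ is identified with $I_k^1$ and $J_k^0$ with $J_k^1$ by a translation. Every point of $X$ has a unique representative in $Q\cap[0,1)^2$. **Theorem.** There are finite-area translation surfaces whose Veech group is an infinite cyclic group generated by a hyperbolic element.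 More precisely: 1. With the charts that are locally translations when read on $Q$, $X$ is a translation surface without singular points, and the formula $$\varphi(x,y)=\begin{cases}(\tfrac12x+\tfrac12,\,2y)& y\in[0,\tfrac12)\\(\tfrac12x,\,2y-1)& y\in[\tfrac12,1)\end{cases}\qquad (x,y)\in Q\cap[0,1)^2,$$ defines an affine homeomorphism $\varphi:X\to X$ whose derivative is the hyperbolic matrix $g=\begin{pmatrix}1/2&0\\0&2\end{pmatrix}$. 2. There is a point $\zeta\in X$ whose stabiliser in $\mathrm{Aff}(X)$ is trivial and whose orbit $\{\varphi^n(\zeta)\mid n\in\mathbb Z\}$ is a closed discrete subset of $X$. 3. For every such point $\zeta$, the open subset $X'=X\setminus\{\varphi^n(\zeta)\mid n\in\mathbb Z\}$, with the restricted charts, is a connected translation surface of finite area, and its Veech group is infinite and equal to the cyclic group $\langle g\rangle$. -/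

import Mathlib

open Set Filter Topology MeasureTheory
open scoped Matrix MatrixGroups

/-- A translation surface: a topological surface `X` (Hausdorff, second countable, locally
homeomorphic to the plane), a closed discrete set `sing` of singularities, and an atlas of the
complement of `sing` by charts with values in the plane whose transition maps are
(locally) translations. (Such a surface is automatically orientable.) -/
structure TranslationSurface (X : Type*) [TopologicalSpace X] where
  t2 : T2Space X
  secondCountable : SecondCountableTopology X
  locally_plane : ∀ x : X, ∃ e : OpenPartialHomeomorph X (Fin 2 → ℝ), x ∈ e.source
  /-- the singularities -/
  sing : Set X
  isClosed_sing : IsClosed sing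
  discrete_sing : DiscreteTopology sing
  /-- the translation charts -/
  charts : Set (OpenPartialHomeomorph X (Fin 2 → ℝ))
  covers : ∀ x : X, (∃ e ∈ charts, x ∈ e.source) ↔ x ∉ sing
  compat : ∀ e ∈ charts, ∀ e' ∈ charts, ∀ x ∈ e.source ∩ e'.source,
    ∃ b : Fin 2 → ℝ, ∀ᶠ y in 𝓝 x, e' y = e y + b

namespace TranslationSurface

variable {X : Type*} [TopologicalSpace X] (S : TranslationSurface X)

/-- The homeomorphism `f` preserves the singularities and, in translation charts, is locally
the restriction of an affine map of the plane with linear part `A`. -/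
def HasLinearPart (f : X ≃ₜ X) (A : Matrix (Fin 2) (Fin 2) ℝ) : Prop :=
  (∀ x, f x ∈ S.sing ↔ x ∈ S.sing) ∧
  ∀ e ∈ S.charts, ∀ e' ∈ S.charts, ∀ x ∈ e.source, f x ∈ e'.source →
    ∃ b : Fin 2 → ℝ, ∀ᶠ y in 𝓝 x, e' (f y) = A *ᵥ e y + b

theorem hasLinearPart_one : S.HasLinearPart 1 1 := by
  refine ⟨fun x => Iff.rfl, fun e he e' he' x hx hx' => ?_⟩
  obtain ⟨b, hb⟩ := S.compat e he e' he' x ⟨hx, hx'⟩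
  exact ⟨b, by simpa using hb⟩

variable {S} in
theorem HasLinearPart.mul {f g : X ≃ₜ X} {A B : Matrix (Fin 2) (Fin 2) ℝ}
    (hf : S.HasLinearPart f A) (hg : S.HasLinearPart g B) :
    S.HasLinearPart (f * g) (A * B) := by
  refine ⟨fun x => (hf.1 (g x)).trans (hg.1 x), fun e he e' he' x hx hx' => ?_⟩
  have hgx : g x ∉ S.sing := fun h => (S.covers x).1 ⟨e, he, hx⟩ ((hg.1 x).1 h)
  obtain ⟨e₁, he₁, hx₁⟩ := (S.covers (g x)).2 hgx
  obtain ⟨b, hb⟩ := hg.2 e he e₁ he₁ x hx hx₁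
  obtain ⟨c, hc⟩ := hf.2 e₁ he₁ e' he' (g x) hx₁ hx'
  refine ⟨A *ᵥ b + c, ?_⟩
  filter_upwards [hb, g.continuous.continuousAt.eventually hc] with y h1 h2
  change e' (f (g y)) = _
  rw [h2, h1, Matrix.mulVec_add, Matrix.mulVec_mulVec, add_assoc]

variable {S} in
theorem HasLinearPart.inv {f : X ≃ₜ X} {A B : Matrix (Fin 2) (Fin 2) ℝ}
    (hf : S.HasLinearPart f A) (hBA : B * A = 1) : S.HasLinearPart f⁻¹ B := by
  have hfi : ∀ x, f (f⁻¹ x) = x := fun x => f.apply_symm_apply x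
  refine ⟨fun x => by rw [← hf.1, hfi], fun e he e' he' x hx hx' => ?_⟩
  obtain ⟨b, hb⟩ := hf.2 e' he' e he (f⁻¹ x) hx' (by rwa [hfi])
  refine ⟨-(B *ᵥ b), ?_⟩
  filter_upwards [(f⁻¹).continuous.continuousAt.eventually hb] with y h
  rw [hfi] at h
  rw [h, Matrix.mulVec_add, Matrix.mulVec_mulVec, hBA, Matrix.one_mulVec]
  abel

/-- The group of (orientation preserving) affine homeomorphisms. -/
def affineGroup : Subgroup (X ≃ₜ X) where
  carrier := {f | ∃ A : GL(2, ℝ)⁺, S.HasLinearPart f A.1.1}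
  one_mem' := ⟨1, by simpa using S.hasLinearPart_one⟩
  mul_mem' := by
    rintro f g ⟨A, hA⟩ ⟨B, hB⟩
    exact ⟨A * B, by simpa using hA.mul hB⟩
  inv_mem' := by
    rintro f ⟨A, hA⟩
    refine ⟨A⁻¹, hA.inv ?_⟩
    simp

/-- The Veech group: the group of linear parts of affine homeomorphisms. -/
def veechGroup : Subgroup GL(2, ℝ)⁺ where
  carrier := {A | ∃ f : X ≃ₜ X, S.HasLinearPart f A.1.1}
  one_mem' := ⟨1, by simpa using S.hasLinearPart_one⟩
  mul_mem' := by
    rintro A B ⟨f, hf⟩ ⟨g, hg⟩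
    exact ⟨f * g, by simpa using hf.mul hg⟩
  inv_mem' := by
    rintro A ⟨f, hf⟩
    refine ⟨f⁻¹, hf.inv ?_⟩
    simp

/-- `μ` is the area of the flat metric: a Borel measure that is Lebesgue measure in every
translation chart and does not charge the singularities. -/
def IsArea (μ : @Measure X (borel X)) : Prop :=
  μ S.sing = 0 ∧
  ∀ e ∈ S.charts, ∀ B ⊆ e.source, MeasurableSet[borel X] B → μ B = volume (e '' B)

/-- The total area is finite. -/
def HasFiniteArea : Prop :=
  ∃ μ : @Measure X (borel X), S.IsArea μ ∧ μ univ < ⊤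

/-- An open subset of a translation surface, with the restricted charts. -/
def restrict (U : TopologicalSpace.Opens X) : TranslationSurface U where
  t2 := by have := S.t2; infer_instance
  secondCountable := by have := S.secondCountable; infer_instance
  locally_plane x := by
    obtain ⟨e, he⟩ := S.locally_plane x
    exact ⟨e.subtypeRestr ⟨x⟩, by simpa using he⟩
  sing := (↑) ⁻¹' S.sing
  isClosed_sing := S.isClosed_sing.preimage continuous_subtype_val
  discrete_sing := by
    have := S.discrete_sing
    exact DiscreteTopology.preimage_of_continuous_injective S.sing continuous_subtype_val
      Subtype.val_injective
  charts := {e | ∃ e₀ ∈ S.charts, ∃ h : Nonempty U, e = e₀.subtypeRestr h}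
  covers x := by
    rw [mem_preimage, ← S.covers]
    constructor
    · rintro ⟨_, ⟨e, he, h, rfl⟩, hx⟩
      exact ⟨e, he, by simpa using hx⟩
    · rintro ⟨e, he, hx⟩
      exact ⟨_, ⟨e, he, ⟨x⟩, rfl⟩, by simpa using hx⟩
  compat := by
    rintro _ ⟨e, he, h, rfl⟩ _ ⟨e', he', h', rfl⟩ x ⟨hx, hx'⟩
    obtain ⟨b, hb⟩ := S.compat e he e' he' x ⟨by simpa using hx, by simpa using hx'⟩
    exact ⟨b, continuous_subtype_val.continuousAt.eventually hb⟩

end TranslationSurface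

/-- A hyperbolic element: determinant one and trace of absolute value greater than two. -/
def IsHyperbolicElement (g : GL(2, ℝ)⁺) : Prop :=
  g.1.1.det = 1 ∧ 2 < |g.1.1.trace|

namespace Chamanara

/-- The four families of segments in the sides of the unit square. -/
def I₀ (k : ℕ) : Set (Fin 2 → ℝ) :=
  {p | p 0 ∈ Icc (1 - (1 / 2) ^ k) (1 - (1 / 2) ^ (k + 1)) ∧ p 1 = 0}

def I₁ (k : ℕ) : Set (Fin 2 → ℝ) :=
  {p | p 0 ∈ Icc ((1 / 2) ^ (k + 1)) ((1 / 2) ^ k) ∧ p 1 = 1}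

def J₀ (k : ℕ) : Set (Fin 2 → ℝ) :=
  {p | p 0 = 0 ∧ p 1 ∈ Icc (1 - (1 / 2) ^ k) (1 - (1 / 2) ^ (k + 1))}

def J₁ (k : ℕ) : Set (Fin 2 → ℝ) :=
  {p | p 0 = 1 ∧ p 1 ∈ Icc ((1 / 2) ^ (k + 1)) ((1 / 2) ^ k)}

/-- The points removed from the square: two corners and the end points of the segments. -/
def removed : Set (Fin 2 → ℝ) :=
  {![0, 1], ![1, 0]} ∪ ⋃ k : ℕ,
    ({![1 - (1 / 2) ^ k, 0], ![1 - (1 / 2) ^ (k + 1), 0]} ∪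
     {![(1 / 2) ^ (k + 1), 1], ![(1 / 2) ^ k, 1]} ∪
     {![0, 1 - (1 / 2) ^ k], ![0, 1 - (1 / 2) ^ (k + 1)]} ∪
     {![1, (1 / 2) ^ (k + 1)], ![1, (1 / 2) ^ k]})

/-- The closed unit square without the removed points. -/
def Q : Set (Fin 2 → ℝ) := Icc 0 1 \ removed

/-- `Glue p q`: for some `k`, the point `q` is the image of `p` under the translation that takes
`I₀ k` to `I₁ k`, or under the one that takes `J₀ k` to `J₁ k`. -/
def Glue (p q : Q) : Prop :=
  ∃ k : ℕ,
    (p.1 ∈ I₀ k ∧ q.1 ∈ I₁ k ∧ q.1 = p.1 + ![(1 / 2) ^ (k + 1) - (1 - (1 / 2) ^ k), 1]) ∨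
    (p.1 ∈ J₀ k ∧ q.1 ∈ J₁ k ∧ q.1 = p.1 + ![1, (1 / 2) ^ (k + 1) - (1 - (1 / 2) ^ k)])

/-- The Chamanara surface, with the quotient topology. -/
abbrev Surface : Type := Quot Glue

/-- The translation charts of the Chamanara surface: the charts that become locally a
translation when read on `Q`. -/
def charts : Set (OpenPartialHomeomorph Surface (Fin 2 → ℝ)) :=
  {e | ∀ p : Q, Quot.mk Glue p ∈ e.source →
    ∃ b : Fin 2 → ℝ, ∀ᶠ q : Q in 𝓝 p, e (Quot.mk Glue q) = q.1 + b}

/-- The formula for the affine map on the half-open square `[0, 1) × [0, 1)`. -/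
noncomputable def planeMap (p : Fin 2 → ℝ) : Fin 2 → ℝ :=
  if p 1 < 1 / 2 then ![p 0 / 2 + 1 / 2, 2 * p 1] else ![p 0 / 2, 2 * p 1 - 1]

/-- `φ` is the self-map of the Chamanara surface given by `planeMap` on representatives
in `[0, 1) × [0, 1)` (every point of the surface has exactly one). -/
def IsPhi (φ : Surface ≃ₜ Surface) : Prop :=
  ∀ p : Q, p.1 0 < 1 → p.1 1 < 1 →
    ∃ h : planeMap p.1 ∈ Q, φ (Quot.mk Glue p) = Quot.mk Glue ⟨planeMap p.1, h⟩

/-- The two-sided orbit of `ζ` under `φ`. -/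
def orbit (φ : Surface ≃ₜ Surface) (ζ : Surface) : Set Surface :=
  range fun n : ℤ => (φ ^ n) ζ

end Chamanara

/-!
The proof rests on two facts: the Chamanara surface has only one end, and its affine group is
countable.

*The surface.* The quotient map from `Q` to the surface is proper, and each point of the sides has
exactly one partner (`mk_eq_mk_iff`), so the open square and the neighbourhoods of the open segments
are charts (`exists_openSquare_chart`, `exists_column_chart`) of a translation surface
`translationSurface`. The piecewise affine formula `planeMap` respects the gluing and is inverted
by its conjugate under the reflection in the diagonal, which gives `phi`.

*A point with trivial stabiliser.* An affine homeomorphism with linear part close to the identity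
that almost fixes the centre of the square fixes three of the removed points and hence is the
identity (`eq_one_of_near`). So the affine group embeds as a discrete subset into a second countable
space and is countable. The fixed points of a nontrivial affine homeomorphism lie on countably many
horizontal lines or meet each horizontal line in a countable set, so every product of two
uncountable sets of coordinates contains a point with trivial stabiliser
(`exists_trivial_stabiliser`).

*A point with closed discrete orbit.* On binary expansions `phi` is the shift of two-sided
sequences (`phi_codePoint`). If a sequence changes at most once in a long window around the place
`n`, then the `n`-th point of the orbit is close to a removed point of the square. Sequences
whose two halves change only at squares have this property for all large `|n|`, so the orbit leaves
every compact set. As there are uncountably many choices for each half, some such point also has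
trivial stabiliser (`exists_point`).

*The Veech group.* The compact sets `core ε` exhaust the surface and have connected complements
(`isPreconnected_compl_core`): there is only one end. Every neighbourhood of this end contains
punctures, unlike a small punctured disc around a puncture. So a homeomorphism of the punctured
surface takes punctures to punctures and extends over them (`exists_homeomorph_extension`).
The extension of an affine homeomorphism is affine with the same linear part
(`TranslationSurface.HasLinearPart.of_restrict`) and takes `ζ` to some `(phi ^ n) ζ`, hence equals
`phi ^ n`, because the stabiliser of `ζ` is trivial.
-/

namespace Chamanara

/-! ### The square and its gluing -/

/-- `x` lies strictly inside the `k`-th of the intervals `[1 - 2⁻ᵏ, 1 - 2⁻ᵏ⁻¹]` that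
subdivide `[0, 1)`. -/
def Gap (k : ℕ) (x : ℝ) : Prop := 1 - (1 / 2) ^ k < x ∧ x < 1 - (1 / 2) ^ (k + 1)

theorem Gap.pos {k : ℕ} {x : ℝ} (h : Gap k x) : 0 < x := by
  have : ((1 : ℝ) / 2) ^ k ≤ 1 := pow_le_one₀ (by norm_num) (by norm_num)
  linarith [h.1]

theorem Gap.lt_one {k : ℕ} {x : ℝ} (h : Gap k x) : x < 1 := by
  have : (0 : ℝ) < (1 / 2) ^ (k + 1) := by positivity
  linarith [h.2]

theorem Gap.unique {k l : ℕ} {x : ℝ} (h : Gap k x) (h' : Gap l x) : k = l := by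
  have key : ∀ {k l : ℕ}, Gap k x → Gap l x → ¬ k < l := by
    intro k l h h' hkl
    have := pow_le_pow_of_le_one (a := (1 : ℝ) / 2) (by norm_num) (by norm_num)
      (show k + 1 ≤ l from hkl)
    linarith [h.2, h'.1]
  exact le_antisymm (not_lt.1 (key h' h)) (not_lt.1 (key h h'))

theorem Gap.isOpen (k : ℕ) : IsOpen {x | Gap k x} := isOpen_Ioo (a := 1 - (1 / 2 : ℝ) ^ k)

/-- The signed length of the horizontal (or vertical) part of the `k`-th gluing translation. -/
noncomputable def shift (k : ℕ) : ℝ := (1 / 2) ^ (k + 1) - (1 - (1 / 2) ^ k)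

theorem gap_one_sub_add_shift {k : ℕ} {x : ℝ} : Gap k (1 - (x + shift k)) ↔ Gap k x := by
  have : ((1 : ℝ) / 2) ^ (k + 1) = (1 / 2) ^ k / 2 := by ring
  unfold Gap shift
  rw [this]
  constructor <;> rintro ⟨h1, h2⟩ <;> constructor <;> linarith

theorem exists_gap {x : ℝ} (h0 : 0 ≤ x) (h1 : x < 1) (h : ∀ k : ℕ, x ≠ 1 - (1 / 2) ^ k) :
    ∃ k, Gap k x := by
  obtain ⟨k, hk1, hk2⟩ := exists_nat_pow_near_of_lt_one (x := 1 - x) (y := (1 : ℝ) / 2)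
    (by linarith) (by linarith) (by norm_num) (by norm_num)
  refine ⟨k, lt_of_le_of_ne (by linarith) fun e => h k e.symm, by linarith⟩

theorem Gap.ne {k : ℕ} {x : ℝ} (hx : Gap k x) (l : ℕ) : x ≠ 1 - (1 / 2) ^ l := by
  rintro rfl
  have h1 := hx.1
  have h2 := hx.2
  have h3 : ((1 : ℝ) / 2) ^ l < (1 / 2) ^ k := by linarith
  have h4 : ((1 : ℝ) / 2) ^ (k + 1) < (1 / 2) ^ l := by linarith
  rw [pow_lt_pow_iff_right_of_lt_one₀ (by norm_num) (by norm_num)] at h3 h4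
  omega

theorem vec_ext {p : Fin 2 → ℝ} {a b : ℝ} : p = ![a, b] ↔ p 0 = a ∧ p 1 = b := by
  constructor
  · rintro rfl
    simp
  · rintro ⟨rfl, rfl⟩
    ext i
    fin_cases i <;> rfl

theorem mem_removed_iff {p : Fin 2 → ℝ} :
    p ∈ removed ↔ (p 0 = 0 ∧ p 1 = 1) ∨ (p 0 = 1 ∧ p 1 = 0) ∨ ∃ k : ℕ,
      (p 0 = 1 - (1 / 2) ^ k ∧ p 1 = 0) ∨ (p 0 = (1 / 2) ^ k ∧ p 1 = 1) ∨
      (p 0 = 0 ∧ p 1 = 1 - (1 / 2) ^ k) ∨ (p 0 = 1 ∧ p 1 = (1 / 2) ^ k) := by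
  simp only [removed, mem_union, mem_insert_iff, mem_singleton_iff, mem_iUnion, vec_ext]
  constructor
  · rintro ((h | h) | ⟨k, h⟩)
    · exact Or.inl h
    · exact Or.inr (Or.inl h)
    · rcases h with ((((h | h) | (h | h)) | (h | h)) | (h | h))
      · exact Or.inr (Or.inr ⟨k, by tauto⟩)
      · exact Or.inr (Or.inr ⟨k + 1, by tauto⟩)
      · exact Or.inr (Or.inr ⟨k + 1, by tauto⟩)
      · exact Or.inr (Or.inr ⟨k, by tauto⟩)
      · exact Or.inr (Or.inr ⟨k, by tauto⟩)
      · exact Or.inr (Or.inr ⟨k + 1, by tauto⟩)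
      · exact Or.inr (Or.inr ⟨k + 1, by tauto⟩)
      · exact Or.inr (Or.inr ⟨k, by tauto⟩)
  · rintro (h | h | ⟨k, h⟩)
    · exact Or.inl (Or.inl h)
    · exact Or.inl (Or.inr h)
    · exact Or.inr ⟨k, by tauto⟩

/-- Membership in `Q`, side by side: a boundary point belongs to `Q` if and only if it lies in
the interior of one of the segments. -/
theorem mem_Q_iff {p : Fin 2 → ℝ} :
    p ∈ Q ↔ (0 ≤ p 0 ∧ p 0 ≤ 1 ∧ 0 ≤ p 1 ∧ p 1 ≤ 1) ∧
      (p 1 = 0 → ∃ k, Gap k (p 0)) ∧ (p 1 = 1 → ∃ k, Gap k (1 - p 0)) ∧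
      (p 0 = 0 → ∃ k, Gap k (p 1)) ∧ (p 0 = 1 → ∃ k, Gap k (1 - p 1)) := by
  have hI : p ∈ Icc (0 : Fin 2 → ℝ) 1 ↔ 0 ≤ p 0 ∧ p 0 ≤ 1 ∧ 0 ≤ p 1 ∧ p 1 ≤ 1 := by
    simp only [mem_Icc, Pi.le_def, Fin.forall_fin_two, Pi.zero_apply, Pi.one_apply]
    tauto
  rw [Q, Set.mem_sdiff, hI, mem_removed_iff]
  refine and_congr_right fun ⟨h0, h0', h1, h1'⟩ => ⟨fun h => ?_, ?_⟩
  · push Not at h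
    obtain ⟨c1, c2, hk⟩ := h
    refine ⟨fun e => exists_gap h0 (lt_of_le_of_ne h0' fun e' => c2 e' e) fun k hk' =>
        (hk k).1 hk' e, fun e => exists_gap (by linarith)
        (by linarith [lt_of_le_of_ne h0 fun e' => c1 e'.symm e]) fun k hk' =>
        (hk k).2.1 (by linarith) e, fun e => exists_gap h1
        (lt_of_le_of_ne h1' fun e' => c1 e e') fun k hk' => (hk k).2.2.1 e hk',
        fun e => exists_gap (by linarith)
        (by linarith [lt_of_le_of_ne h1 fun e' => c2 e e'.symm]) fun k hk' =>
        (hk k).2.2.2 e (by linarith)⟩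
  · rintro ⟨a, b, c, d⟩ (⟨e, f⟩ | ⟨e, f⟩ | ⟨k, ⟨e, f⟩ | ⟨e, f⟩ | ⟨e, f⟩ | ⟨e, f⟩⟩)
    · obtain ⟨k, hk⟩ := b f
      linarith [hk.lt_one]
    · obtain ⟨k, hk⟩ := a f
      linarith [hk.lt_one]
    · obtain ⟨l, hl⟩ := a f
      exact hl.ne k e
    · obtain ⟨l, hl⟩ := b f
      exact hl.ne k (by linarith)
    · obtain ⟨l, hl⟩ := c e
      exact hl.ne k f
    · obtain ⟨l, hl⟩ := d e
      exact hl.ne k (by linarith)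

theorem Q_bounds (p : Q) : 0 ≤ p.1 0 ∧ p.1 0 ≤ 1 ∧ 0 ≤ p.1 1 ∧ p.1 1 ≤ 1 := (mem_Q_iff.1 p.2).1

theorem glue_iff {p q : Q} : Glue p q ↔ ∃ k,
    (p.1 1 = 0 ∧ Gap k (p.1 0) ∧ q.1 0 = p.1 0 + shift k ∧ q.1 1 = 1) ∨
    (p.1 0 = 0 ∧ Gap k (p.1 1) ∧ q.1 0 = 1 ∧ q.1 1 = p.1 1 + shift k) := by
  have hp' := mem_Q_iff.1 p.2
  have key : ∀ {k : ℕ} {x : ℝ}, (∃ l, Gap l x) →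
      x ∈ Icc (1 - (1 / 2 : ℝ) ^ k) (1 - (1 / 2) ^ (k + 1)) → Gap k x := fun ⟨l, hl⟩ hx =>
    ⟨lt_of_le_of_ne hx.1 (hl.ne _).symm, lt_of_le_of_ne hx.2 (hl.ne _)⟩
  have key2 : ∀ {k : ℕ} {x : ℝ}, Gap k x →
      x + shift k ∈ Icc ((1 / 2 : ℝ) ^ (k + 1)) ((1 / 2) ^ k) := by
    intro k x hx
    have := gap_one_sub_add_shift.2 hx
    exact ⟨by linarith [this.2], by linarith [this.1]⟩
  refine exists_congr fun k => or_congr ⟨?_, ?_⟩ ⟨?_, ?_⟩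
  · rintro ⟨⟨h1, h2⟩, ⟨h3, h4⟩, h5⟩
    exact ⟨h2, key (hp'.2.1 h2) h1, by simp [h5, shift], h4⟩
  · rintro ⟨h1, h2, h3, h4⟩
    refine ⟨⟨⟨h2.1.le, h2.2.le⟩, h1⟩, ⟨?_, h4⟩, ?_⟩
    · change q.1 0 ∈ _
      rw [h3]
      exact key2 h2
    · ext i
      fin_cases i
      · simpa [shift] using h3
      · simp at h1 h4 ⊢
        simp [h1, h4]
  · rintro ⟨⟨h1, h2⟩, ⟨h3, h4⟩, h5⟩
    exact ⟨h1, key (hp'.2.2.2.1 h1) h2, h3, by simp [h5, shift]⟩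
  · rintro ⟨h1, h2, h3, h4⟩
    refine ⟨⟨h1, ⟨h2.1.le, h2.2.le⟩⟩, ⟨h3, ?_⟩, ?_⟩
    · simp only [h4]
      exact key2 h2
    · ext i
      fin_cases i
      · simp at h1 h3 ⊢
        simp [h1, h3]
      · simpa [shift] using h4

/-- `Partner p q`: the points `p ≠ q` of `Q` represent the same point of the surface. -/
def Partner (p q : Q) : Prop := Glue p q ∨ Glue q p

theorem Partner.symm {p q : Q} (h : Partner p q) : Partner q p := Or.symm h

/-- The four ways in which a point can have a partner; `q` is the translate of `p` by a vector
that depends only on the segment containing `p`. -/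
theorem partner_iff {p q : Q} : Partner p q ↔ ∃ k,
    (p.1 1 = 0 ∧ Gap k (p.1 0) ∧ q.1 = p.1 + ![shift k, 1]) ∨
    (p.1 0 = 0 ∧ Gap k (p.1 1) ∧ q.1 = p.1 + ![1, shift k]) ∨
    (p.1 1 = 1 ∧ Gap k (1 - p.1 0) ∧ q.1 = p.1 - ![shift k, 1]) ∨
    (p.1 0 = 1 ∧ Gap k (1 - p.1 1) ∧ q.1 = p.1 - ![1, shift k]) := by
  have ea : ∀ {a b : ℝ}, q.1 = p.1 + ![a, b] ↔ q.1 0 = p.1 0 + a ∧ q.1 1 = p.1 1 + b := by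
    intro a b
    constructor
    · intro h
      simp [h]
    · rintro ⟨h, h'⟩
      ext i
      fin_cases i <;> simpa
  have es : ∀ {a b : ℝ}, q.1 = p.1 - ![a, b] ↔ q.1 0 = p.1 0 - a ∧ q.1 1 = p.1 1 - b := by
    intro a b
    constructor
    · intro h
      simp [h]
    · rintro ⟨h, h'⟩
      ext i
      fin_cases i <;> simpa
  rw [Partner, glue_iff, glue_iff]
  simp only [ea, es]
  constructor
  · rintro (⟨k, ⟨h1, h2, h3, h4⟩ | ⟨h1, h2, h3, h4⟩⟩ | ⟨k, ⟨h1, h2, h3, h4⟩ | ⟨h1, h2, h3, h4⟩⟩)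
    · exact ⟨k, Or.inl ⟨h1, h2, h3, by linarith⟩⟩
    · exact ⟨k, Or.inr (Or.inl ⟨h1, h2, by linarith, h4⟩)⟩
    · exact ⟨k, Or.inr (Or.inr (Or.inl ⟨h4, by rwa [h3, gap_one_sub_add_shift], by linarith,
        by linarith⟩))⟩
    · exact ⟨k, Or.inr (Or.inr (Or.inr ⟨h3, by rwa [h4, gap_one_sub_add_shift], by linarith,
        by linarith⟩))⟩
  · rintro ⟨k, ⟨h1, h2, h3, h4⟩ | ⟨h1, h2, h3, h4⟩ | ⟨h1, h2, h3, h4⟩ | ⟨h1, h2, h3, h4⟩⟩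
    · exact Or.inl ⟨k, Or.inl ⟨h1, h2, h3, by linarith⟩⟩
    · exact Or.inl ⟨k, Or.inr ⟨h1, h2, by linarith, h4⟩⟩
    · refine Or.inr ⟨k, Or.inl ⟨by linarith, ?_, by linarith, h1⟩⟩
      rw [← gap_one_sub_add_shift, h3]
      simpa using h2
    · refine Or.inr ⟨k, Or.inr ⟨by linarith, ?_, h1, by linarith⟩⟩
      rw [← gap_one_sub_add_shift, h4]
      simpa using h2

/-- A boundary point of `Q` lies on one side only, in one segment only. -/
theorem Partner.unique {p q q' : Q} (h : Partner p q) (h' : Partner p q') : q = q' := by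
  rw [partner_iff] at h h'
  obtain ⟨k, h⟩ := h
  obtain ⟨l, h'⟩ := h'
  apply Subtype.ext
  rcases h with ⟨h1, h2, h3⟩ | ⟨h1, h2, h3⟩ | ⟨h1, h2, h3⟩ | ⟨h1, h2, h3⟩ <;>
  rcases h' with ⟨h1', h2', h3'⟩ | ⟨h1', h2', h3'⟩ | ⟨h1', h2', h3'⟩ | ⟨h1', h2', h3'⟩ <;>
  first
  | (have := h2.unique h2'; subst this; rw [h3, h3'])
  | (exfalso; linarith [h2.pos, h2.lt_one, h2'.pos, h2'.lt_one])

theorem mk_eq_mk_iff {p q : Q} : Quot.mk Glue p = Quot.mk Glue q ↔ p = q ∨ Partner p q := by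
  refine ⟨fun h' => ?_, ?_⟩
  · have h := Quot.eqvGen_exact h'
    clear h'
    induction h with
    | rel x y h => exact Or.inr (Or.inl h)
    | refl x => exact Or.inl rfl
    | symm x y _ ih => exact ih.imp Eq.symm Partner.symm
    | trans x y z _ _ h1 h2 =>
      rcases h1 with rfl | h1
      · exact h2
      rcases h2 with rfl | h2
      · exact Or.inr h1
      exact Or.inl (h1.symm.unique h2)
  · rintro (rfl | h | h)
    · rfl
    · exact Quot.sound h
    · exact (Quot.sound h).symm

/-- Gluing is locally constant: near `p`, the partner of a point `r` differs from `r` by the same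
vector as the partner of `p` differs from `p`. In particular the segments are locally finite in
`Q`, since they accumulate only at the removed corners. -/
theorem eventually_partner (p : Q) :
    ∀ᶠ r : Q in 𝓝 p, ∀ r', Partner r r' → ∃ p', Partner p p' ∧ p'.1 - p.1 = r'.1 - r.1 := by
  have hp := mem_Q_iff.1 p.2
  have c0 : Continuous fun r : Q => r.1 0 := (continuous_apply 0).comp continuous_subtype_val
  have c1 : Continuous fun r : Q => r.1 1 := (continuous_apply 1).comp continuous_subtype_val
  -- near `p`, no point lies on a side not containing `p`, and on a side containing `p` the
  -- nearby points are in the same segment as `p`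
  have key : ∀ (f g : Q → ℝ) (c : ℝ), Continuous f → Continuous g → (f p = c → ∃ k, Gap k (g p)) →
      ∀ᶠ r in 𝓝 p, f r = c → ∃ k, f p = c ∧ Gap k (g p) ∧ Gap k (g r) := by
    intro f g c hf hg h
    by_cases hc : f p = c
    · obtain ⟨k, hk⟩ := h hc
      filter_upwards [hg.continuousAt.eventually ((Gap.isOpen k).mem_nhds hk)] with r hr _
      exact ⟨k, hc, hk, hr⟩
    · filter_upwards [hf.continuousAt.eventually (isOpen_ne.mem_nhds hc)] with r hr h'
      exact absurd h' hr
  filter_upwards [key _ _ 0 c1 c0 hp.2.1, key _ _ 0 c0 c1 hp.2.2.2.1,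
    key _ (fun r : Q => 1 - r.1 0) 1 c1 (continuous_const.sub c0) hp.2.2.1,
    key _ (fun r : Q => 1 - r.1 1) 1 c0 (continuous_const.sub c1) hp.2.2.2.2]
    with r k1 k2 k3 k4 r' hr
  have hQ : ∀ v : Fin 2 → ℝ, p.1 + v ∈ Q → (∀ hv : p.1 + v ∈ Q, Partner p ⟨p.1 + v, hv⟩) →
      r'.1 = r.1 + v → ∃ p', Partner p p' ∧ p'.1 - p.1 = r'.1 - r.1 := fun v hv hP e =>
    ⟨⟨p.1 + v, hv⟩, hP hv, by simp [e]⟩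
  obtain ⟨k, ⟨h1, h2, h3⟩ | ⟨h1, h2, h3⟩ | ⟨h1, h2, h3⟩ | ⟨h1, h2, h3⟩⟩ := partner_iff.1 hr
  · obtain ⟨l, e1, e2, e3⟩ := k1 h1
    obtain rfl := h2.unique e3
    refine hQ _ ?_ (fun hv => partner_iff.2 ⟨k, Or.inl ⟨e1, e2, rfl⟩⟩) h3
    have e4 := gap_one_sub_add_shift.2 e2
    have := e4.pos
    have := e4.lt_one
    rw [mem_Q_iff]
    simp only [Pi.add_apply, Matrix.cons_val_zero, Matrix.cons_val_one, e1, zero_add]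
    refine ⟨⟨by linarith, by linarith, by norm_num, le_rfl⟩, by norm_num, fun _ => ⟨k, e4⟩,
      fun h => by linarith, fun h => by linarith⟩
  · obtain ⟨l, e1, e2, e3⟩ := k2 h1
    obtain rfl := h2.unique e3
    refine hQ _ ?_ (fun hv => partner_iff.2 ⟨k, Or.inr (Or.inl ⟨e1, e2, rfl⟩)⟩) h3
    have e4 := gap_one_sub_add_shift.2 e2
    have := e4.pos
    have := e4.lt_one
    rw [mem_Q_iff]
    simp only [Pi.add_apply, Matrix.cons_val_zero, Matrix.cons_val_one, e1, zero_add]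
    refine ⟨⟨by norm_num, le_rfl, by linarith, by linarith⟩, fun h => by linarith,
      fun h => by linarith, by norm_num, fun _ => ⟨k, e4⟩⟩
  · obtain ⟨l, e1, e2, e3⟩ := k3 h1
    obtain rfl := h2.unique e3
    refine hQ (-![shift k, 1]) ?_ (fun hv => partner_iff.2
      ⟨k, Or.inr (Or.inr (Or.inl ⟨e1, e2, by simp [sub_eq_add_neg]⟩))⟩) (by rw [h3, sub_eq_add_neg])
    have e4 : Gap k (p.1 0 + -shift k) := by
      rw [← gap_one_sub_add_shift]
      simpa using e2
    have := e4.pos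
    have := e4.lt_one
    rw [mem_Q_iff]
    simp only [Pi.add_apply, Pi.neg_apply, Matrix.cons_val_zero, Matrix.cons_val_one, e1]
    refine ⟨⟨by linarith, by linarith, by norm_num, by norm_num⟩, fun _ => ⟨k, e4⟩, by norm_num,
      fun h => by linarith, fun h => by linarith⟩
  · obtain ⟨l, e1, e2, e3⟩ := k4 h1
    obtain rfl := h2.unique e3
    refine hQ (-![1, shift k]) ?_ (fun hv => partner_iff.2
      ⟨k, Or.inr (Or.inr (Or.inr ⟨e1, e2, by simp [sub_eq_add_neg]⟩))⟩) (by rw [h3, sub_eq_add_neg])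
    have e4 : Gap k (p.1 1 + -shift k) := by
      rw [← gap_one_sub_add_shift]
      simpa using e2
    have := e4.pos
    have := e4.lt_one
    rw [mem_Q_iff]
    simp only [Pi.add_apply, Pi.neg_apply, Matrix.cons_val_zero, Matrix.cons_val_one, e1]
    refine ⟨⟨by norm_num, by norm_num, by linarith, by linarith⟩, fun h => by linarith,
      fun h => by linarith, fun _ => ⟨k, e4⟩, by norm_num⟩

/-! ### The quotient map -/

/-- The quotient map from the square to the surface. -/
abbrev proj (p : Q) : Surface := Quot.mk Glue p

theorem continuous_proj : Continuous proj := continuous_quot_mk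

theorem surjective_proj : Function.Surjective proj := Quot.mk_surjective

theorem isOpen_setOf_fiber_subset {N : Set Q} (hN : IsOpen N) :
    IsOpen {r : Q | ∀ r', proj r' = proj r → r' ∈ N} := by
  rw [isOpen_iff_eventually]
  intro p hp
  have h2 : ∀ p', Partner p p' → ∀ᶠ r : Q in 𝓝 p, ∀ r' : Q, r'.1 - r.1 = p'.1 - p.1 → r' ∈ N := by
    intro p' hpp
    have h3 : N ∈ 𝓝 p' := hN.mem_nhds (hp p' (mk_eq_mk_iff.2 (Or.inr hpp.symm)))
    rw [nhds_subtype_eq_comap, mem_comap] at h3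
    obtain ⟨t, ht, htN⟩ := h3
    have h4 : Tendsto (fun r : Q => r.1 + (p'.1 - p.1)) (𝓝 p) (𝓝 p'.1) := by
      have : Continuous fun r : Q => r.1 + (p'.1 - p.1) := by fun_prop
      simpa using this.tendsto p
    filter_upwards [h4 ht] with r hr r' hr'
    apply htN
    have : r'.1 = r.1 + (p'.1 - p.1) := by rw [← hr']; abel
    simpa [this] using hr
  have h5 : ∀ᶠ r : Q in 𝓝 p, ∀ p', Partner p p' → ∀ r' : Q, r'.1 - r.1 = p'.1 - p.1 → r' ∈ N := by
    by_cases h : ∃ p', Partner p p'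
    · obtain ⟨p', hp'⟩ := h
      filter_upwards [h2 p' hp'] with r hr p'' hp''
      rw [← hp'.unique hp'']
      exact hr
    · exact Eventually.of_forall fun r p' hp' => absurd ⟨p', hp'⟩ h
  filter_upwards [eventually_partner p, h5, hN.mem_nhds (hp p rfl)] with r hr hr5 hrN r' hr'
  rcases mk_eq_mk_iff.1 hr' with rfl | h
  · exact hrN
  · obtain ⟨p', hp', e⟩ := hr r' h.symm
    exact hr5 p' hp' r' e.symm

theorem isClosedMap_proj : IsClosedMap proj := by
  intro F hF
  have h := isOpen_setOf_fiber_subset hF.isOpen_compl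
  rw [← isOpen_compl_iff, ← isQuotientMap_quot_mk.isOpen_preimage]
  convert h using 1
  ext r
  simp only [mem_preimage, mem_compl_iff, mem_image, not_exists, not_and, mem_ofPred_eq]
  exact ⟨fun h r' e hr' => h r' hr' e, fun h r' hr' e => h r' e hr'⟩

theorem eventually_nhds_proj {p : Q} {P : Surface → Prop}
    (h : ∀ p', proj p' = proj p → ∀ᶠ r in 𝓝 p', P (proj r)) : ∀ᶠ y in 𝓝 (proj p), P y := by
  filter_upwards [isClosedMap_proj.eventually_nhds_fiber (proj p) (p := fun r => P (proj r)) h]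
    with y hy
  obtain ⟨r, rfl⟩ := surjective_proj y
  exact hy r rfl

theorem finite_fiber (y : Surface) : (proj ⁻¹' {y}).Finite := by
  obtain ⟨p, rfl⟩ := surjective_proj y
  by_cases h : ∃ p', Partner p p'
  · obtain ⟨p', hp'⟩ := h
    refine (Set.toFinite {p, p'}).subset fun r hr => ?_
    rcases mk_eq_mk_iff.1 hr with rfl | h
    · exact Or.inl rfl
    · exact Or.inr (h.symm.unique hp')
  · refine (Set.finite_singleton p).subset fun r hr => ?_
    rcases mk_eq_mk_iff.1 hr with rfl | h'
    · rfl
    · exact absurd ⟨r, h'.symm⟩ h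

theorem isProperMap_proj : IsProperMap proj :=
  isProperMap_iff_isClosedMap_and_compact_fibers.2
    ⟨continuous_proj, isClosedMap_proj, fun y => (finite_fiber y).isCompact⟩

instance : T2Space Surface := by
  refine t2Space_iff_disjoint_nhds.2 fun x y hxy => ?_
  have hd : Disjoint (proj ⁻¹' {x}) (proj ⁻¹' {y}) :=
    Disjoint.preimage _ (by simpa using hxy)
  obtain ⟨U, V, hU, hV, hxU, hyV, hUV⟩ := SeparatedNhds.of_isCompact_isCompact
    (finite_fiber x).isCompact (finite_fiber y).isCompact hd
  have key : ∀ {U : Set Q} {x : Surface}, IsOpen U → proj ⁻¹' {x} ⊆ U →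
      {y | ∀ r ∈ proj ⁻¹' {y}, r ∈ U} ∈ 𝓝 x := fun hU hx =>
    isClosedMap_proj.eventually_nhds_fiber _ fun r hr => hU.mem_nhds (hx hr)
  refine Filter.disjoint_iff.2 ⟨_, key hU hxU, _, key hV hyV,
    Set.disjoint_left.2 fun z hz hz' => ?_⟩
  obtain ⟨r, rfl⟩ := surjective_proj z
  exact Set.disjoint_left.1 hUV (hz r rfl) (hz' r rfl)

/-! ### The symmetry in the diagonal -/

/-- The reflection of the plane in the diagonal. -/
def planeSwap : (Fin 2 → ℝ) ≃ₜ (Fin 2 → ℝ) where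
  toFun p := ![p 1, p 0]
  invFun p := ![p 1, p 0]
  left_inv p := (vec_ext.2 ⟨rfl, rfl⟩).symm
  right_inv p := (vec_ext.2 ⟨rfl, rfl⟩).symm
  continuous_toFun := by fun_prop
  continuous_invFun := by fun_prop

@[simp] theorem planeSwap_zero (p : Fin 2 → ℝ) : planeSwap p 0 = p 1 := rfl

@[simp] theorem planeSwap_one (p : Fin 2 → ℝ) : planeSwap p 1 = p 0 := rfl

@[simp] theorem planeSwap_planeSwap (p : Fin 2 → ℝ) : planeSwap (planeSwap p) = p :=
  planeSwap.left_inv p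

theorem planeSwap_add (p q : Fin 2 → ℝ) : planeSwap (p + q) = planeSwap p + planeSwap q := by
  ext i
  fin_cases i <;> rfl

theorem planeSwap_sub (p q : Fin 2 → ℝ) : planeSwap (p - q) = planeSwap p - planeSwap q := by
  ext i
  fin_cases i <;> rfl

theorem planeSwap_mem {p : Fin 2 → ℝ} (h : p ∈ Q) : planeSwap p ∈ Q := by
  rw [mem_Q_iff] at h ⊢
  simp only [planeSwap_zero, planeSwap_one]
  tauto

/-- The reflection of `Q` in the diagonal. -/
def QSwap (p : Q) : Q := ⟨planeSwap p.1, planeSwap_mem p.2⟩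

@[simp] theorem QSwap_val (p : Q) : (QSwap p).1 = planeSwap p.1 := rfl

@[simp] theorem QSwap_QSwap (p : Q) : QSwap (QSwap p) = p := Subtype.ext (planeSwap_planeSwap _)

theorem continuous_QSwap : Continuous QSwap :=
  (planeSwap.continuous.comp continuous_subtype_val).subtype_mk _

theorem glue_QSwap {p q : Q} (h : Glue p q) : Glue (QSwap p) (QSwap q) := by
  rw [glue_iff] at h ⊢
  simp only [QSwap_val, planeSwap_zero, planeSwap_one]
  obtain ⟨k, h⟩ := h
  exact ⟨k, by tauto⟩

/-- The homeomorphism of the surface induced by the reflection of the square in the diagonal. -/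
def swap : Surface ≃ₜ Surface where
  toFun := Quot.map QSwap fun _ _ => glue_QSwap
  invFun := Quot.map QSwap fun _ _ => glue_QSwap
  left_inv := by
    rintro ⟨p⟩
    exact congrArg proj (QSwap_QSwap p)
  right_inv := by
    rintro ⟨p⟩
    exact congrArg proj (QSwap_QSwap p)
  continuous_toFun := continuous_quot_lift _ (continuous_proj.comp continuous_QSwap)
  continuous_invFun := continuous_quot_lift _ (continuous_proj.comp continuous_QSwap)

@[simp] theorem swap_proj (p : Q) : swap (proj p) = proj (QSwap p) := rfl

/-! ### Charts -/

theorem charts_eventually {e : OpenPartialHomeomorph Surface (Fin 2 → ℝ)} (he : e ∈ charts) {p : Q}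
    (hp : proj p ∈ e.source) :
    ∀ᶠ r : Q in 𝓝 p, e (proj r) = e (proj p) + (r.1 - p.1) := by
  obtain ⟨b, hb⟩ := he p hp
  have h0 : e (proj p) = p.1 + b := hb.self_of_nhds
  filter_upwards [hb] with r hr
  rw [h0]
  refine hr.trans ?_
  abel

theorem charts_compat : ∀ e ∈ charts, ∀ e' ∈ charts, ∀ x ∈ e.source ∩ e'.source,
    ∃ b : Fin 2 → ℝ, ∀ᶠ y in 𝓝 x, e' y = e y + b := by
  rintro e he e' he' x ⟨hx, hx'⟩
  refine ⟨e' x - e x, ?_⟩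
  obtain ⟨p, rfl⟩ := surjective_proj x
  refine eventually_nhds_proj fun p' hp' => ?_
  rw [← hp'] at hx hx' ⊢
  filter_upwards [charts_eventually he hx, charts_eventually he' hx'] with r h h'
  rw [h, h']
  abel

/-- A parametrisation `s` of a part of the surface that is locally a translation when read on `Q`
is the inverse of a chart. -/
theorem exists_chart {R : Set (Fin 2 → ℝ)} (hR : IsOpen R) {s : (Fin 2 → ℝ) → Surface}
    (hs : ContinuousOn s R) (hinj : InjOn s R)
    (h : ∀ v ∈ R, ∀ p : Q, proj p = s v → ∀ᶠ r : Q in 𝓝 p, s (v + (r.1 - p.1)) = proj r) :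
    ∃ e ∈ charts, e.target = R ∧ ∀ v ∈ R, s v ∈ e.source ∧ e (s v) = v ∧ e.symm v = s v := by
  have hlim : ∀ (v : Fin 2 → ℝ) (p : Q), Tendsto (fun r : Q => v + (r.1 - p.1)) (𝓝 p) (𝓝 v) := by
    intro v p
    have : Continuous fun r : Q => v + (r.1 - p.1) := by fun_prop
    simpa using this.tendsto p
  have hopen : IsOpenMap (R.domRestrict s) := by
    intro O hO
    rw [isOpen_iff_mem_nhds]
    rintro _ ⟨⟨v, hv⟩, hvO, rfl⟩
    obtain ⟨O', hO', rfl⟩ := hO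
    obtain ⟨p, hp⟩ := surjective_proj (s v)
    change ∀ᶠ y in 𝓝 (s v), _
    rw [← hp]
    refine eventually_nhds_proj fun p' hp' => ?_
    filter_upwards [h v hv p' (hp'.trans hp), hlim v p' ((hR.inter hO').mem_nhds ⟨hv, hvO⟩)]
      with r hr hrO
    exact ⟨⟨_, hrO.1⟩, hrO.2, hr⟩
  let e :=
    (OpenPartialHomeomorph.ofContinuousOpenRestrict (hinj.toPartialEquiv s R) hs hopen hR).symm
  have e1 : ∀ v ∈ R, s v ∈ e.source := fun v hv => ⟨v, hv, rfl⟩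
  have e2 : ∀ v ∈ R, e (s v) = v := fun v hv => e.symm.left_inv hv
  refine ⟨e, fun p hp => ?_, rfl, fun v hv => ⟨e1 v hv, e2 v hv, rfl⟩⟩
  obtain ⟨v, hv, hvp⟩ := hp
  refine ⟨v - p.1, ?_⟩
  filter_upwards [h v hv p hvp.symm, hlim v p (hR.mem_nhds hv)] with r hr hrR
  change e (proj r) = _
  rw [← hr, e2 _ hrR]
  exact add_sub_left_comm _ _ _

/-- The chart obtained from a chart by reflecting in the diagonal. -/
def swapChart (e : OpenPartialHomeomorph Surface (Fin 2 → ℝ)) :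
    OpenPartialHomeomorph Surface (Fin 2 → ℝ) :=
  (swap.toOpenPartialHomeomorph.trans e).trans planeSwap.toOpenPartialHomeomorph

theorem mem_swapChart_source {e : OpenPartialHomeomorph Surface (Fin 2 → ℝ)} {x : Surface} :
    x ∈ (swapChart e).source ↔ swap x ∈ e.source := by
  simp [swapChart]

theorem swapChart_mem {e : OpenPartialHomeomorph Surface (Fin 2 → ℝ)} (he : e ∈ charts) :
    swapChart e ∈ charts := by
  intro p hp
  rw [mem_swapChart_source] at hp
  refine ⟨planeSwap (e (proj (QSwap p))) - p.1, ?_⟩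
  filter_upwards [continuous_QSwap.continuousAt.eventually (charts_eventually he hp)] with r hr
  change planeSwap (e (proj (QSwap r))) = _
  rw [hr, planeSwap_add, planeSwap_sub, QSwap_val, QSwap_val, planeSwap_planeSwap,
    planeSwap_planeSwap]
  abel

/-- The open unit square. -/
def openSquare : Set (Fin 2 → ℝ) := {v | 0 < v 0 ∧ v 0 < 1 ∧ 0 < v 1 ∧ v 1 < 1}

theorem isOpen_openSquare : IsOpen openSquare := by
  have c0 : Continuous fun v : Fin 2 → ℝ => v 0 := continuous_apply 0
  have c1 : Continuous fun v : Fin 2 → ℝ => v 1 := continuous_apply 1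
  exact (isOpen_lt continuous_const c0).inter ((isOpen_lt c0 continuous_const).inter
    ((isOpen_lt continuous_const c1).inter (isOpen_lt c1 continuous_const)))

theorem openSquare_subset_Q : openSquare ⊆ Q := by
  rintro v ⟨h1, h2, h3, h4⟩
  exact mem_Q_iff.2 ⟨⟨h1.le, h2.le, h3.le, h4.le⟩, fun h => by linarith, fun h => by linarith,
    fun h => by linarith, fun h => by linarith⟩

theorem not_partner_of_mem_openSquare {p q : Q} (hp : p.1 ∈ openSquare) : ¬ Partner p q := by
  rw [partner_iff]
  obtain ⟨h1, h2, h3, h4⟩ := hp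
  rintro ⟨k, ⟨h, -, -⟩ | ⟨h, -, -⟩ | ⟨h, -, -⟩ | ⟨h, -, -⟩⟩ <;> linarith

theorem eq_of_proj_eq_of_mem_openSquare {p q : Q} (hp : p.1 ∈ openSquare) (h : proj q = proj p) :
    q = p := by
  rcases mk_eq_mk_iff.1 h.symm with h | h
  · exact h.symm
  · exact absurd h (not_partner_of_mem_openSquare hp)

open Classical in
/-- The quotient map, extended to the plane by a constant. -/
noncomputable def planeProj (v : Fin 2 → ℝ) : Surface :=
  if h : v ∈ Q then proj ⟨v, h⟩ else proj ⟨![1 / 2, 1 / 2], openSquare_subset_Q (by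
    simp [openSquare]; norm_num)⟩

theorem planeProj_of_mem {v : Fin 2 → ℝ} (h : v ∈ Q) : planeProj v = proj ⟨v, h⟩ := dif_pos h

@[simp] theorem planeProj_val (p : Q) : planeProj p.1 = proj p := dif_pos p.2

theorem continuousOn_planeProj : ContinuousOn planeProj Q := by
  rw [continuousOn_iff_continuous_domRestrict]
  convert continuous_proj using 1
  ext p
  exact planeProj_val p

/-- The interior of the square is a chart. -/
theorem exists_openSquare_chart : ∃ e ∈ charts, e.target = openSquare ∧
    ∀ v ∈ openSquare, planeProj v ∈ e.source ∧ e (planeProj v) = v ∧ e.symm v = planeProj v := by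
  refine exists_chart isOpen_openSquare (continuousOn_planeProj.mono openSquare_subset_Q) ?_ ?_
  · intro v hv w hw h
    rw [planeProj_of_mem (openSquare_subset_Q hv), planeProj_of_mem (openSquare_subset_Q hw)] at h
    exact (congrArg Subtype.val (eq_of_proj_eq_of_mem_openSquare hv h.symm)).symm
  · intro v hv p hp
    rw [planeProj_of_mem (openSquare_subset_Q hv)] at hp
    obtain rfl := eq_of_proj_eq_of_mem_openSquare hv hp
    exact Eventually.of_forall fun r => by simp

/-- The part of the plane above and below the interior of the segment `I₀ k`. -/
def column (k : ℕ) : Set (Fin 2 → ℝ) := {v | Gap k (v 0) ∧ -(1 / 2) < v 1 ∧ v 1 < 1 / 2}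

/-- The parametrisation of the surface near the interior of the segment `I₀ k`: the part of the
square just below `I₁ k` is translated to a position just below `I₀ k`. -/
noncomputable def columnProj (k : ℕ) (v : Fin 2 → ℝ) : Surface :=
  if 0 ≤ v 1 then planeProj v else planeProj (v + ![shift k, 1])

theorem isOpen_column (k : ℕ) : IsOpen (column k) := by
  have c0 : Continuous fun v : Fin 2 → ℝ => v 0 := continuous_apply 0
  have c1 : Continuous fun v : Fin 2 → ℝ => v 1 := continuous_apply 1
  exact ((Gap.isOpen k).preimage c0).inter
    ((isOpen_lt continuous_const c1).inter (isOpen_lt c1 continuous_const))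

theorem column_mem_Q {k : ℕ} {v : Fin 2 → ℝ} (hv : v ∈ column k) (h : 0 ≤ v 1) : v ∈ Q := by
  obtain ⟨h1, h2, h3⟩ := hv
  have := h1.pos
  have := h1.lt_one
  exact mem_Q_iff.2 ⟨⟨by linarith, by linarith, by linarith, by linarith⟩, fun _ => ⟨k, h1⟩,
    fun h => by linarith, fun h => by linarith, fun h => by linarith⟩

theorem column_add_mem_Q {k : ℕ} {v : Fin 2 → ℝ} (hv : v ∈ column k) (h : v 1 ≤ 0) :
    v + ![shift k, 1] ∈ Q := by
  obtain ⟨h1, h2, h3⟩ := hv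
  have h4 := gap_one_sub_add_shift.2 h1
  have := h4.pos
  have := h4.lt_one
  rw [mem_Q_iff]
  simp only [Pi.add_apply, Matrix.cons_val_zero, Matrix.cons_val_one]
  exact ⟨⟨by linarith, by linarith, by linarith, by linarith⟩, fun h => by linarith,
    fun h => ⟨k, h4⟩, fun h => by linarith, fun h => by linarith⟩

theorem columnProj_of_nonneg {k : ℕ} {v : Fin 2 → ℝ} (h : 0 ≤ v 1) :
    columnProj k v = planeProj v := if_pos h

theorem column_partner {k : ℕ} {v : Fin 2 → ℝ} (hv : v ∈ column k) (h : v 1 = 0) :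
    Partner ⟨v, column_mem_Q hv h.ge⟩ ⟨v + ![shift k, 1], column_add_mem_Q hv h.le⟩ :=
  partner_iff.2 ⟨k, Or.inl ⟨h, hv.1, rfl⟩⟩

theorem columnProj_of_nonpos {k : ℕ} {v : Fin 2 → ℝ} (hv : v ∈ column k) (h : v 1 ≤ 0) :
    columnProj k v = planeProj (v + ![shift k, 1]) := by
  rcases h.lt_or_eq with h | h
  · exact if_neg (not_le.2 h)
  · rw [columnProj_of_nonneg h.ge, planeProj_of_mem (column_mem_Q hv h.ge),
      planeProj_of_mem (column_add_mem_Q hv h.le)]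
    exact mk_eq_mk_iff.2 (Or.inr (column_partner hv h))

theorem continuousOn_columnProj (k : ℕ) : ContinuousOn (columnProj k) (column k) := by
  have c1 : Continuous fun v : Fin 2 → ℝ => v 1 := continuous_apply 1
  refine ContinuousOn.if ?_ ?_ ?_
  · rintro v ⟨hv, h⟩
    have h : 0 = v 1 := frontier_le_subset_eq continuous_const c1 h
    rw [← columnProj_of_nonpos hv h.ge, columnProj_of_nonneg h.le]
  · refine continuousOn_planeProj.mono ?_
    rintro v ⟨hv, h⟩
    rw [closure_le_eq continuous_const c1] at h
    exact column_mem_Q hv h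
  · refine ContinuousOn.comp (t := Q) continuousOn_planeProj (by fun_prop) ?_
    rintro v ⟨hv, h⟩
    simp only [not_le] at h
    exact column_add_mem_Q hv (closure_lt_subset_le c1 continuous_const h)

/-- The interior of a horizontal segment has a neighbourhood that is a chart. -/
theorem exists_column_chart (k : ℕ) : ∃ e ∈ charts, e.target = column k ∧
    ∀ v ∈ column k, columnProj k v ∈ e.source ∧ e (columnProj k v) = v ∧
      e.symm v = columnProj k v := by
  -- away from `v 1 = 0` both formulas for `columnProj` take values in the open square
  have hpos : ∀ {v}, v ∈ column k → 0 < v 1 → v ∈ openSquare := fun hv h =>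
    ⟨hv.1.pos, hv.1.lt_one, h, by linarith [hv.2.2]⟩
  have hneg : ∀ {v}, v ∈ column k → v 1 < 0 → v + ![shift k, 1] ∈ openSquare := fun hv h => by
    have h4 := gap_one_sub_add_shift.2 hv.1
    have := h4.pos
    have := h4.lt_one
    have := hv.2.1
    simp only [openSquare, Set.mem_ofPred_eq, Pi.add_apply, Matrix.cons_val_zero,
      Matrix.cons_val_one]
    exact ⟨by linarith, by linarith, by linarith, by linarith⟩
  refine exists_chart (isOpen_column k) (continuousOn_columnProj k) ?_ ?_
  · have main : ∀ v ∈ column k, ∀ w ∈ column k, v 1 ≤ w 1 → columnProj k v = columnProj k w →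
        v = w := by
      intro v hv w hw hvw h
      rcases lt_or_ge (v 1) 0 with hv0 | hv0
      · rw [columnProj_of_nonpos hv hv0.le, planeProj_of_mem (column_add_mem_Q hv hv0.le)] at h
        rcases le_or_gt 0 (w 1) with hw0 | hw0
        · rw [columnProj_of_nonneg hw0, planeProj_of_mem (column_mem_Q hw hw0)] at h
          have := congrArg Subtype.val (eq_of_proj_eq_of_mem_openSquare (hneg hv hv0) h.symm)
          have h1 := congrFun this 1
          simp at h1
          linarith [hw.2.2, hv.2.1]
        · rw [columnProj_of_nonpos hw hw0.le, planeProj_of_mem (column_add_mem_Q hw hw0.le)] at h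
          have := congrArg Subtype.val (eq_of_proj_eq_of_mem_openSquare (hneg hv hv0) h.symm)
          exact (add_right_cancel this).symm
      · rw [columnProj_of_nonneg hv0, planeProj_of_mem (column_mem_Q hv hv0),
          columnProj_of_nonneg (hv0.trans hvw), planeProj_of_mem (column_mem_Q hw (hv0.trans hvw))]
          at h
        rcases (hv0.trans hvw).lt_or_eq with hw0 | hw0
        · exact congrArg Subtype.val (eq_of_proj_eq_of_mem_openSquare (hpos hw hw0) h)
        · have hv1 : v 1 = 0 := le_antisymm (hvw.trans hw0.ge) hv0
          rcases mk_eq_mk_iff.1 h with h | h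
          · exact congrArg Subtype.val h
          · have := congrArg Subtype.val (h.unique (column_partner hv hv1))
            have := congrFun this 1
            simp at this
            linarith
    intro v hv w hw h
    rcases le_total (v 1) (w 1) with h' | h'
    · exact main v hv w hw h' h
    · exact (main w hw v hv h' h.symm).symm
  · intro v hv p hp
    have cr : Continuous fun r : Q => v + (r.1 - p.1) := by fun_prop
    have hlim : Tendsto (fun r : Q => v + (r.1 - p.1)) (𝓝 p) (𝓝 v) := by
      simpa using cr.tendsto p
    have hcol := hlim.eventually ((isOpen_column k).mem_nhds hv)
    have c1 : Continuous fun v : Fin 2 → ℝ => v 1 := continuous_apply 1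
    -- the two possible positions of `p` relative to `v`
    have hA : ∀ h : 0 ≤ v 1, p = ⟨v, column_mem_Q hv h⟩ →
        ∀ᶠ r : Q in 𝓝 p, columnProj k (v + (r.1 - p.1)) = proj r := by
      rintro h rfl
      exact Eventually.of_forall fun r => by
        simp [columnProj_of_nonneg (Q_bounds r).2.2.1]
    have hB : ∀ h : v 1 ≤ 0, p = ⟨v + ![shift k, 1], column_add_mem_Q hv h⟩ →
        ∀ᶠ r : Q in 𝓝 p, columnProj k (v + (r.1 - p.1)) = proj r := by
      rintro h rfl
      filter_upwards [hcol] with r hr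
      have e : v + (r.1 - (v + ![shift k, 1])) = r.1 - ![shift k, 1] := by abel
      simp only [e] at hr ⊢
      rw [columnProj_of_nonpos hr (by simpa using (Q_bounds r).2.2.2), sub_add_cancel,
        planeProj_val]
    rcases lt_trichotomy (v 1) 0 with h | h | h
    · refine hB h.le ?_
      rw [columnProj_of_nonpos hv h.le, planeProj_of_mem (column_add_mem_Q hv h.le)] at hp
      exact eq_of_proj_eq_of_mem_openSquare (hneg hv h) hp
    · rw [columnProj_of_nonneg h.ge, planeProj_of_mem (column_mem_Q hv h.ge)] at hp
      rcases mk_eq_mk_iff.1 hp with h' | h'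
      · exact hA h.ge h'
      · exact hB h.le (h'.symm.unique (column_partner hv h))
    · refine hA h.le ?_
      rw [columnProj_of_nonneg h.le, planeProj_of_mem (column_mem_Q hv h.le)] at hp
      exact eq_of_proj_eq_of_mem_openSquare (hpos hv h) hp

theorem exists_mem_charts (x : Surface) : ∃ e ∈ charts, x ∈ e.source := by
  -- it suffices to consider the bottom side, up to replacing a point by its partner and reflecting
  have hbot : ∀ p : Q, p.1 1 = 0 → ∃ e ∈ charts, proj p ∈ e.source := by
    intro p hp
    obtain ⟨k, hk⟩ := (mem_Q_iff.1 p.2).2.1 hp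
    obtain ⟨e, he, -, h⟩ := exists_column_chart k
    have := (h p.1 ⟨hk, by rw [hp]; norm_num, by rw [hp]; norm_num⟩).1
    rw [columnProj_of_nonneg hp.ge, planeProj_val] at this
    exact ⟨e, he, this⟩
  have hhor : ∀ p : Q, p.1 1 = 0 ∨ p.1 1 = 1 → ∃ e ∈ charts, proj p ∈ e.source := by
    rintro p (hp | hp)
    · exact hbot p hp
    · obtain ⟨k, hk⟩ := (mem_Q_iff.1 p.2).2.2.1 hp
      have hk' : Gap k (p.1 0 - shift k) := by
        rw [← gap_one_sub_add_shift]
        simpa using hk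
      have hQ : ![p.1 0 - shift k, 0] ∈ Q := by
        have := hk'.pos
        have := hk'.lt_one
        rw [mem_Q_iff]
        simp only [Matrix.cons_val_zero, Matrix.cons_val_one]
        exact ⟨⟨by linarith, by linarith, le_rfl, by norm_num⟩, fun _ => ⟨k, hk'⟩, by norm_num,
          fun h => by linarith, fun h => by linarith⟩
      have hP : Partner p ⟨_, hQ⟩ := partner_iff.2 ⟨k, Or.inr (Or.inr (Or.inl ⟨hp, hk, by
        symm
        ext i
        fin_cases i <;> simp [hp]⟩))⟩
      rw [show proj p = proj ⟨_, hQ⟩ from mk_eq_mk_iff.2 (Or.inr hP)]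
      exact hbot _ (by simp)
  obtain ⟨p, rfl⟩ := surjective_proj x
  by_cases h1 : p.1 1 = 0 ∨ p.1 1 = 1
  · exact hhor p h1
  by_cases h0 : p.1 0 = 0 ∨ p.1 0 = 1
  · obtain ⟨e, he, h⟩ := hhor (QSwap p) h0
    exact ⟨swapChart e, swapChart_mem he, mem_swapChart_source.2 h⟩
  · push Not at h0 h1
    obtain ⟨b1, b2, b3, b4⟩ := Q_bounds p
    have hp : p.1 ∈ openSquare := ⟨lt_of_le_of_ne b1 h0.1.symm, lt_of_le_of_ne b2 h0.2,
      lt_of_le_of_ne b3 h1.1.symm, lt_of_le_of_ne b4 h1.2⟩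
    obtain ⟨e, he, -, h⟩ := exists_openSquare_chart
    exact ⟨e, he, by simpa using (h p.1 hp).1⟩

/-- The charts make the surface a charted space, hence locally compact. -/
noncomputable instance : ChartedSpace (Fin 2 → ℝ) Surface where
  atlas := charts
  chartAt x := (exists_mem_charts x).choose
  mem_chart_source x := (exists_mem_charts x).choose_spec.2
  chart_mem_atlas x := (exists_mem_charts x).choose_spec.1

instance : LocallyCompactSpace Surface := ChartedSpace.locallyCompactSpace (Fin 2 → ℝ) Surface

instance : SecondCountableTopology Surface := by
  have : LindelofSpace Surface := ⟨by
    rw [← surjective_proj.range_eq]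
    exact isLindelof_range continuous_proj⟩
  obtain ⟨t, ht, h⟩ := countable_cover_nhds fun x : Surface =>
    (chartAt (Fin 2 → ℝ) x).open_source.mem_nhds (mem_chart_source (Fin 2 → ℝ) x)
  exact ChartedSpace.secondCountable_of_countable_cover (Fin 2 → ℝ) h ht

/-- The Chamanara surface as a translation surface without singularities. -/
def translationSurface : TranslationSurface Surface where
  t2 := inferInstance
  secondCountable := inferInstance
  locally_plane x := ⟨chartAt _ x, mem_chart_source _ x⟩
  sing := ∅
  isClosed_sing := isClosed_empty
  discrete_sing := inferInstance
  charts := charts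
  covers x := by simpa using exists_mem_charts x
  compat := charts_compat

/-! ### The affine homeomorphism -/

/-- `planeMap` on the lower half of the square. -/
noncomputable def lowMap (v : Fin 2 → ℝ) : Fin 2 → ℝ := ![v 0 / 2 + 1 / 2, 2 * v 1]

/-- `planeMap` on the upper half of the square. -/
noncomputable def highMap (v : Fin 2 → ℝ) : Fin 2 → ℝ := ![v 0 / 2, 2 * v 1 - 1]

theorem continuous_lowMap : Continuous lowMap := by
  unfold lowMap
  fun_prop

theorem continuous_highMap : Continuous highMap := by
  unfold highMap
  fun_prop

theorem gap_succ_iff {k : ℕ} {x : ℝ} : Gap (k + 1) (x / 2 + 1 / 2) ↔ Gap k x := by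
  have h1 : ((1 : ℝ) / 2) ^ (k + 1) = (1 / 2) ^ k / 2 := by ring
  have h2 : ((1 : ℝ) / 2) ^ (k + 1 + 1) = (1 / 2) ^ k / 4 := by ring
  unfold Gap
  rw [h2, h1]
  constructor <;> rintro ⟨h1, h2⟩ <;> constructor <;> linarith

theorem gap_zero_iff {x : ℝ} : Gap 0 x ↔ 0 < x ∧ x < 1 / 2 := by
  unfold Gap
  norm_num

/-- A point of a segment in the right half comes from a larger segment. -/
theorem Gap.two_mul {k : ℕ} {x : ℝ} (h : Gap k x) (hx : 1 / 2 ≤ x) :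
    ∃ l, k = l + 1 ∧ Gap l (2 * x - 1) := by
  cases k with
  | zero => linarith [(gap_zero_iff.1 h).2]
  | succ l =>
    refine ⟨l, rfl, ?_⟩
    rw [← gap_succ_iff]
    convert h using 1
    ring

theorem shift_succ (k : ℕ) : shift (k + 1) = shift k / 2 - 1 / 2 := by
  unfold shift
  ring

theorem shift_zero : shift 0 = 1 / 2 := by
  unfold shift
  norm_num

theorem lowMap_mem {v : Fin 2 → ℝ} (hv : v ∈ Q) (h : v 1 ≤ 1 / 2) : lowMap v ∈ Q := by
  obtain ⟨⟨b1, b2, b3, b4⟩, c1, c2, c3, c4⟩ := mem_Q_iff.1 hv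
  rw [mem_Q_iff]
  simp only [lowMap, Matrix.cons_val_zero, Matrix.cons_val_one]
  refine ⟨⟨by linarith, by linarith, by linarith, by linarith⟩, fun e => ?_, fun e => ⟨0, ?_⟩,
    fun e => by linarith, fun e => ?_⟩
  · obtain ⟨k, hk⟩ := c1 (by linarith)
    exact ⟨k + 1, gap_succ_iff.2 hk⟩
  · -- the end points of the segment `v 1 = 1 / 2` are removed
    have e : v 1 = 1 - (1 / 2) ^ 1 := by linarith
    rw [gap_zero_iff]
    constructor
    · have : v 0 ≠ 1 := fun h' => by
        obtain ⟨k, hk⟩ := c4 h'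
        exact hk.ne 1 (by linarith)
      have := lt_of_le_of_ne b2 this
      linarith
    · have : v 0 ≠ 0 := fun h' => by
        obtain ⟨k, hk⟩ := c3 h'
        exact hk.ne 1 e
      have := lt_of_le_of_ne b1 this.symm
      linarith
  · obtain ⟨k, hk⟩ := c4 (by linarith)
    obtain ⟨l, -, hl⟩ := hk.two_mul (by linarith)
    exact ⟨l, by convert hl using 1; ring⟩

theorem highMap_mem {v : Fin 2 → ℝ} (hv : v ∈ Q) (h : 1 / 2 ≤ v 1) : highMap v ∈ Q := by
  obtain ⟨⟨b1, b2, b3, b4⟩, c1, c2, c3, c4⟩ := mem_Q_iff.1 hv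
  rw [mem_Q_iff]
  simp only [highMap, Matrix.cons_val_zero, Matrix.cons_val_one]
  refine ⟨⟨by linarith, by linarith, by linarith, by linarith⟩, fun e => ⟨0, ?_⟩, fun e => ?_,
    fun e => ?_, fun e => by linarith⟩
  · have e : v 1 = 1 - (1 / 2) ^ 1 := by linarith
    rw [gap_zero_iff]
    constructor
    · have : v 0 ≠ 0 := fun h' => by
        obtain ⟨k, hk⟩ := c3 h'
        exact hk.ne 1 e
      have := lt_of_le_of_ne b1 this.symm
      linarith
    · have : v 0 ≠ 1 := fun h' => by
        obtain ⟨k, hk⟩ := c4 h'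
        exact hk.ne 1 (by linarith)
      have := lt_of_le_of_ne b2 this
      linarith
  · obtain ⟨k, hk⟩ := c2 (by linarith)
    exact ⟨k + 1, by
      rw [show 1 - v 0 / 2 = (1 - v 0) / 2 + 1 / 2 by ring]
      exact gap_succ_iff.2 hk⟩
  · obtain ⟨k, hk⟩ := c3 (by linarith)
    obtain ⟨l, -, hl⟩ := hk.two_mul h
    exact ⟨l, hl⟩

/-- The images of the two halves of the square agree along their common side. -/
theorem planeProj_lowMap_eq {v : Fin 2 → ℝ} (hv : v ∈ Q) (h : v 1 = 1 / 2) :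
    planeProj (lowMap v) = planeProj (highMap v) := by
  rw [planeProj_of_mem (lowMap_mem hv h.le), planeProj_of_mem (highMap_mem hv h.ge)]
  refine mk_eq_mk_iff.2 (Or.inr (Or.inr (glue_iff.2 ⟨0, Or.inl ⟨?_, ?_, ?_, ?_⟩⟩)))
  · simp [highMap, h]
  · obtain ⟨k, hk⟩ := (mem_Q_iff.1 (highMap_mem hv h.ge)).2.1 (by simp [highMap, h])
    -- the interval is the `0`-th one because `highMap v 0 = v 0 / 2 ≤ 1 / 2`
    have h1 : highMap v 0 = v 0 / 2 := rfl
    refine gap_zero_iff.2 ⟨hk.pos, lt_of_le_of_ne ?_ ?_⟩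
    · have := (mem_Q_iff.1 hv).1.2.1
      simp only [highMap, Matrix.cons_val_zero]
      linarith
    · have := hk.ne 1
      norm_num at this ⊢
      exact this
  · simp [highMap, lowMap, shift_zero]
  · simp [lowMap, h]

theorem planeProj_planeMap_of_le {v : Fin 2 → ℝ} (hv : v ∈ Q) (h : v 1 ≤ 1 / 2) :
    planeProj (planeMap v) = planeProj (lowMap v) := by
  rcases h.lt_or_eq with h | h
  · exact congrArg planeProj (if_pos h)
  · rw [planeProj_lowMap_eq hv h]
    exact congrArg planeProj (if_neg h.not_lt)

theorem planeProj_planeMap_of_ge {v : Fin 2 → ℝ} (h : 1 / 2 ≤ v 1) :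
    planeProj (planeMap v) = planeProj (highMap v) :=
  congrArg planeProj (if_neg (not_lt.2 h))

theorem continuous_planeProj_planeMap : Continuous fun p : Q => planeProj (planeMap p.1) := by
  have c1 : Continuous fun p : Q => p.1 1 := (continuous_apply 1).comp continuous_subtype_val
  have h : (fun p : Q => planeProj (planeMap p.1)) = fun p : Q =>
      if p.1 1 ≤ 1 / 2 then planeProj (lowMap p.1) else planeProj (highMap p.1) := by
    ext p
    split_ifs with h
    · exact planeProj_planeMap_of_le p.2 h
    · exact planeProj_planeMap_of_ge (not_le.1 h).le
  rw [h]
  refine continuous_if ?_ ?_ ?_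
  · intro p hp
    exact planeProj_lowMap_eq p.2 (frontier_le_subset_eq c1 continuous_const hp)
  · refine ContinuousOn.comp (t := Q) continuousOn_planeProj
      (continuous_lowMap.comp continuous_subtype_val).continuousOn ?_
    intro p hp
    rw [closure_le_eq c1 continuous_const] at hp
    exact lowMap_mem p.2 hp
  · refine ContinuousOn.comp (t := Q) continuousOn_planeProj
      (continuous_highMap.comp continuous_subtype_val).continuousOn ?_
    intro p hp
    simp only [not_le] at hp
    exact highMap_mem p.2 (closure_lt_subset_le continuous_const c1 hp)

theorem planeProj_planeMap_eq_of_glue {p q : Q} (h : Glue p q) :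
    planeProj (planeMap p.1) = planeProj (planeMap q.1) := by
  obtain ⟨k, ⟨h1, h2, h3, h4⟩ | ⟨h1, h2, h3, h4⟩⟩ := glue_iff.1 h
  · have hp : p.1 1 ≤ 1 / 2 := by linarith
    have hq : 1 / 2 ≤ q.1 1 := by linarith
    rw [planeProj_planeMap_of_le p.2 hp, planeProj_planeMap_of_ge hq,
      planeProj_of_mem (lowMap_mem p.2 hp), planeProj_of_mem (highMap_mem q.2 hq)]
    refine Quot.sound (glue_iff.2 ⟨k + 1, Or.inl ⟨?_, ?_, ?_, ?_⟩⟩)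
    · simp [lowMap, h1]
    · exact gap_succ_iff.2 h2
    · simp only [lowMap, highMap, Matrix.cons_val_zero, h3, shift_succ]
      ring
    · simp only [highMap, Matrix.cons_val_one, h4]
      norm_num
  · rcases lt_or_ge (p.1 1) (1 / 2) with hp | hp
    · -- the `0`-th vertical segments are both mapped to the vertical line through `1 / 2`
      obtain rfl := h2.unique (gap_zero_iff.2 ⟨h2.pos, hp⟩)
      rw [shift_zero] at h4
      rw [planeProj_planeMap_of_le p.2 hp.le, planeProj_planeMap_of_ge (by linarith [h2.pos])]
      congr 1
      rw [highMap, vec_ext]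
      simp only [lowMap, Matrix.cons_val_zero, Matrix.cons_val_one, h1, h3, h4]
      constructor <;> ring
    · obtain ⟨l, rfl, hl⟩ := h2.two_mul hp
      have hl' := gap_one_sub_add_shift.2 hl
      have hq : q.1 1 ≤ 1 / 2 := by
        rw [h4, shift_succ]
        linarith [hl'.pos]
      rw [planeProj_planeMap_of_ge hp, planeProj_planeMap_of_le q.2 hq,
        planeProj_of_mem (highMap_mem p.2 hp), planeProj_of_mem (lowMap_mem q.2 hq)]
      refine Quot.sound (glue_iff.2 ⟨l, Or.inr ⟨?_, ?_, ?_, ?_⟩⟩)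
      · simp [highMap, h1]
      · exact hl
      · simp [lowMap, h3]
        norm_num
      · simp only [lowMap, highMap, Matrix.cons_val_one, Matrix.cons_val_zero, h4, shift_succ]
        ring

/-- The underlying map of `phi`. -/
noncomputable def phiFun : Surface → Surface :=
  Quot.lift (fun p => planeProj (planeMap p.1)) fun _ _ => planeProj_planeMap_eq_of_glue

theorem phiFun_of_le {p : Q} (h : p.1 1 ≤ 1 / 2) :
    phiFun (proj p) = proj ⟨lowMap p.1, lowMap_mem p.2 h⟩ :=
  (planeProj_planeMap_of_le p.2 h).trans (planeProj_of_mem _)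

theorem phiFun_of_ge {p : Q} (h : 1 / 2 ≤ p.1 1) :
    phiFun (proj p) = proj ⟨highMap p.1, highMap_mem p.2 h⟩ :=
  (planeProj_planeMap_of_ge h).trans (planeProj_of_mem _)

/-- The inverse of `phi` is its conjugate under the reflection in the diagonal. -/
theorem swap_phiFun_swap_phiFun (x : Surface) : swap (phiFun (swap (phiFun x))) = x := by
  obtain ⟨p, rfl⟩ := surjective_proj x
  obtain ⟨b1, b2, b3, b4⟩ := Q_bounds p
  rcases le_total (p.1 1) (1 / 2) with h | h
  · rw [phiFun_of_le h, swap_proj, phiFun_of_ge (by simp [lowMap]; linarith), swap_proj]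
    congr 1
    apply Subtype.ext
    ext i
    fin_cases i
    · simp [lowMap, highMap]; ring
    · simp [lowMap, highMap]
  · rw [phiFun_of_ge h, swap_proj, phiFun_of_le (by simp [highMap]; linarith), swap_proj]
    congr 1
    apply Subtype.ext
    ext i
    fin_cases i
    · simp [lowMap, highMap]; ring
    · simp [lowMap, highMap]; ring

/-- The affine homeomorphism of the Chamanara surface. -/
noncomputable def phi : Surface ≃ₜ Surface where
  toFun := phiFun
  invFun x := swap (phiFun (swap x))
  left_inv := swap_phiFun_swap_phiFun
  right_inv x := by
    have := swap_phiFun_swap_phiFun (swap x)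
    rw [← swap.injective.eq_iff]
    exact this
  continuous_toFun := continuous_quot_lift _ continuous_planeProj_planeMap
  continuous_invFun := swap.continuous.comp
    ((continuous_quot_lift _ continuous_planeProj_planeMap).comp swap.continuous)

theorem isPhi_phi : IsPhi phi := by
  intro p h0 h1
  rcases lt_or_ge (p.1 1) (1 / 2) with h | h
  · have e : planeMap p.1 = lowMap p.1 := if_pos h
    exact ⟨e ▸ lowMap_mem p.2 h.le, planeProj_of_mem _⟩
  · have e : planeMap p.1 = highMap p.1 := if_neg (not_lt.2 h)
    exact ⟨e ▸ highMap_mem p.2 h, planeProj_of_mem _⟩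

/-! ### Affine homeomorphisms read on the square -/

theorem charts_eventually_planeProj {e : OpenPartialHomeomorph Surface (Fin 2 → ℝ)}
    (he : e ∈ charts) {v : Fin 2 → ℝ} (hv : v ∈ Q) (h : planeProj v ∈ e.source) :
    ∀ᶠ w in 𝓝[Q] v, e (planeProj w) = e (planeProj v) + (w - v) := by
  rw [planeProj_of_mem hv] at h ⊢
  have := charts_eventually he h
  rw [nhdsWithin_eq_map_subtype_coe hv, eventually_map]
  filter_upwards [this] with r hr
  rw [planeProj_val, hr]

theorem hasLinearPart_iff {f : Surface ≃ₜ Surface} {A : Matrix (Fin 2) (Fin 2) ℝ} :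
    translationSurface.HasLinearPart f A ↔
      ∀ p : Q, ∀ e ∈ charts, f (proj p) ∈ e.source →
        ∀ᶠ r : Q in 𝓝 p, e (f (proj r)) = e (f (proj p)) + A *ᵥ (r.1 - p.1) := by
  constructor
  · rintro ⟨-, h⟩ p e' he' hp
    obtain ⟨e, he, hpe⟩ := exists_mem_charts (proj p)
    obtain ⟨b, hb⟩ := h e he e' he' _ hpe hp
    filter_upwards [continuous_proj.continuousAt.eventually hb, charts_eventually he hpe]
      with r hr hr'
    rw [hr, hb.self_of_nhds, hr', Matrix.mulVec_add]
    abel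
  · intro h
    refine ⟨fun x => Iff.rfl, fun e he e' he' x hx hx' => ⟨e' (f x) - A *ᵥ e x, ?_⟩⟩
    obtain ⟨p, rfl⟩ := surjective_proj x
    refine eventually_nhds_proj fun p' hp' => ?_
    rw [← hp'] at hx hx' ⊢
    filter_upwards [h p' e' he' hx', charts_eventually he hx] with r h1 h2
    rw [h1, h2, Matrix.mulVec_add]
    abel

theorem hasLinearPart_phi : translationSurface.HasLinearPart phi !![1 / 2, 0; 0, 2] := by
  rw [hasLinearPart_iff]
  intro p e he hp
  have c1 : Continuous fun r : Q => r.1 1 := (continuous_apply 1).comp continuous_subtype_val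
  have key : ∀ (m : (Fin 2 → ℝ) → Fin 2 → ℝ) (P : Q → Prop), Continuous m →
      (∀ r : Q, P r → m r.1 ∈ Q ∧ phi (proj r) = planeProj (m r.1)) →
      (∀ v w, m v - m w = !![1 / 2, 0; 0, 2] *ᵥ (v - w)) → (¬ P p → ∀ᶠ r in 𝓝 p, ¬ P r) →
      ∀ᶠ r : Q in 𝓝 p, P r →
        e (phi (proj r)) = e (phi (proj p)) + !![1 / 2, 0; 0, 2] *ᵥ (r.1 - p.1) := by
    intro m P hm hmP hA hP
    by_cases hp' : P p
    · obtain ⟨h1, h2⟩ := hmP p hp'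
      rw [h2] at hp ⊢
      have h3 := charts_eventually_planeProj he h1 hp
      rw [eventually_nhdsWithin_iff] at h3
      filter_upwards [(hm.comp continuous_subtype_val).continuousAt.eventually h3] with r hr hPr
      rw [(hmP r hPr).2, ← hA]
      exact hr (hmP r hPr).1
    · filter_upwards [hP hp'] with r hr hr'
      exact absurd hr' hr
  have h1 := key lowMap (fun r => r.1 1 ≤ 1 / 2) continuous_lowMap
    (fun r hr => ⟨lowMap_mem r.2 hr, planeProj_planeMap_of_le r.2 hr⟩) (fun v w => by
      ext i
      fin_cases i <;> simp [lowMap, Matrix.mulVec, dotProduct, Fin.sum_univ_two] <;> ring)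
    (fun h => by
      simp only [not_le] at h ⊢
      exact c1.continuousAt.eventually (isOpen_Ioi.mem_nhds h))
  have h2 := key highMap (fun r => 1 / 2 ≤ r.1 1) continuous_highMap
    (fun r hr => ⟨highMap_mem r.2 hr, planeProj_planeMap_of_ge hr⟩) (fun v w => by
      ext i
      fin_cases i <;> simp [highMap, Matrix.mulVec, dotProduct, Fin.sum_univ_two] <;> ring)
    (fun h => by
      simp only [not_le] at h ⊢
      exact c1.continuousAt.eventually (isOpen_Iio.mem_nhds h))
  filter_upwards [h1, h2] with r hr1 hr2
  exact (le_total (r.1 1) (1 / 2)).elim hr1 hr2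

/-- The hyperbolic matrix with diagonal entries `1 / 2` and `2`. -/
noncomputable def hyperbolic : GL(2, ℝ)⁺ :=
  ⟨Matrix.GeneralLinearGroup.mkOfDetNeZero !![1 / 2, 0; 0, 2] (by simp [Matrix.det_fin_two]),
    by
      rw [Matrix.mem_glpos]
      simp [Matrix.GeneralLinearGroup.mkOfDetNeZero, Matrix.det_fin_two]⟩

theorem hyperbolic_val : hyperbolic.1.1 = !![1 / 2, 0; 0, 2] := rfl

theorem isHyperbolicElement_hyperbolic : IsHyperbolicElement hyperbolic := by
  rw [IsHyperbolicElement, hyperbolic_val]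
  constructor
  · simp [Matrix.det_fin_two]
  · rw [Matrix.trace_fin_two, lt_abs]
    left
    norm_num

theorem hyperbolic_zpow_eq_one {n : ℤ} (h : hyperbolic ^ n = 1) : n = 0 := by
  -- compare the upper left entries, first for natural exponents
  have hpow : ∀ m : ℕ, (hyperbolic ^ m).1.1 0 0 = (1 / 2 : ℝ) ^ m ∧
      (hyperbolic ^ m).1.1 1 0 = 0 := by
    intro m
    induction m with
    | zero => simp
    | succ m ih =>
      have e : (hyperbolic ^ (m + 1)).1.1 = hyperbolic.1.1 * (hyperbolic ^ m).1.1 := by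
        rw [pow_succ']
        rfl
      rw [e, hyperbolic_val]
      generalize (hyperbolic ^ m).1.1 = M at ih
      simp only [Matrix.mul_apply, Fin.sum_univ_two, ih.1, ih.2, Matrix.of_apply,
        Matrix.cons_val_zero, Matrix.cons_val_one, mul_zero, add_zero, zero_mul]
      exact ⟨(pow_succ' _ _).symm, trivial⟩
  have key : ∀ m : ℕ, hyperbolic ^ m = 1 → m = 0 := by
    intro m hm
    by_contra hm0
    have h1 := (hpow m).1
    rw [hm] at h1
    have h2 : ((1 : ℝ) / 2) ^ m < 1 := pow_lt_one₀ (by norm_num) (by norm_num) hm0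
    rw [← h1] at h2
    simp at h2
  obtain ⟨m, rfl | rfl⟩ := n.eq_nat_or_neg
  · rw [zpow_natCast] at h
    simp [key m h]
  · rw [zpow_neg, zpow_natCast, inv_eq_one] at h
    simp [key m h]

/-! ### Connectedness and the end of the surface -/

theorem openSquare_eq_ball : openSquare = Metric.ball ![1 / 2, 1 / 2] (1 / 2 : ℝ) := by
  ext v
  rw [Metric.mem_ball, dist_pi_lt_iff (by norm_num), Fin.forall_fin_two]
  simp only [openSquare, Set.mem_ofPred_eq, Matrix.cons_val_zero, Matrix.cons_val_one,
    Real.dist_eq, abs_lt]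
  constructor
  · rintro ⟨h1, h2, h3, h4⟩
    exact ⟨⟨by linarith, by linarith⟩, ⟨by linarith, by linarith⟩⟩
  · rintro ⟨⟨h1, h2⟩, ⟨h3, h4⟩⟩
    exact ⟨by linarith, by linarith, by linarith, by linarith⟩

theorem convex_openSquare : Convex ℝ openSquare := by
  rw [openSquare_eq_ball]
  exact convex_ball _ _

theorem Q_subset_closure_openSquare : Q ⊆ closure openSquare := by
  intro v hv
  rw [openSquare_eq_ball, closure_ball _ (by norm_num), Metric.mem_closedBall,
    dist_pi_le_iff (by norm_num), Fin.forall_fin_two]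
  obtain ⟨h1, h2, h3, h4⟩ := (mem_Q_iff.1 hv).1
  simp only [Matrix.cons_val_zero, Matrix.cons_val_one, Real.dist_eq, abs_le]
  exact ⟨⟨by linarith, by linarith⟩, ⟨by linarith, by linarith⟩⟩

theorem removed_subset_closure_openSquare : removed ⊆ closure openSquare := by
  intro v hv
  rw [openSquare_eq_ball, closure_ball _ (by norm_num), Metric.mem_closedBall,
    dist_pi_le_iff (by norm_num), Fin.forall_fin_two]
  have hk0 : ∀ k : ℕ, (0 : ℝ) < (1 / 2) ^ k := fun k => by positivity
  have hk1 : ∀ k : ℕ, ((1 : ℝ) / 2) ^ k ≤ 1 := fun k =>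
    pow_le_one₀ (by norm_num) (by norm_num)
  simp only [Matrix.cons_val_zero, Matrix.cons_val_one, Real.dist_eq, abs_le]
  rcases mem_removed_iff.1 hv with ⟨e, f⟩ | ⟨e, f⟩ | ⟨k, ⟨e, f⟩ | ⟨e, f⟩ | ⟨e, f⟩ | ⟨e, f⟩⟩ <;>
  rw [e, f]
  · norm_num
  · norm_num
  all_goals
    exact ⟨⟨by linarith [hk0 k, hk1 k], by linarith [hk0 k, hk1 k]⟩,
      ⟨by linarith [hk0 k, hk1 k], by linarith [hk0 k, hk1 k]⟩⟩

theorem tendsto_half_pow : Tendsto (fun k : ℕ => ((1 : ℝ) / 2) ^ k) atTop (𝓝 0) :=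
  tendsto_pow_atTop_nhds_zero_of_lt_one (by norm_num) (by norm_num)

theorem tendsto_vec {f g : ℕ → ℝ} {a b : ℝ} (hf : Tendsto f atTop (𝓝 a))
    (hg : Tendsto g atTop (𝓝 b)) : Tendsto (fun k => ![f k, g k]) atTop (𝓝 ![a, b]) := by
  rw [tendsto_pi_nhds, Fin.forall_fin_two]
  exact ⟨hf, hg⟩

theorem isClosed_removed : IsClosed removed := by
  have h1 : Tendsto (fun k : ℕ => 1 - ((1 : ℝ) / 2) ^ k) atTop (𝓝 1) := by
    simpa using tendsto_half_pow.const_sub 1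
  have hA := (tendsto_vec h1 tendsto_const_nhds (b := (0 : ℝ))).isCompact_insert_range
  have hB := (tendsto_vec tendsto_half_pow tendsto_const_nhds (b := (1 : ℝ))).isCompact_insert_range
  have hC := (tendsto_vec tendsto_const_nhds h1 (a := (0 : ℝ))).isCompact_insert_range
  have hD := (tendsto_vec tendsto_const_nhds tendsto_half_pow (a := (1 : ℝ))).isCompact_insert_range
  convert (((hA.union hB).union hC).union hD).isClosed
  ext v
  rw [mem_removed_iff]
  simp only [mem_union, mem_insert_iff, mem_range, vec_ext, @eq_comm _ _ v]
  constructor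
  · rintro (h | h | ⟨k, h | h | h | h⟩)
    · exact Or.inl (Or.inr (Or.inl h))
    · exact Or.inl (Or.inl (Or.inl (Or.inl h)))
    · exact Or.inl (Or.inl (Or.inl (Or.inr ⟨k, h⟩)))
    · exact Or.inl (Or.inl (Or.inr (Or.inr ⟨k, h⟩)))
    · exact Or.inl (Or.inr (Or.inr ⟨k, h⟩))
    · exact Or.inr (Or.inr ⟨k, h⟩)
  · rintro ((((h | ⟨k, h⟩) | (h | ⟨k, h⟩)) | (h | ⟨k, h⟩)) | (h | ⟨k, h⟩))
    · exact Or.inr (Or.inl h)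
    · exact Or.inr (Or.inr ⟨k, Or.inl h⟩)
    · exact Or.inl h
    · exact Or.inr (Or.inr ⟨k, Or.inr (Or.inl h)⟩)
    · exact Or.inl h
    · exact Or.inr (Or.inr ⟨k, Or.inr (Or.inr (Or.inl h))⟩)
    · exact Or.inr (Or.inl h)
    · exact Or.inr (Or.inr ⟨k, Or.inr (Or.inr (Or.inr h))⟩)

theorem removed_nonempty : removed.Nonempty :=
  ⟨![0, 1], mem_removed_iff.2 (Or.inl (by simp))⟩

/-- In terms of a sequence approaching a removed point: the image in the surface has no limit. -/
theorem not_tendsto_planeProj {ι : Type*} {l : Filter ι} [l.NeBot] {v : ι → Fin 2 → ℝ}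
    {r : Fin 2 → ℝ} (hr : r ∈ removed) (hv : Tendsto v l (𝓝 r)) (hQ : ∀ᶠ i in l, v i ∈ Q)
    (z : Surface) : ¬ Tendsto (fun i => planeProj (v i)) l (𝓝 z) := by
  classical
  intro hz
  let w : ι → Q := fun i => if h : v i ∈ Q then ⟨v i, h⟩ else ⟨_, openSquare_subset_Q
    (openSquare_eq_ball ▸ Metric.mem_ball_self (by norm_num))⟩
  have hw : ∀ᶠ i in l, (w i).1 = v i := by
    filter_upwards [hQ] with i hi
    simp [w, hi]
  have h1 : Tendsto (fun i => proj (w i)) l (𝓝 z) := by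
    refine hz.congr' ?_
    filter_upwards [hw] with i hi
    rw [← hi, planeProj_val]
  obtain ⟨p, -, hp⟩ := isProperMap_proj.clusterPt_of_mapClusterPt
    (ℱ := map w l) (y := z) (by
      rw [MapClusterPt, map_map]
      exact ClusterPt.of_le_nhds h1)
  have h2 : MapClusterPt p.1 l fun i => (w i).1 :=
    MapClusterPt.continuousAt_comp continuous_subtype_val.continuousAt hp
  have h3 : Tendsto (fun i => (w i).1) l (𝓝 r) := hv.congr' (by
    filter_upwards [hw] with i hi using hi.symm)
  have hne : (𝓝 p.1 ⊓ 𝓝 r).NeBot := h2.clusterPt.neBot.mono (inf_le_inf_left _ h3)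
  have : p.1 = r := eq_of_nhds_neBot hne
  exact p.2.2 (this ▸ hr)

/-- The points of the surface with a representative in `Q` at distance at least `ε` from the
removed points. -/
def core (ε : ℝ) : Set Surface := proj '' {p : Q | ε ≤ Metric.infDist p.1 removed}

theorem isCompact_core {ε : ℝ} (hε : 0 < ε) : IsCompact (core ε) := by
  refine IsCompact.image ?_ continuous_proj
  rw [Subtype.isCompact_iff]
  have : IsCompact (Icc (0 : Fin 2 → ℝ) 1 ∩ {v | ε ≤ Metric.infDist v removed}) :=
    isCompact_Icc.inter_right (isClosed_le continuous_const (Metric.continuous_infDist_pt _))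
  convert this
  ext v
  constructor
  · rintro ⟨p, hp, rfl⟩
    exact ⟨p.2.1, hp⟩
  · rintro ⟨h1, h2⟩
    refine ⟨⟨v, h1, fun h => ?_⟩, h2, rfl⟩
    rw [Set.mem_ofPred_eq, Metric.infDist_zero_of_mem h] at h2
    linarith

theorem exists_subset_core {C : Set Surface} (hC : IsCompact C) : ∃ ε > 0, C ⊆ core ε := by
  have h1 := isProperMap_proj.isCompact_preimage hC
  rcases (proj ⁻¹' C).eq_empty_or_nonempty with h | h
  · refine ⟨1, one_pos, fun x hx => ?_⟩
    obtain ⟨p, rfl⟩ := surjective_proj x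
    exact absurd (show p ∈ proj ⁻¹' C from hx) (h ▸ notMem_empty p)
  · have hc : Continuous fun p : Q => Metric.infDist p.1 removed :=
      (Metric.continuous_infDist_pt _).comp continuous_subtype_val
    obtain ⟨p, -, hp⟩ := h1.exists_isMinOn h hc.continuousOn
    refine ⟨Metric.infDist p.1 removed, ?_, fun x hx => ?_⟩
    · exact (isClosed_removed.notMem_iff_infDist_pos removed_nonempty).1 p.2.2
    · obtain ⟨r, rfl⟩ := surjective_proj x
      exact ⟨r, hp hx, rfl⟩

theorem notMem_core_iff {ε : ℝ} {p : Q} : proj p ∉ core ε ↔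
    ∀ p', proj p' = proj p → Metric.infDist p'.1 removed < ε := by
  simp only [core, mem_image, not_exists, not_and, Set.mem_ofPred_eq]
  constructor
  · intro h p' hp'
    by_contra h'
    exact h p' (not_lt.1 h') hp'
  · intro h p' h1 h2
    exact absurd (h p' h2) (not_lt.2 h1)

/-- The part of the open square close to a removed point `r`, in the surface. -/
def corner (ε : ℝ) (r : Fin 2 → ℝ) : Set Surface := planeProj '' (Metric.ball r ε ∩ openSquare)

theorem isPreconnected_corner (ε : ℝ) (r : Fin 2 → ℝ) : IsPreconnected (corner ε r) :=
  ((convex_ball r ε).inter convex_openSquare).isPreconnected.image _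
    (continuousOn_planeProj.mono (inter_subset_right.trans openSquare_subset_Q))

theorem corner_subset {ε : ℝ} {r : Fin 2 → ℝ} (hr : r ∈ removed) : corner ε r ⊆ (core ε)ᶜ := by
  rintro _ ⟨v, ⟨hv, hvo⟩, rfl⟩
  rw [planeProj_of_mem (openSquare_subset_Q hvo), mem_compl_iff, notMem_core_iff]
  intro p' hp'
  rw [eq_of_proj_eq_of_mem_openSquare hvo hp']
  exact (Metric.infDist_le_dist_of_mem hr).trans_lt hv

theorem mem_closure_corner {ε : ℝ} {r : Fin 2 → ℝ} {p : Q} (h : dist p.1 r < ε) :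
    proj p ∈ closure (corner ε r) := by
  rw [← planeProj_val]
  have h1 : p.1 ∈ closure (Metric.ball r ε ∩ openSquare) := by
    have := Metric.isOpen_ball.inter_closure ⟨(show p.1 ∈ Metric.ball r ε from h),
      Q_subset_closure_openSquare p.2⟩
    exact this
  have h2 : ContinuousWithinAt planeProj (Metric.ball r ε ∩ openSquare) p.1 :=
    (continuousOn_planeProj p.1 p.2).mono (inter_subset_right.trans openSquare_subset_Q)
  exact h2.mem_closure_image h1

/-- The removed point `r` is joined to `(1, 0)` near the removed points: some connected set that
avoids `core ε` contains the corners at both points. -/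
def Joined (ε : ℝ) (r : Fin 2 → ℝ) : Prop :=
  ∃ t ⊆ (core ε)ᶜ, IsPreconnected t ∧ corner ε ![1, 0] ⊆ t ∧ corner ε r ⊆ t

theorem mem_removed_of_eq {r : Fin 2 → ℝ} (k : ℕ)
    (h : r = ![1 - (1 / 2) ^ k, 0] ∨ r = ![(1 / 2) ^ k, 1] ∨ r = ![0, 1 - (1 / 2) ^ k] ∨
      r = ![1, (1 / 2) ^ k]) : r ∈ removed := by
  rw [mem_removed_iff]
  simp only [vec_ext] at h
  exact Or.inr (Or.inr ⟨k, h⟩)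

theorem corner_nonempty {ε : ℝ} (hε : 0 < ε) {r : Fin 2 → ℝ} (hr : r ∈ removed) :
    (corner ε r).Nonempty := by
  refine Nonempty.image _ ?_
  exact mem_closure_iff_nhds.1 (removed_subset_closure_openSquare hr) _ (Metric.ball_mem_nhds r hε)

/-- Corners at nearby removed points overlap. -/
theorem Joined.of_dist_lt {ε : ℝ} {r r' : Fin 2 → ℝ} (h : Joined ε r)
    (hr' : r' ∈ removed) (hd : dist r r' < ε) : Joined ε r' := by
  obtain ⟨t, htc, ht, h1, h2⟩ := h
  refine ⟨t ∪ corner ε r', union_subset htc (corner_subset hr'),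
    IsPreconnected.union' ?_ ht (isPreconnected_corner ε r'), h1.trans subset_union_left,
    subset_union_right⟩
  have h3 : Metric.ball r ε ∩ Metric.ball r' ε ∈ 𝓝 r' := by
    refine (Metric.isOpen_ball.inter Metric.isOpen_ball).mem_nhds ⟨?_, ?_⟩
    · rwa [Metric.mem_ball, dist_comm]
    · exact Metric.mem_ball_self (dist_nonneg.trans_lt hd)
  obtain ⟨v, ⟨hv1, hv2⟩, hv3⟩ := mem_closure_iff_nhds.1 (removed_subset_closure_openSquare hr') _ h3
  exact ⟨planeProj v, h2 ⟨v, ⟨hv1, hv3⟩, rfl⟩, ⟨v, ⟨hv2, hv3⟩, rfl⟩⟩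

/-- Corners are joined across the segments. -/
theorem Joined.of_partner {ε : ℝ} {r r' : Fin 2 → ℝ} (h : Joined ε r) (hr : r ∈ removed)
    (hr' : r' ∈ removed) {p p' : Q} (hp : Partner p p') (hd : dist p.1 r < ε)
    (hd' : dist p'.1 r' < ε) : Joined ε r' := by
  obtain ⟨t, htc, ht, h1, h2⟩ := h
  have hpp' : proj p = proj p' := mk_eq_mk_iff.2 (Or.inr hp)
  have hz : proj p ∈ (core ε)ᶜ := by
    rw [mem_compl_iff, notMem_core_iff]
    intro q hq
    rcases mk_eq_mk_iff.1 hq with rfl | hq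
    · exact (Metric.infDist_le_dist_of_mem hr).trans_lt hd
    · rw [hq.symm.unique hp]
      exact (Metric.infDist_le_dist_of_mem hr').trans_lt hd'
  have hA : IsPreconnected (insert (proj p) t) :=
    ht.subset_closure (subset_insert _ _) (insert_subset (closure_mono h2 (mem_closure_corner hd))
      subset_closure)
  have hB : IsPreconnected (insert (proj p) (corner ε r')) :=
    (isPreconnected_corner ε r').subset_closure (subset_insert _ _)
      (insert_subset (hpp' ▸ mem_closure_corner hd') subset_closure)
  exact ⟨_, union_subset (insert_subset hz htc) (insert_subset hz (corner_subset hr')),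
    hA.union (proj p) (mem_insert _ _) (mem_insert _ _) hB,
    (h1.trans (subset_insert _ _)).trans subset_union_left,
    (subset_insert _ _).trans subset_union_right⟩

theorem exists_gap_near_left (k : ℕ) {ε : ℝ} (hε : 0 < ε) :
    ∃ x, Gap k x ∧ |x - (1 - (1 / 2) ^ k)| < ε ∧ |x + shift k - (1 / 2) ^ (k + 1)| < ε := by
  have h2 : ((1 : ℝ) / 2) ^ (k + 1) = (1 / 2) ^ k / 2 := by ring
  have h0 : (0 : ℝ) < (1 / 2) ^ k := by positivity
  have hm : 0 < min (ε / 2) ((1 / 2) ^ k / 4) := by positivity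
  have h3 := min_le_left (ε / 2) ((1 / 2 : ℝ) ^ k / 4)
  have h4 := min_le_right (ε / 2) ((1 / 2 : ℝ) ^ k / 4)
  refine ⟨1 - (1 / 2) ^ k + min (ε / 2) ((1 / 2) ^ k / 4), ⟨by linarith, by linarith⟩, ?_, ?_⟩
  · rw [abs_lt]
    constructor <;> linarith
  · rw [abs_lt, shift]
    constructor <;> linarith

theorem exists_gap_near_right (k : ℕ) {ε : ℝ} (hε : 0 < ε) :
    ∃ x, Gap k x ∧ |x - (1 - (1 / 2) ^ (k + 1))| < ε ∧ |x + shift k - (1 / 2) ^ k| < ε := by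
  have h2 : ((1 : ℝ) / 2) ^ (k + 1) = (1 / 2) ^ k / 2 := by ring
  have h0 : (0 : ℝ) < (1 / 2) ^ k := by positivity
  have hm : 0 < min (ε / 2) ((1 / 2) ^ k / 4) := by positivity
  have h3 := min_le_left (ε / 2) ((1 / 2 : ℝ) ^ k / 4)
  have h4 := min_le_right (ε / 2) ((1 / 2 : ℝ) ^ k / 4)
  refine ⟨1 - (1 / 2) ^ (k + 1) - min (ε / 2) ((1 / 2) ^ k / 4), ⟨by linarith, by linarith⟩, ?_, ?_⟩
  · rw [abs_lt]
    constructor <;> linarith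
  · rw [abs_lt, shift]
    constructor <;> linarith

theorem dist_vec_lt {v : Fin 2 → ℝ} {a b ε : ℝ} (hε : 0 < ε) :
    dist v ![a, b] < ε ↔ |v 0 - a| < ε ∧ |v 1 - b| < ε := by
  rw [dist_pi_lt_iff hε, Fin.forall_fin_two]
  rfl

/-- The two points of the horizontal sides that are glued together at position `x`. -/
theorem exists_horizontal_partner {k : ℕ} {x : ℝ} (h : Gap k x) :
    ∃ p p' : Q, Partner p p' ∧ p.1 = ![x, 0] ∧ p'.1 = ![x + shift k, 1] := by
  have hv : ![x, 0] ∈ column k := ⟨h, by simp, by simp⟩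
  exact ⟨_, _, column_partner hv rfl, rfl, by
    rw [vec_ext]
    simp⟩

theorem exists_vertical_partner {k : ℕ} {x : ℝ} (h : Gap k x) :
    ∃ p p' : Q, Partner p p' ∧ p.1 = ![0, x] ∧ p'.1 = ![1, x + shift k] := by
  obtain ⟨p, p', hp, h1, h2⟩ := exists_horizontal_partner h
  refine ⟨QSwap p, QSwap p', hp.imp glue_QSwap glue_QSwap, ?_, ?_⟩
  · rw [QSwap_val, h1]
    rfl
  · rw [QSwap_val, h2]
    rfl

/-- The removed points of two opposite sides are all joined to `(1, 0)` if they are linked as the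
end points of the segments and accumulate at `(1, 0)` along one of the two sides. -/
theorem joined_of_link {ε : ℝ} (hε : 0 < ε) {a b : ℕ → Fin 2 → ℝ}
    (ha : Tendsto a atTop (𝓝 ![1, 0])) (har : ∀ k, a k ∈ removed)
    (hr : ∀ k, Joined ε (a (k + 1)) → Joined ε (b k))
    (hl' : ∀ k, Joined ε (b (k + 1)) → Joined ε (a k)) (k : ℕ) :
    Joined ε (a k) ∧ Joined ε (b k) := by
  have h10 : ![1, 0] ∈ removed := mem_removed_iff.2 (Or.inr (Or.inl (by simp)))
  have h0 : Joined ε ![1, 0] := ⟨_, corner_subset h10, isPreconnected_corner _ _, subset_rfl,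
    subset_rfl⟩
  obtain ⟨K, hK⟩ := eventually_atTop.1 (ha.eventually (Metric.ball_mem_nhds _ hε))
  have hlarge : ∀ k, K ≤ k → Joined ε (a k) := fun k hk => h0.of_dist_lt (har k) (by
    rw [dist_comm]
    exact hK k hk)
  have hdown : ∀ n k, K ≤ k + n → Joined ε (a k) ∧ Joined ε (b k) := by
    intro n
    induction n with
    | zero => exact fun k hk => ⟨hlarge k hk, hr k (hlarge (k + 1) (by omega))⟩
    | succ n ih =>
      intro k hk
      have := ih (k + 1) (by omega)
      exact ⟨hl' k this.2, hr k this.1⟩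
  exact hdown K k (by omega)

theorem joined_of_mem_removed {ε : ℝ} (hε : 0 < ε) {r : Fin 2 → ℝ} (hr : r ∈ removed) :
    Joined ε r := by
  have h1 : Tendsto (fun k : ℕ => 1 - ((1 : ℝ) / 2) ^ k) atTop (𝓝 1) := by
    simpa using tendsto_half_pow.const_sub 1
  have mb : ∀ k : ℕ, ![1 - (1 / 2 : ℝ) ^ k, 0] ∈ removed := fun k =>
    mem_removed_of_eq k (Or.inl rfl)
  have mt : ∀ k : ℕ, ![(1 / 2 : ℝ) ^ k, 1] ∈ removed := fun k =>
    mem_removed_of_eq k (Or.inr (Or.inl rfl))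
  have ml : ∀ k : ℕ, ![0, 1 - (1 / 2 : ℝ) ^ k] ∈ removed := fun k =>
    mem_removed_of_eq k (Or.inr (Or.inr (Or.inl rfl)))
  have mr : ∀ k : ℕ, ![1, (1 / 2 : ℝ) ^ k] ∈ removed := fun k =>
    mem_removed_of_eq k (Or.inr (Or.inr (Or.inr rfl)))
  -- the end points of the `k`-th segments, horizontally
  have hL : ∀ k : ℕ, ∃ p p' : Q, Partner p p' ∧ dist p.1 ![1 - (1 / 2 : ℝ) ^ k, 0] < ε ∧
      dist p'.1 ![(1 / 2 : ℝ) ^ (k + 1), 1] < ε := by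
    intro k
    obtain ⟨x, hx, h2, h3⟩ := exists_gap_near_left k hε
    obtain ⟨p, p', hp, e, e'⟩ := exists_horizontal_partner hx
    refine ⟨p, p', hp, ?_, ?_⟩
    · rw [dist_vec_lt hε, e]
      simpa [hε] using h2
    · rw [dist_vec_lt hε, e']
      simpa [hε] using h3
  have hR : ∀ k : ℕ, ∃ p p' : Q, Partner p p' ∧ dist p.1 ![1 - (1 / 2 : ℝ) ^ (k + 1), 0] < ε ∧
      dist p'.1 ![(1 / 2 : ℝ) ^ k, 1] < ε := by
    intro k
    obtain ⟨x, hx, h2, h3⟩ := exists_gap_near_right k hε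
    obtain ⟨p, p', hp, e, e'⟩ := exists_horizontal_partner hx
    refine ⟨p, p', hp, ?_, ?_⟩
    · rw [dist_vec_lt hε, e]
      simpa [hε] using h2
    · rw [dist_vec_lt hε, e']
      simpa [hε] using h3
  -- the same for the vertical segments
  have hL' : ∀ k : ℕ, ∃ p p' : Q, Partner p p' ∧ dist p.1 ![0, 1 - (1 / 2 : ℝ) ^ k] < ε ∧
      dist p'.1 ![1, (1 / 2 : ℝ) ^ (k + 1)] < ε := by
    intro k
    obtain ⟨x, hx, h2, h3⟩ := exists_gap_near_left k hε
    obtain ⟨p, p', hp, e, e'⟩ := exists_vertical_partner hx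
    refine ⟨p, p', hp, ?_, ?_⟩
    · rw [dist_vec_lt hε, e]
      simpa [hε] using h2
    · rw [dist_vec_lt hε, e']
      simpa [hε] using h3
  have hR' : ∀ k : ℕ, ∃ p p' : Q, Partner p p' ∧ dist p.1 ![0, 1 - (1 / 2 : ℝ) ^ (k + 1)] < ε ∧
      dist p'.1 ![1, (1 / 2 : ℝ) ^ k] < ε := by
    intro k
    obtain ⟨x, hx, h2, h3⟩ := exists_gap_near_right k hε
    obtain ⟨p, p', hp, e, e'⟩ := exists_vertical_partner hx
    refine ⟨p, p', hp, ?_, ?_⟩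
    · rw [dist_vec_lt hε, e]
      simpa [hε] using h2
    · rw [dist_vec_lt hε, e']
      simpa [hε] using h3
  have hbt := joined_of_link hε (a := fun k => ![1 - (1 / 2 : ℝ) ^ k, 0])
    (b := fun k => ![(1 / 2 : ℝ) ^ k, 1]) (tendsto_vec h1 tendsto_const_nhds) mb
    (fun k h => by
      obtain ⟨p, p', hp, hd, hd'⟩ := hR k
      exact h.of_partner (mb (k + 1)) (mt k) hp hd hd')
    (fun k h => by
      obtain ⟨p, p', hp, hd, hd'⟩ := hL k
      exact h.of_partner (mt (k + 1)) (mb k) hp.symm hd' hd)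
  have hrl := joined_of_link hε (a := fun k => ![1, (1 / 2 : ℝ) ^ k])
    (b := fun k => ![0, 1 - (1 / 2 : ℝ) ^ k]) (tendsto_vec tendsto_const_nhds tendsto_half_pow) mr
    (fun k h => by
      obtain ⟨p, p', hp, hd, hd'⟩ := hL' k
      exact h.of_partner (mr (k + 1)) (ml k) hp.symm hd' hd)
    (fun k h => by
      obtain ⟨p, p', hp, hd, hd'⟩ := hR' k
      exact h.of_partner (ml (k + 1)) (mr k) hp hd hd')
  rcases mem_removed_iff.1 hr with h | h | ⟨k, h | h | h | h⟩
  · -- `(0, 1)` is a limit of removed points on the upper side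
    rw [← vec_ext] at h
    subst h
    obtain ⟨k, hk⟩ := ((tendsto_vec tendsto_half_pow tendsto_const_nhds).eventually
      (Metric.ball_mem_nhds ![(0 : ℝ), 1] hε)).exists
    exact (hbt k).2.of_dist_lt hr hk
  · rw [← vec_ext] at h
    subst h
    exact ⟨_, corner_subset hr, isPreconnected_corner _ _, subset_rfl, subset_rfl⟩
  · rw [vec_ext.2 h]
    exact (hbt k).1
  · rw [vec_ext.2 h]
    exact (hbt k).2
  · rw [vec_ext.2 h]
    exact (hrl k).2
  · rw [vec_ext.2 h]
    exact (hrl k).1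

/-- The surface has only one end: the complement of each of the compact sets `core ε` is
connected. -/
theorem isPreconnected_compl_core {ε : ℝ} (hε : 0 < ε) : IsPreconnected (core ε)ᶜ := by
  have h10 : ![1, 0] ∈ removed := mem_removed_iff.2 (Or.inr (Or.inl (by simp)))
  obtain ⟨x, hx⟩ := corner_nonempty hε h10
  refine isPreconnected_of_forall x fun y hy => ?_
  obtain ⟨p, rfl⟩ := surjective_proj y
  obtain ⟨r, hr, hd⟩ := (Metric.infDist_lt_iff removed_nonempty).1 (notMem_core_iff.1 hy p rfl)
  obtain ⟨t, htc, ht, h1, h2⟩ := joined_of_mem_removed hε hr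
  exact ⟨insert (proj p) t, insert_subset hy htc, mem_insert_of_mem _ (h1 hx), mem_insert _ _,
    ht.subset_closure (subset_insert _ _)
      (insert_subset (closure_mono h2 (mem_closure_corner hd)) subset_closure)⟩

end Chamanara

/-! ### Extending homeomorphisms over punctures -/

section Punctures

variable {X : Type*} [TopologicalSpace X] [T2Space X] [LocallyCompactSpace X]
  {U : TopologicalSpace.Opens X}

/-- If `f y` accumulates at `z` when `y` tends to a puncture `c`, then `f y` tends to `z`: the
preimage of the boundary of a small neighbourhood of `z` stays away from `c`, so a connected
punctured neighbourhood of `c` is mapped into that neighbourhood. -/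
theorem tendsto_of_mapClusterPt_puncture (hE : ∀ c ∉ U, ∀ᶠ x in 𝓝[≠] c, x ∈ U)
    (hconn : ∀ c ∉ U, ∀ N ∈ 𝓝 c, ∃ P ⊆ N, P ⊆ U ∧ IsPreconnected P ∧ P ∈ 𝓝[≠] c)
    (f : U ≃ₜ U) {c z : X} (hc : c ∉ U)
    (hz : MapClusterPt z (comap ((↑) : U → X) (𝓝 c)) fun y => (f y : X)) :
    Tendsto (fun y => (f y : X)) (comap ((↑) : U → X) (𝓝 c)) (𝓝 z) := by
  rw [mapClusterPt_iff_frequently] at hz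
  have hemb : IsOpenEmbedding ((↑) : U → X) := U.isOpen.isOpenEmbedding_subtypeVal
  have hzU : z ∉ U := by
    intro hzU
    obtain ⟨y, hy⟩ := f.surjective ⟨z, hzU⟩
    have hcy : c ≠ y := fun h => hc (h ▸ y.2)
    obtain ⟨A, B, hA, hB, hAB⟩ := t2_separation_nhds hcy
    have h1 : (fun x : U => (f x : X)) '' ((↑) ⁻¹' B) ∈ 𝓝 z := by
      have := (hemb.comp f.isOpenEmbedding).isOpenMap.image_mem_nhds
        (continuous_subtype_val.continuousAt.preimage_mem_nhds hB : ((↑) ⁻¹' B : Set U) ∈ 𝓝 y)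
      simpa [hy] using this
    obtain ⟨x, ⟨x', hx', hxx'⟩, hxA⟩ := ((hz _ h1).and_eventually (preimage_mem_comap hA)).exists
    have : x' = x := f.injective (Subtype.ext hxx')
    subst this
    exact Set.disjoint_left.1 hAB hxA hx'
  intro N hN
  have hz' : insert z (U : Set X) ∈ 𝓝 z := by
    have := hE z hzU
    rw [eventually_nhdsWithin_iff] at this
    filter_upwards [this] with x hx
    by_cases h : x = z
    · exact Or.inl h
    · exact Or.inr (hx h)
  obtain ⟨K, hK, hKN, hKc⟩ := local_compact_nhds (inter_mem hN hz')
  have hfr : frontier K ⊆ U := by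
    intro x hx
    rcases (hKN (hKc.isClosed.frontier_subset hx)).2 with rfl | h
    · exact absurd (mem_interior_iff_mem_nhds.2 hK) hx.2
    · exact h
  have hfrc : IsCompact (frontier K) := hKc.of_isClosed_subset isClosed_frontier
    hKc.isClosed.frontier_subset
  have hG : IsCompact ((↑) '' ((fun y : U => (f y : X)) ⁻¹' frontier K) : Set X) := by
    refine IsCompact.image ?_ continuous_subtype_val
    refine (hemb.comp f.isOpenEmbedding).isInducing.isCompact_preimage' hfrc ?_
    intro x hx
    obtain ⟨y, hy⟩ := f.surjective ⟨x, hfr hx⟩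
    exact ⟨y, by simp [hy]⟩
  have hcG : c ∉ ((↑) '' ((fun y : U => (f y : X)) ⁻¹' frontier K) : Set X) := by
    rintro ⟨y, -, rfl⟩
    exact hc y.2
  obtain ⟨P, hPG, hPU, hPc, hPn⟩ := hconn c hc _ (hG.isClosed.isOpen_compl.mem_nhds hcG)
  have hPF : ((↑) ⁻¹' P : Set U) ∈ comap ((↑) : U → X) (𝓝 c) := by
    rw [mem_nhdsWithin_iff_exists_mem_nhds_inter] at hPn
    obtain ⟨t, ht, htP⟩ := hPn
    refine ⟨t, ht, fun y hy => htP ⟨hy, fun h => hc (h ▸ y.2)⟩⟩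
  have hPc' : IsPreconnected ((fun y : U => (f y : X)) '' ((↑) ⁻¹' P)) := by
    refine IsPreconnected.image ?_ _ (continuous_subtype_val.comp f.continuous).continuousOn
    refine hemb.isInducing.isPreconnected_image.1 ?_
    rwa [image_preimage_eq_of_subset (by simpa using hPU)]
  have hmeet : ((fun y : U => (f y : X)) '' ((↑) ⁻¹' P) ∩ K).Nonempty := by
    obtain ⟨y, hy, hyP⟩ := ((hz K hK).and_eventually hPF).exists
    exact ⟨_, ⟨y, hyP, rfl⟩, hy⟩
  have hcover : (fun y : U => (f y : X)) '' ((↑) ⁻¹' P) ⊆ interior K ∪ Kᶜ := by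
    rintro _ ⟨y, hy, rfl⟩
    by_contra h
    rw [mem_union, not_or, mem_compl_iff, not_not] at h
    exact hPG hy ⟨y, ⟨subset_closure h.2, h.1⟩, rfl⟩
  rw [mem_map]
  filter_upwards [hPF] with y hy
  rcases isPreconnected_iff_subset_of_disjoint.1 hPc' _ _ isOpen_interior hKc.isClosed.isOpen_compl
    hcover (eq_empty_of_forall_notMem fun x hx => hx.2.2 (interior_subset hx.2.1)) with h | h
  · exact (hKN (interior_subset (h ⟨y, hy, rfl⟩))).1
  · obtain ⟨x, hx, hxK⟩ := hmeet
    exact absurd hxK (h hx)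

/-- In a one-ended space with infinitely many punctures, `f y` cannot leave all compact sets of
`X` when `y` tends to a puncture: the image of a small punctured disc would be one of the two
sides of a compact set, and each side contains an end or a puncture. -/
theorem exists_mapClusterPt_puncture (hE : ∀ c ∉ U, ∀ᶠ x in 𝓝[≠] c, x ∈ U)
    (hend : ∀ C : Set X, IsCompact C →
      ∃ K, IsCompact K ∧ C ⊆ K ∧ IsPreconnected Kᶜ ∧ ∃ c ∉ U, c ∉ K)
    (f : U ≃ₜ U) {c : X} (hc : c ∉ U) (hne : (comap ((↑) : U → X) (𝓝 c)).NeBot) :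
    ∃ z, MapClusterPt z (comap ((↑) : U → X) (𝓝 c)) fun y => (f y : X) := by
  by_contra! hno
  have hemb : IsOpenEmbedding ((↑) : U → X) := U.isOpen.isOpenEmbedding_subtypeVal
  have hfc : Continuous fun y : U => (f y : X) := continuous_subtype_val.comp f.continuous
  have hc' : insert c (U : Set X) ∈ 𝓝 c := by
    have := hE c hc
    rw [eventually_nhdsWithin_iff] at this
    filter_upwards [this] with x hx
    by_cases h : x = c
    · exact Or.inl h
    · exact Or.inr (hx h)
  obtain ⟨D, hD, hDU, hDc⟩ := local_compact_nhds hc'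
  -- the image of a compact subset of `U` is compact
  have himage : ∀ L : Set X, IsCompact L → L ⊆ U →
      IsCompact ((fun y : U => (f y : X)) '' ((↑) ⁻¹' L)) := by
    intro L hL hLU
    refine IsCompact.image (hemb.isInducing.isCompact_preimage' hL ?_) hfc
    simpa using hLU
  have hclosed : IsClosed ((fun y : U => (f y : X)) '' ((↑) ⁻¹' D)) := by
    rw [← isOpen_compl_iff, isOpen_iff_mem_nhds]
    intro z hz
    have hz' := hno z
    rw [mapClusterPt_iff_frequently] at hz'
    push Not at hz'
    obtain ⟨N, hN, hfN⟩ := hz'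
    obtain ⟨t, ht, htN⟩ := hfN
    obtain ⟨O, hOt, hO, hcO⟩ := mem_nhds_iff.1 ht
    have h1 := himage (D \ O) (hDc.diff hO) fun x hx => (hDU hx.1).resolve_left fun h =>
      hx.2 (h ▸ hcO)
    have h2 : z ∉ (fun y : U => (f y : X)) '' ((↑) ⁻¹' (D \ O)) := by
      rintro ⟨y, hy, rfl⟩
      exact hz ⟨y, hy.1, rfl⟩
    filter_upwards [hN, h1.isClosed.isOpen_compl.mem_nhds h2] with x hxN hx2
    rintro ⟨y, hy, rfl⟩
    by_cases hyO : (y : X) ∈ O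
    · exact htN (hOt hyO) hxN
    · exact hx2 ⟨y, ⟨hy, hyO⟩, rfl⟩
  have hopen : IsOpen ((fun y : U => (f y : X)) '' ((↑) ⁻¹' interior D)) :=
    (hemb.comp f.isOpenEmbedding).isOpenMap _ (isOpen_interior.preimage continuous_subtype_val)
  have hfr : frontier D ⊆ U := by
    intro x hx
    rcases hDU (hDc.isClosed.frontier_subset hx) with rfl | h
    · exact absurd (mem_interior_iff_mem_nhds.2 hD) hx.2
    · exact h
  obtain ⟨K, hK, hCK, hKc, c', hc'U, hc'K⟩ := hend _ (himage _ (hDc.of_isClosed_subset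
    isClosed_frontier hDc.isClosed.frontier_subset) hfr)
  have hcover : Kᶜ ⊆ (fun y : U => (f y : X)) '' ((↑) ⁻¹' interior D) ∪
      ((fun y : U => (f y : X)) '' ((↑) ⁻¹' D))ᶜ := by
    intro x hx
    by_contra h
    rw [mem_union, not_or, mem_compl_iff, not_not] at h
    obtain ⟨y, hy, rfl⟩ := h.2
    exact hx (hCK ⟨y, ⟨subset_closure hy, fun h' => h.1 ⟨y, h', rfl⟩⟩, rfl⟩)
  rcases (isPreconnected_iff_subset_of_disjoint.1 hKc) _ _ hopen hclosed.isOpen_compl hcover (by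
    refine eq_empty_of_forall_notMem ?_
    rintro x ⟨-, ⟨y, hy, rfl⟩, h⟩
    exact h ⟨y, interior_subset (s := D) hy, rfl⟩) with h | h
  · obtain ⟨y, -, hy⟩ := h hc'K
    exact hc'U (hy ▸ (f y).2)
  · have hev : ∀ᶠ y in comap ((↑) : U → X) (𝓝 c), (f y : X) ∈ K := by
      filter_upwards [preimage_mem_comap hD] with y hy
      by_contra hyK
      exact h hyK ⟨y, hy, rfl⟩
    obtain ⟨z, -, hz⟩ := hK.exists_mapClusterPt_of_frequently hev.frequently
    exact hno z hz

/-- A self-homeomorphism of a one-ended space with infinitely many punctures extends over the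
punctures. -/
theorem exists_homeomorph_extension (hE : ∀ c ∉ U, ∀ᶠ x in 𝓝[≠] c, x ∈ U)
    (hconn : ∀ c ∉ U, ∀ N ∈ 𝓝 c, ∃ P ⊆ N, P ⊆ U ∧ IsPreconnected P ∧ P ∈ 𝓝[≠] c)
    (hdense : Dense (U : Set X))
    (hend : ∀ C : Set X, IsCompact C →
      ∃ K, IsCompact K ∧ C ⊆ K ∧ IsPreconnected Kᶜ ∧ ∃ c ∉ U, c ∉ K)
    (f : U ≃ₜ U) : ∃ F : X ≃ₜ X, ∀ x : U, F x = f x := by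
  have hdi : IsDenseInducing ((↑) : U → X) :=
    ⟨U.isOpen.isOpenEmbedding_subtypeVal.isInducing, by
      rw [DenseRange, Subtype.range_coe_subtype]
      exact hdense⟩
  have hext : ∀ g : U ≃ₜ U, ∃ G : X → X, Continuous G ∧ ∀ x : U, G x = g x := by
    intro g
    have hgc : Continuous fun y : U => (g y : X) := continuous_subtype_val.comp g.continuous
    refine ⟨hdi.extend fun y => (g y : X), hdi.continuous_extend fun x => ?_,
      fun x => hdi.extend_eq hgc x⟩
    by_cases hx : x ∈ U
    · refine ⟨g ⟨x, hx⟩, ?_⟩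
      have := hgc.tendsto ⟨x, hx⟩
      rwa [nhds_subtype_eq_comap] at this
    · obtain ⟨z, hz⟩ := exists_mapClusterPt_puncture hE hend g hx (hdi.comap_nhds_neBot x)
      exact ⟨z, tendsto_of_mapClusterPt_puncture hE hconn g hx hz⟩
  obtain ⟨F, hF, hFf⟩ := hext f
  obtain ⟨G, hG, hGf⟩ := hext f.symm
  have hGF : ∀ x, G (F x) = x := congrFun (hdi.dense.equalizer (hG.comp hF) continuous_id (by
    ext x
    simp [hFf, hGf]))
  have hFG : ∀ x, F (G x) = x := congrFun (hdi.dense.equalizer (hF.comp hG) continuous_id (by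
    ext x
    simp [hFf, hGf]))
  exact ⟨⟨⟨F, G, hGF, hFG⟩, hF, hG⟩, hFf⟩

end Punctures

namespace Chamanara

/-- Removing a countable set from a disc leaves it connected. -/
theorem isConnected_ball_diff {s : Set (Fin 2 → ℝ)} (hs : s.Countable) (c : Fin 2 → ℝ) {r : ℝ}
    (hr : 0 < r) : IsConnected (Metric.ball c r \ s) := by
  let e := OpenPartialHomeomorph.univBall c r
  have hrank : 1 < Module.rank ℝ (Fin 2 → ℝ) := by
    rw [rank_fun']
    simp
  have hinj : InjOn e univ := by
    rw [← OpenPartialHomeomorph.univBall_source c r]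
    exact e.injOn
  have h1 : (e ⁻¹' s).Countable := hs.preimage_of_injOn (hinj.mono (subset_univ _))
  have h2 := (h1.isConnected_compl_of_one_lt_rank hrank).image e
    (OpenPartialHomeomorph.continuous_univBall c r).continuousOn
  convert h2 using 1
  ext v
  constructor
  · rintro ⟨hv, hvs⟩
    rw [← OpenPartialHomeomorph.univBall_target c hr] at hv
    refine ⟨e.symm v, ?_, e.right_inv hv⟩
    rwa [mem_compl_iff, mem_preimage, e.right_inv hv]
  · rintro ⟨w, hw, rfl⟩
    refine ⟨?_, hw⟩
    rw [← OpenPartialHomeomorph.univBall_target c hr]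
    exact e.map_source (by simp [e])

theorem injOn_planeProj : InjOn planeProj openSquare := by
  intro v hv w hw h
  rw [planeProj_of_mem (openSquare_subset_Q hv), planeProj_of_mem (openSquare_subset_Q hw)] at h
  exact (congrArg Subtype.val (eq_of_proj_eq_of_mem_openSquare hv h.symm)).symm

/-- The complement of a countable set is the closure of a connected set, the image of the
complement of a countable set in the open square. -/
theorem isConnected_compl_countable {E : Set Surface} (hE : E.Countable) : IsConnected Eᶜ := by
  have hs : (openSquare ∩ planeProj ⁻¹' E).Countable := by
    refine countable_of_injective_of_countable_image (f := planeProj)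
      (injOn_planeProj.mono inter_subset_left) (hE.mono ?_)
    rintro _ ⟨v, hv, rfl⟩
    exact hv.2
  have h1 := isConnected_ball_diff hs ![1 / 2, 1 / 2] (r := 1 / 2) (by norm_num)
  rw [← openSquare_eq_ball] at h1
  have h2 : IsConnected (planeProj '' (openSquare \ (openSquare ∩ planeProj ⁻¹' E))) :=
    h1.image _ (continuousOn_planeProj.mono (sdiff_subset.trans openSquare_subset_Q))
  refine h2.subset_closure ?_ ?_
  · rintro _ ⟨v, hv, rfl⟩ h
    exact hv.2 ⟨hv.1, h⟩
  · intro x _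
    obtain ⟨p, rfl⟩ := surjective_proj x
    have h3 : p.1 ∈ closure (openSquare \ (openSquare ∩ planeProj ⁻¹' E)) := by
      refine closure_minimal ?_ isClosed_closure (Q_subset_closure_openSquare p.2)
      exact (hs.dense_compl ℝ).open_subset_closure_inter isOpen_openSquare
    rw [← planeProj_val]
    refine ContinuousWithinAt.mem_closure_image ?_ h3
    exact (continuousOn_planeProj p.1 p.2).mono (sdiff_subset.trans openSquare_subset_Q)

instance : ConnectedSpace Surface := by
  rw [connectedSpace_iff_univ, ← compl_empty]
  exact isConnected_compl_countable countable_empty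

theorem exists_punctured_nhds (c : Surface) {N : Set Surface} (hN : N ∈ 𝓝 c) :
    ∃ P ⊆ N \ {c}, IsPreconnected P ∧ P ∈ 𝓝[≠] c := by
  obtain ⟨e, -, hc⟩ := exists_mem_charts c
  have h1 : e.target ∩ e.symm ⁻¹' N ∈ 𝓝 (e c) := by
    refine inter_mem (e.open_target.mem_nhds (e.map_source hc)) ?_
    refine (e.continuousAt_symm (e.map_source hc)).preimage_mem_nhds ?_
    rwa [e.left_inv hc]
  obtain ⟨r, hr, hball⟩ := Metric.mem_nhds_iff.1 h1
  have hsub : Metric.ball (e c) r \ {e c} ⊆ e.target := fun v hv => (hball hv.1).1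
  refine ⟨e.symm '' (Metric.ball (e c) r \ {e c}), ?_, ?_, ?_⟩
  · rintro _ ⟨v, hv, rfl⟩
    refine ⟨(hball hv.1).2, fun h => hv.2 ?_⟩
    rw [mem_singleton_iff] at h
    rw [mem_singleton_iff, ← h, e.right_inv (hball hv.1).1]
  · exact (isConnected_ball_diff (countable_singleton _) _ hr).isPreconnected.image _
      (e.continuousOn_symm.mono hsub)
  · rw [mem_nhdsWithin_iff_exists_mem_nhds_inter]
    refine ⟨e.source ∩ e ⁻¹' Metric.ball (e c) r, inter_mem (e.open_source.mem_nhds hc)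
      ((e.continuousAt hc).preimage_mem_nhds (Metric.ball_mem_nhds _ hr)), ?_⟩
    rintro x ⟨⟨hx, hxb⟩, hxc⟩
    exact ⟨e x, ⟨hxb, fun h => hxc (e.injOn hx hc h)⟩, e.left_inv hx⟩

/-! ### Area -/

theorem hasFDerivWithinAt_chart {e : OpenPartialHomeomorph Surface (Fin 2 → ℝ)}
    (he : e ∈ charts) {v : Fin 2 → ℝ} (hv : v ∈ Q) (h : planeProj v ∈ e.source) :
    HasFDerivWithinAt (fun w => e (planeProj w)) (ContinuousLinearMap.id ℝ (Fin 2 → ℝ)) Q v := by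
  have h1 : HasFDerivWithinAt (fun w => e (planeProj v) + (w - v))
      (ContinuousLinearMap.id ℝ (Fin 2 → ℝ)) Q v :=
    ((hasFDerivWithinAt_id v Q).sub_const v).const_add _
  refine h1.congr_of_eventuallyEq (charts_eventually_planeProj he hv h) (by simp)

theorem volume_boundary : volume (Q \ openSquare) = 0 := by
  have h : ∀ (i : Fin 2) (a : ℝ), volume {v : Fin 2 → ℝ | v i = a} = 0 := fun i a => by
    rw [volume_pi]
    exact Measure.pi_hyperplane (fun _ : Fin 2 => (volume : Measure ℝ)) i a
  refine measure_mono_null (t := ({v | v 0 = 0} ∪ {v | v 0 = 1}) ∪ ({v | v 1 = 0} ∪ {v | v 1 = 1}))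
    ?_ (measure_union_null (measure_union_null (h _ _) (h _ _))
      (measure_union_null (h _ _) (h _ _)))
  rintro v ⟨hv, hvo⟩
  obtain ⟨h1, h2, h3, h4⟩ := (mem_Q_iff.1 hv).1
  by_contra hc
  simp only [mem_union, Set.mem_ofPred_eq, not_or] at hc
  exact hvo ⟨lt_of_le_of_ne h1 (Ne.symm hc.1.1), lt_of_le_of_ne h2 hc.1.2,
    lt_of_le_of_ne h3 (Ne.symm hc.2.1), lt_of_le_of_ne h4 hc.2.2⟩

theorem measurableSet_preimage_planeProj {B : Set Surface} (hB : MeasurableSet[borel Surface] B) :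
    MeasurableSet (openSquare ∩ planeProj ⁻¹' B) := by
  let _ : MeasurableSpace Surface := borel Surface
  have : BorelSpace Surface := ⟨rfl⟩
  have h : Measurable (openSquare.domRestrict planeProj) :=
    (continuousOn_iff_continuous_domRestrict.1
      (continuousOn_planeProj.mono openSquare_subset_Q)).measurable
  have := isOpen_openSquare.measurableSet.subtype_image (h hB)
  convert this using 1
  ext v
  simp [and_comm]

/-- Charts preserve the area of the square; the sides of the square do not contribute. -/
theorem volume_chart_image {e : OpenPartialHomeomorph Surface (Fin 2 → ℝ)} (he : e ∈ charts)
    {B : Set Surface} (hBe : B ⊆ e.source) (hB : MeasurableSet[borel Surface] B) :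
    volume (openSquare ∩ planeProj ⁻¹' B) = volume (e '' B) := by
  set s := openSquare ∩ planeProj ⁻¹' B
  have hs : MeasurableSet s := measurableSet_preimage_planeProj hB
  have hdec : e '' B = (fun w => e (planeProj w)) '' s ∪
      (fun w => e (planeProj w)) '' ((Q \ openSquare) ∩ planeProj ⁻¹' B) := by
    rw [← image_union, ← union_inter_distrib_right, union_sdiff_cancel openSquare_subset_Q]
    ext v
    constructor
    · rintro ⟨x, hx, rfl⟩
      obtain ⟨p, rfl⟩ := surjective_proj x
      exact ⟨p.1, ⟨p.2, by simpa using hx⟩, by simp⟩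
    · rintro ⟨w, ⟨-, hw⟩, rfl⟩
      exact ⟨_, hw, rfl⟩
  have h0 : volume ((fun w => e (planeProj w)) '' ((Q \ openSquare) ∩ planeProj ⁻¹' B)) = 0 := by
    refine addHaar_image_eq_zero_of_differentiableOn_of_addHaar_eq_zero volume (fun v hv => ?_)
      (measure_mono_null inter_subset_left volume_boundary)
    exact ((hasFDerivWithinAt_chart he hv.1.1 (hBe hv.2)).mono
      (inter_subset_left.trans sdiff_subset)).differentiableWithinAt
  have h1 := lintegral_abs_det_fderiv_eq_addHaar_image volume hs (f := fun w => e (planeProj w))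
    (f' := fun _ => ContinuousLinearMap.id ℝ (Fin 2 → ℝ)) (fun v hv =>
      (hasFDerivWithinAt_chart he (openSquare_subset_Q hv.1) (hBe hv.2)).mono
        (inter_subset_left.trans openSquare_subset_Q)) (fun v hv w hw h =>
      injOn_planeProj hv.1 hw.1 (e.injOn (hBe hv.2) (hBe hw.2) h))
  rw [hdec, le_antisymm ((measure_union_le _ _).trans (by rw [h0, add_zero]))
    (measure_mono subset_union_left), ← h1]
  simp [ContinuousLinearMap.det]

theorem hasFiniteArea : translationSurface.HasFiniteArea := by
  let _ : MeasurableSpace Surface := borel Surface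
  have : BorelSpace Surface := ⟨rfl⟩
  have hm : AEMeasurable planeProj (volume.restrict openSquare) :=
    (continuousOn_planeProj.mono openSquare_subset_Q).aemeasurable isOpen_openSquare.measurableSet
  refine ⟨(volume.restrict openSquare).map planeProj, ⟨measure_empty, fun e he B hBe hB => ?_⟩, ?_⟩
  · rw [Measure.map_apply_of_aemeasurable hm hB,
      Measure.restrict_apply' isOpen_openSquare.measurableSet, inter_comm]
    exact volume_chart_image he hBe hB
  · rw [Measure.map_apply_of_aemeasurable hm MeasurableSet.univ, preimage_univ,
      Measure.restrict_apply_univ, openSquare_eq_ball]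
    exact measure_ball_lt_top

end Chamanara

theorem TranslationSurface.HasFiniteArea.restrict {X : Type*} [TopologicalSpace X]
    {S : TranslationSurface X} (h : S.HasFiniteArea) (U : TopologicalSpace.Opens X) :
    (S.restrict U).HasFiniteArea := by
  let _ : MeasurableSpace X := borel X
  have : BorelSpace X := ⟨rfl⟩
  let _ : MeasurableSpace U := borel U
  have : BorelSpace U := ⟨rfl⟩
  have hemb : MeasurableEmbedding ((↑) : U → X) :=
    U.isOpen.isOpenEmbedding_subtypeVal.measurableEmbedding
  obtain ⟨μ, ⟨h0, h1⟩, h2⟩ := h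
  refine ⟨μ.comap (↑), ⟨?_, ?_⟩, ?_⟩
  · rw [hemb.comap_apply]
    exact measure_mono_null (image_preimage_subset _ _) h0
  · rintro _ ⟨e, he, hU, rfl⟩ B hBe hB
    rw [hemb.comap_apply, h1 e he _ _ (hemb.measurableSet_image.2 hB), image_image]
    · rfl
    · rintro _ ⟨x, hx, rfl⟩
      simpa using hBe hx
  · rw [hemb.comap_apply]
    exact (measure_mono (subset_univ _)).trans_lt h2

namespace Chamanara

/-! ### Rigidity of affine homeomorphisms -/

theorem chart_symm_eventually {e e' : OpenPartialHomeomorph Surface (Fin 2 → ℝ)} (he : e ∈ charts)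
    (he' : e' ∈ charts) {v : Fin 2 → ℝ} (hv : v ∈ e.target) (hv' : e.symm v ∈ e'.source) :
    ∀ᶠ w in 𝓝 v, e' (e.symm w) = e' (e.symm v) + (w - v) := by
  obtain ⟨b, hb⟩ := charts_compat e he e' he' _ ⟨e.map_target hv, hv'⟩
  have h0 := hb.self_of_nhds
  rw [e.right_inv hv] at h0
  filter_upwards [(e.continuousAt_symm hv).eventually hb, e.open_target.mem_nhds hv] with w hw hwt
  rw [hw, e.right_inv hwt, h0]
  abel

/-- Analytic continuation for affine maps: if `f` is affine with linear part `A`, then the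
equation `f ∘ e.symm = e'.symm ∘ T` for an affine map `T` of the plane with linear part `A`
propagates along connected sets. -/
theorem eqOn_of_hasLinearPart {f : Surface ≃ₜ Surface} {A : Matrix (Fin 2) (Fin 2) ℝ}
    (hf : translationSurface.HasLinearPart f A)
    {e e' : OpenPartialHomeomorph Surface (Fin 2 → ℝ)} (he : e ∈ charts) (he' : e' ∈ charts)
    {T : (Fin 2 → ℝ) → Fin 2 → ℝ} (hT : ∀ v w, T w - T v = A *ᵥ (w - v)) (hTc : Continuous T)
    {K : Set (Fin 2 → ℝ)} (hK : IsPreconnected K) (hKe : K ⊆ e.target)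
    (hKe' : ∀ v ∈ K, T v ∈ e'.target) {v₀ : Fin 2 → ℝ} (hv₀ : v₀ ∈ K)
    (h₀ : f (e.symm v₀) = e'.symm (T v₀)) :
    ∀ v ∈ K, f (e.symm v) = e'.symm (T v) := by
  have hc : ∀ v ∈ K, ContinuousAt (fun w => f (e.symm w)) v := fun v hv =>
    f.continuous.continuousAt.comp (e.continuousAt_symm (hKe hv))
  have hc' : ∀ v ∈ K, ContinuousAt (fun w => e'.symm (T w)) v := fun v hv =>
    ContinuousAt.comp (f := T) (e'.continuousAt_symm (hKe' v hv)) hTc.continuousAt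
  have heq : ∀ v ∈ K, f (e.symm v) = e'.symm (T v) →
      ∀ᶠ w in 𝓝 v, f (e.symm w) = e'.symm (T w) := by
    intro v hv h
    obtain ⟨a, ha, hva⟩ := exists_mem_charts (e.symm v)
    obtain ⟨a', ha', hva'⟩ := exists_mem_charts (f (e.symm v))
    obtain ⟨b, hb⟩ := hf.2 a ha a' ha' _ hva hva'
    have h1 := chart_symm_eventually he ha (hKe hv) hva
    have h2 := chart_symm_eventually he' ha' (hKe' v hv) (h ▸ hva')
    have h3 := hb.self_of_nhds
    filter_upwards [h1, hTc.continuousAt.eventually h2,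
      (e.continuousAt_symm (hKe hv)).eventually hb,
      (hc v hv).preimage_mem_nhds (a'.open_source.mem_nhds hva'),
      (hc' v hv).preimage_mem_nhds (a'.open_source.mem_nhds (h ▸ hva'))] with w k1 k2 k3 k4 k5
    refine a'.injOn k4 k5 ?_
    rw [k2, k3, k1, ← h, h3, hT, Matrix.mulVec_add]
    abel
  have hne : ∀ v ∈ K, f (e.symm v) ≠ e'.symm (T v) →
      ∀ᶠ w in 𝓝 v, f (e.symm w) ≠ e'.symm (T w) := fun v hv h =>
    ((hc v hv).prodMk (hc' v hv)).eventually (isClosed_diagonal.isOpen_compl.mem_nhds h)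
  rcases isPreconnected_iff_subset_of_disjoint.1 hK
    (interior {w | f (e.symm w) = e'.symm (T w)}) (interior {w | f (e.symm w) ≠ e'.symm (T w)})
    isOpen_interior isOpen_interior (fun v hv => by
      by_cases h : f (e.symm v) = e'.symm (T v)
      · exact Or.inl (mem_interior_iff_mem_nhds.2 (heq v hv h))
      · exact Or.inr (mem_interior_iff_mem_nhds.2 (hne v hv h)))
    (eq_empty_of_forall_notMem fun v hv => by
      have h1 : v ∈ {w | f (e.symm w) ≠ e'.symm (T w)} := interior_subset hv.2.2
      exact h1 (interior_subset (s := {w | f (e.symm w) = e'.symm (T w)}) hv.2.1)) with h | h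
  · exact fun v hv => interior_subset (s := {w | f (e.symm w) = e'.symm (T w)}) (h hv)
  · exact absurd h₀ (interior_subset (s := {w | f (e.symm w) ≠ e'.symm (T w)}) (h hv₀))

/-- An affine homeomorphism with trivial linear part and a fixed point is the identity. -/
theorem eq_one_of_hasLinearPart_one {f : Surface ≃ₜ Surface}
    (hf : translationSurface.HasLinearPart f 1) {x : Surface} (hx : f x = x) : f = 1 := by
  have hcl : IsClosed {y | f y = y} := isClosed_eq f.continuous continuous_id
  have hop : IsOpen {y | f y = y} := by
    rw [isOpen_iff_mem_nhds]
    intro y hy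
    obtain ⟨e, he, hye⟩ := exists_mem_charts y
    have hy : f y = y := hy
    obtain ⟨b, hb⟩ := hf.2 e he e he y hye (hy.symm ▸ hye)
    have h0 := hb.self_of_nhds
    rw [hy, Matrix.one_mulVec] at h0
    filter_upwards [hb, e.open_source.mem_nhds hye, f.continuous.continuousAt.preimage_mem_nhds
      (e.open_source.mem_nhds (hy.symm ▸ hye))] with z hz hze hfz
    refine e.injOn hfz hze ?_
    rw [hz, Matrix.one_mulVec, left_eq_add.1 h0, add_zero]
  have := IsClopen.eq_univ ⟨hcl, hop⟩ ⟨x, hx⟩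
  ext y
  exact (this.symm ▸ mem_univ y : y ∈ {y | f y = y})

theorem hasLinearPart_swap : translationSurface.HasLinearPart swap !![0, 1; 1, 0] := by
  rw [hasLinearPart_iff]
  intro p e he hp
  filter_upwards [continuous_QSwap.continuousAt.eventually (charts_eventually he hp)] with r hr
  rw [swap_proj, hr, ← swap_proj, QSwap_val, QSwap_val, ← planeSwap_sub]
  congr 1
  ext i
  fin_cases i <;> simp [Matrix.mulVec, dotProduct, Fin.sum_univ_two]

theorem planeProj_planeSwap {v : Fin 2 → ℝ} (hv : v ∈ Q) :
    planeProj (planeSwap v) = swap (planeProj v) := by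
  rw [planeProj_of_mem hv, planeProj_of_mem (planeSwap_mem hv)]
  rfl

theorem mulVec_apply (A : Matrix (Fin 2) (Fin 2) ℝ) (v : Fin 2 → ℝ) (i : Fin 2) :
    (A *ᵥ v) i = A i 0 * v 0 + A i 1 * v 1 := by
  simp [Matrix.mulVec, dotProduct, Fin.sum_univ_two]

/-- The centre of the square. -/
noncomputable def center : Fin 2 → ℝ := ![1 / 2, 1 / 2]

theorem center_mem : center ∈ openSquare :=
  openSquare_eq_ball ▸ Metric.mem_ball_self (by norm_num)

/-- An affine homeomorphism that maps the centre of the square into the square is given on the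
square by an affine map of the plane, as long as one stays in the square. -/
theorem apply_planeProj {f : Surface ≃ₜ Surface} {A : Matrix (Fin 2) (Fin 2) ℝ}
    (hf : translationSurface.HasLinearPart f A) {c : Fin 2 → ℝ} (hc : c ∈ openSquare)
    (hfc : f (planeProj center) = planeProj c) {v : Fin 2 → ℝ} (hv : v ∈ openSquare)
    (hTv : A *ᵥ (v - center) + c ∈ openSquare) :
    f (planeProj v) = planeProj (A *ᵥ (v - center) + c) := by
  obtain ⟨e, he, ht, hs⟩ := exists_openSquare_chart
  have hseg : ∀ w ∈ segment ℝ center v, A *ᵥ (w - center) + c ∈ openSquare := by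
    rintro _ ⟨a, b, ha, hb, hab, rfl⟩
    have := convex_openSquare hc hTv ha hb hab
    convert this using 1
    have h1 : a • center + b • v - center = b • (v - center) := by
      obtain rfl : a = 1 - b := by linarith
      module
    have h2 : c = a • c + b • c := by rw [← add_smul, hab, one_smul]
    rw [h1, Matrix.mulVec_smul, smul_add]
    nth_rw 1 [h2]
    abel
  have hsub : segment ℝ center v ⊆ openSquare := convex_openSquare.segment_subset center_mem hv
  have key := eqOn_of_hasLinearPart hf he he (T := fun w => A *ᵥ (w - center) + c)
    (fun v w => by rw [add_sub_add_right_eq_sub, ← Matrix.mulVec_sub, sub_sub_sub_cancel_right])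
    (by fun_prop) (convex_segment center v).isPreconnected (ht ▸ hsub)
    (fun w hw => ht ▸ hseg w hw) (left_mem_segment ℝ center v) (by
      simp only [sub_self, Matrix.mulVec_zero, zero_add]
      rw [(hs _ center_mem).2.2, (hs _ hc).2.2, hfc]) v (right_mem_segment ℝ center v)
  rwa [(hs _ hv).2.2, (hs _ hTv).2.2] at key

/-- An affine homeomorphism close to the identity fixes the removed point `(1 - 2⁻ˡ⁻¹, 0)`: its
affine extension to the plane can move this point neither into the square, nor into one of the
copies of the square attached to the two adjacent segments, nor to the point just below, since
points of the square tend to infinity in the surface when they approach a removed point. The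
vector `u` is the direction that is mapped to the vertical. -/
theorem map_removed_eq {f : Surface ≃ₜ Surface} {A : Matrix (Fin 2) (Fin 2) ℝ}
    (hf : translationSurface.HasLinearPart f A) {c : Fin 2 → ℝ} (hc : c ∈ openSquare)
    (hfc : f (planeProj center) = planeProj c) {l : ℕ} {r u d : Fin 2 → ℝ}
    (hr : r = ![1 - (1 / 2) ^ (l + 1), 0]) (hu : A *ᵥ u = ![0, 1])
    (hu0 : |u 0| < (1 / 2) ^ (l + 2)) (hu1 : |u 1 - 1| < 1 / 2)
    (hd : A *ᵥ (r - center) + c = r + d) (hd0 : |d 0| < (1 / 2) ^ (l + 2)) (hd1 : |d 1| < 1 / 8) :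
    d = 0 := by
  have p1 : ((1 : ℝ) / 2) ^ (l + 1) = 2 * (1 / 2) ^ (l + 2) := by ring
  have p0 : ((1 : ℝ) / 2) ^ l = 4 * (1 / 2) ^ (l + 2) := by ring
  have p2 : ((1 : ℝ) / 2) ^ (l + 1 + 1) = (1 / 2) ^ (l + 2) := rfl
  have ple : ((1 : ℝ) / 2) ^ l ≤ 1 := pow_le_one₀ (by norm_num) (by norm_num)
  have ppos : (0 : ℝ) < (1 / 2) ^ (l + 2) := by positivity
  set q : ℝ := (1 / 2) ^ (l + 2)
  have r0 : r 0 = 1 - 2 * q := by rw [hr, ← p1]; rfl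
  have r1 : r 1 = 0 := by rw [hr]; rfl
  have hrr : r ∈ removed := mem_removed_of_eq (l + 1) (Or.inl hr)
  rw [abs_lt] at hu0 hu1 hd0 hd1
  -- the path ending at `r` whose image ends vertically at `r + d`
  have hwo : ∀ t : ℝ, 0 < t → t ≤ 1 / 4 → r + t • u ∈ openSquare := by
    intro t ht ht'
    have a1 : t * u 0 ≤ q := by nlinarith
    have a2 : -q ≤ t * u 0 := by nlinarith
    have a3 : 0 < t * u 1 := mul_pos ht (by linarith)
    have a4 : t * u 1 < 1 := by nlinarith
    simp only [openSquare, Set.mem_ofPred_eq, Pi.add_apply, Pi.smul_apply, smul_eq_mul, r0, r1]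
    exact ⟨by linarith, by linarith, by linarith, by linarith⟩
  have hTw : ∀ t : ℝ, A *ᵥ (r + t • u - center) + c = r + d + t • ![0, 1] := by
    intro t
    rw [← hd, ← hu, ← Matrix.mulVec_smul, add_right_comm, ← Matrix.mulVec_add]
    congr 2
    abel
  have hTw0 : ∀ t : ℝ, (r + d + t • ![0, 1] : Fin 2 → ℝ) 0 = 1 - 2 * q + d 0 := by
    intro t
    simp [r0]
  have hTw1 : ∀ t : ℝ, (r + d + t • ![0, 1] : Fin 2 → ℝ) 1 = d 1 + t := by
    intro t
    simp [r1]
  have hTwo : ∀ t : ℝ, 0 < d 1 + t → t ≤ 1 / 4 → r + d + t • ![0, 1] ∈ openSquare := by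
    intro t ht ht'
    simp only [openSquare, Set.mem_ofPred_eq, hTw0, hTw1]
    exact ⟨by linarith, by linarith, by linarith, by linarith⟩
  have hfw : ∀ t : ℝ, 0 < t → t ≤ 1 / 4 → 0 < d 1 + t →
      f (planeProj (r + t • u)) = planeProj (r + d + t • ![0, 1]) := by
    intro t ht ht' h
    rw [← hTw t]
    refine apply_planeProj hf hc hfc (hwo t ht ht') ?_
    rw [hTw]
    exact hTwo t h ht'
  have cw : Continuous fun t : ℝ => r + t • u := by fun_prop
  have cTw : Continuous fun t : ℝ => r + d + t • (![0, 1] : Fin 2 → ℝ) := by fun_prop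
  have hsmall : ∀ a : ℝ, a < 1 / 4 → ∀ᶠ t in 𝓝[>] a, a < t ∧ t ≤ 1 / 4 := fun a ha =>
    Ioc_mem_nhdsGT ha
  -- the image of the path cannot have a limit at its end
  have hno : ∀ z, ¬ Tendsto (fun t : ℝ => f (planeProj (r + t • u))) (𝓝[>] 0) (𝓝 z) := by
    intro z hz
    refine not_tendsto_planeProj (l := 𝓝[>] (0 : ℝ)) hrr (v := fun t => r + t • u) ?_ ?_
      (f.symm z) ?_
    · have := cw.tendsto 0
      simp only [zero_smul, add_zero] at this
      exact this.mono_left nhdsWithin_le_nhds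
    · filter_upwards [hsmall 0 (by norm_num)] with t ht
      exact openSquare_subset_Q (hwo t ht.1 ht.2)
    · have := (f.symm.continuous.tendsto z).comp hz
      simpa [Function.comp_def] using this
  have hTlim : Tendsto (fun t : ℝ => r + d + t • (![0, 1] : Fin 2 → ℝ)) (𝓝[>] 0) (𝓝 (r + d)) := by
    have := cTw.tendsto 0
    simp only [zero_smul, add_zero] at this
    exact this.mono_left nhdsWithin_le_nhds
  rcases lt_or_ge 0 (d 1) with h1 | h1
  · -- the end point would be in the open square
    exfalso
    have hrd : r + d ∈ openSquare := by
      simpa using hTwo 0 (by linarith) (by norm_num)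
    refine hno (planeProj (r + d)) (Tendsto.congr' ?_
      (((continuousOn_planeProj.mono openSquare_subset_Q).continuousAt
        (isOpen_openSquare.mem_nhds hrd)).tendsto.comp hTlim))
    filter_upwards [hsmall 0 (by norm_num)] with t ht
    exact (hfw t ht.1 ht.2 (by linarith [ht.1])).symm
  by_cases h0 : d 0 = 0
  · rcases h1.lt_or_eq with h1 | h1
    · -- the image of the path would cross `r`
      exfalso
      have hlim : Tendsto (fun t : ℝ => f (planeProj (r + t • u))) (𝓝[>] (-d 1))
          (𝓝 (f (planeProj (r + (-d 1) • u)))) := by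
        have h2 : ContinuousAt planeProj (r + (-d 1) • u) :=
          (continuousOn_planeProj.mono openSquare_subset_Q).continuousAt
            (isOpen_openSquare.mem_nhds (hwo _ (by linarith) (by linarith)))
        have h3 := ContinuousAt.comp (f := fun t : ℝ => r + t • u) h2 cw.continuousAt
        exact (f.continuous.continuousAt.comp h3).tendsto.mono_left nhdsWithin_le_nhds
      refine not_tendsto_planeProj (l := 𝓝[>] (-d 1)) hrr
        (v := fun t => r + d + t • ![0, 1]) ?_ ?_ _ (hlim.congr' ?_)
      · have h2 : r + d + (-d 1) • ![0, 1] = r := by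
          ext i
          fin_cases i <;> simp [h0]
        have := cTw.tendsto (-d 1)
        rw [h2] at this
        exact this.mono_left nhdsWithin_le_nhds
      · filter_upwards [hsmall (-d 1) (by linarith)] with t ht
        exact openSquare_subset_Q (hTwo t (by linarith [ht.1]) ht.2)
      · filter_upwards [hsmall (-d 1) (by linarith)] with t ht
        exact hfw t (by linarith [ht.1]) ht.2 (by linarith [ht.1])
    · ext i
      fin_cases i
      · exact h0
      · exact h1
  · -- the image of the path would end in a column next to `r`
    exfalso
    obtain ⟨m, hm⟩ : ∃ m, Gap m (1 - 2 * q + d 0) := by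
      rcases lt_or_gt_of_ne h0 with h | h
      · exact ⟨l, by rw [p0]; linarith, by rw [p1]; linarith⟩
      · exact ⟨l + 1, by rw [p1]; linarith, by rw [p2]; linarith⟩
    obtain ⟨e, he, ht, hs⟩ := exists_openSquare_chart
    obtain ⟨e', he', ht', hs'⟩ := exists_column_chart m
    have hcol : ∀ t : ℝ, 0 ≤ t → t ≤ 1 / 4 → r + d + t • ![0, 1] ∈ column m := by
      intro t ht ht'
      simp only [column, Set.mem_ofPred_eq, hTw0, hTw1]
      exact ⟨hm, by linarith, by linarith⟩
    have key := eqOn_of_hasLinearPart hf he he' (T := fun w => A *ᵥ (w - center) + c)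
      (fun v w => by rw [add_sub_add_right_eq_sub, ← Matrix.mulVec_sub, sub_sub_sub_cancel_right])
      (by fun_prop) (K := (fun t : ℝ => r + t • u) '' Ioc 0 (1 / 4))
      (isPreconnected_Ioc.image _ cw.continuousOn) (by
        rintro _ ⟨t, ht1, rfl⟩
        rw [ht]
        exact hwo t ht1.1 ht1.2) (by
        rintro _ ⟨t, ht1, rfl⟩
        rw [ht']
        simp only [hTw]
        exact hcol t ht1.1.le ht1.2) (v₀ := r + (1 / 4 : ℝ) • u)
      ⟨1 / 4, ⟨by norm_num, le_rfl⟩, rfl⟩ (by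
        simp only [hTw]
        rw [(hs _ (hwo _ (by norm_num) le_rfl)).2.2, (hs' _ (hcol _ (by norm_num) le_rfl)).2.2,
          hfw _ (by norm_num) le_rfl (by linarith),
          columnProj_of_nonneg (by rw [hTw1]; linarith)])
    have hrd : r + d ∈ column m := by
      simpa using hcol 0 le_rfl (by norm_num)
    refine hno (columnProj m (r + d)) (Tendsto.congr' ?_
      (((continuousOn_columnProj m).continuousAt ((isOpen_column m).mem_nhds hrd)).tendsto.comp
        hTlim))
    filter_upwards [hsmall 0 (by norm_num)] with t ht1
    have := key _ ⟨t, ht1, rfl⟩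
    simp only [hTw] at this
    rw [(hs _ (hwo t ht1.1 ht1.2)).2.2, (hs' _ (hcol t ht1.1.le ht1.2)).2.2] at this
    exact this.symm

/-- `M` is close to the identity matrix. -/
def NearOne (M : Matrix (Fin 2) (Fin 2) ℝ) : Prop :=
  ∀ i j, |M i j - (1 : Matrix _ _ ℝ) i j| < 1 / 32

theorem NearOne.entries {M : Matrix (Fin 2) (Fin 2) ℝ} (h : NearOne M) :
    |M 0 0 - 1| < 1 / 32 ∧ |M 0 1| < 1 / 32 ∧ |M 1 0| < 1 / 32 ∧ |M 1 1 - 1| < 1 / 32 :=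
  ⟨by simpa using h 0 0, by simpa using h 0 1, by simpa using h 1 0, by simpa using h 1 1⟩

/-- The equations saying that the removed points `(1/2, 0)` and `(3/4, 0)` are fixed. -/
theorem fixed_removed {f : Surface ≃ₜ Surface} {A B : Matrix (Fin 2) (Fin 2) ℝ}
    (hf : translationSurface.HasLinearPart f A) (hAB : A * B = 1) (hA : NearOne A) (hB : NearOne B)
    {c : Fin 2 → ℝ} (hc0 : |c 0 - 1 / 2| < 1 / 32) (hc1 : |c 1 - 1 / 2| < 1 / 32)
    (hfc : f (planeProj center) = planeProj c) :
    (-(1 / 2) * A 0 1 + c 0 = 1 / 2 ∧ -(1 / 2) * A 1 1 + c 1 = 0) ∧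
    (1 / 4 * A 0 0 - 1 / 2 * A 0 1 + c 0 = 3 / 4 ∧ 1 / 4 * A 1 0 - 1 / 2 * A 1 1 + c 1 = 0) := by
  obtain ⟨a1, a2, a3, a4⟩ := hA.entries
  obtain ⟨-, b2, -, b4⟩ := hB.entries
  rw [abs_lt] at a1 a2 a3 a4 b2 b4 hc0 hc1
  have hc : c ∈ openSquare := ⟨by linarith, by linarith, by linarith, by linarith⟩
  have hu : A *ᵥ (B *ᵥ ![0, 1]) = ![0, 1] := by
    rw [Matrix.mulVec_mulVec, hAB, Matrix.one_mulVec]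
  have hu0 : (B *ᵥ ![0, 1]) 0 = B 0 1 := by simp [mulVec_apply]
  have hu1 : (B *ᵥ ![0, 1]) 1 = B 1 1 := by simp [mulVec_apply]
  have key : ∀ (l : ℕ) (x : ℝ), x = 1 - (1 / 2) ^ (l + 1) → (1 / 8 : ℝ) ≤ (1 / 2) ^ (l + 2) →
      1 / 2 ≤ x → x ≤ 3 / 4 →
      A 0 0 * (x - 1 / 2) - 1 / 2 * A 0 1 + c 0 = x ∧
      A 1 0 * (x - 1 / 2) - 1 / 2 * A 1 1 + c 1 = 0 := by
    intro l x hx hl hx1 hx2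
    have e : ∀ i, (A *ᵥ (![x, 0] - center) + c - ![x, 0]) i =
        A i 0 * (x - 1 / 2) - 1 / 2 * A i 1 + c i - ![x, 0] i := by
      intro i
      rw [Pi.sub_apply, Pi.add_apply, mulVec_apply]
      simp only [Pi.sub_apply, center, Matrix.cons_val_zero, Matrix.cons_val_one]
      ring
    have e0 := e 0
    have e1 := e 1
    simp only [Matrix.cons_val_zero, Matrix.cons_val_one, sub_zero] at e0 e1
    have := map_removed_eq hf hc hfc (l := l) (r := ![x, 0]) (by rw [hx]) hu
      (by rw [hu0, abs_lt]; constructor <;> linarith)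
      (by rw [hu1, abs_lt]; constructor <;> linarith) (add_sub_cancel _ _).symm
      (by rw [e0, abs_lt]; constructor <;> nlinarith)
      (by rw [e1, abs_lt]; constructor <;> nlinarith)
    rw [this] at e0 e1
    simp only [Pi.zero_apply] at e0 e1
    constructor <;> linarith
  have k0 := key 0 (1 / 2) (by norm_num) (by norm_num) le_rfl (by norm_num)
  have k1 := key 1 (3 / 4) (by norm_num) (by norm_num) (by norm_num) le_rfl
  refine ⟨⟨?_, ?_⟩, ?_, ?_⟩ <;> linarith [k0.1, k0.2, k1.1, k1.2]

/-- An affine homeomorphism close to the identity is the identity: it fixes the three removed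
points `(1/2, 0)`, `(3/4, 0)` and `(0, 1/2)`, which are not collinear. -/
theorem eq_one_of_near {f : Surface ≃ₜ Surface} {A B : Matrix (Fin 2) (Fin 2) ℝ}
    (hf : translationSurface.HasLinearPart f A) (hAB : A * B = 1) (hA : NearOne A) (hB : NearOne B)
    {c : Fin 2 → ℝ} (hc0 : |c 0 - 1 / 2| < 1 / 32) (hc1 : |c 1 - 1 / 2| < 1 / 32)
    (hfc : f (planeProj center) = planeProj c) : f = 1 := by
  obtain ⟨⟨h1, h2⟩, h3, h4⟩ := fixed_removed hf hAB hA hB hc0 hc1 hfc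
  have hS : (!![0, 1; 1, 0] * !![0, 1; 1, 0] : Matrix (Fin 2) (Fin 2) ℝ) = 1 := by
    ext i j
    fin_cases i <;> fin_cases j <;> simp
  have hconj : ∀ M : Matrix (Fin 2) (Fin 2) ℝ, !![0, 1; 1, 0] * M * !![0, 1; 1, 0] =
      !![M 1 1, M 1 0; M 0 1, M 0 0] := by
    intro M
    ext i j
    rw [Matrix.mul_apply, Fin.sum_univ_two, Matrix.mul_apply, Fin.sum_univ_two, Matrix.mul_apply,
      Fin.sum_univ_two]
    fin_cases i <;> fin_cases j <;> simp
  have hnear : ∀ M : Matrix (Fin 2) (Fin 2) ℝ, NearOne M →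
      NearOne (!![0, 1; 1, 0] * M * !![0, 1; 1, 0]) := by
    intro M hM
    obtain ⟨a1, a2, a3, a4⟩ := hM.entries
    rw [hconj]
    intro i j
    fin_cases i <;> fin_cases j
    · simpa using a4
    · simpa using a3
    · simpa using a2
    · simpa using a1
  have hcQ : c ∈ Q := by
    rw [abs_lt] at hc0 hc1
    exact openSquare_subset_Q ⟨by linarith, by linarith, by linarith, by linarith⟩
  obtain ⟨⟨h5, h6⟩, -⟩ := fixed_removed (f := swap * f * swap) (c := planeSwap c)
    ((hasLinearPart_swap.mul hf).mul hasLinearPart_swap)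
    (B := !![0, 1; 1, 0] * B * !![0, 1; 1, 0]) (by
      calc _ = !![0, 1; 1, 0] * A * (!![0, 1; 1, 0] * !![0, 1; 1, 0]) * B * !![0, 1; 1, 0] := by
            simp only [Matrix.mul_assoc]
        _ = 1 := by rw [hS, Matrix.mul_one, Matrix.mul_assoc _ A, hAB, Matrix.mul_one, hS])
    (hnear A hA) (hnear B hB) hc1 hc0 (by
      change swap (f (swap (planeProj center))) = _
      rw [← planeProj_planeSwap (openSquare_subset_Q center_mem), planeProj_planeSwap hcQ, ← hfc]
      rfl)
  rw [hconj] at h5 h6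
  simp only [Matrix.of_apply, Matrix.cons_val_zero, Matrix.cons_val_one, planeSwap_zero,
    planeSwap_one] at h5 h6
  have hA1 : A = 1 := by
    ext i j
    fin_cases i <;> fin_cases j <;> simp <;> linarith
  have hcc : c = center := by
    rw [center, vec_ext]
    rw [hA1] at h1 h2
    simp at h1 h2
    constructor <;> linarith
  subst hA1
  exact eq_one_of_hasLinearPart_one hf (x := planeProj center) (by rw [hfc, hcc])

/-! ### Points with trivial stabiliser -/

/-- The linear part of an affine homeomorphism. -/
noncomputable def linearPart (f : translationSurface.affineGroup) : GL(2, ℝ)⁺ := f.2.choose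

theorem hasLinearPart_linearPart (f : translationSurface.affineGroup) :
    translationSurface.HasLinearPart f.1 (linearPart f).1.1 := f.2.choose_spec

theorem isOpen_nearOne : IsOpen {M : Matrix (Fin 2) (Fin 2) ℝ | NearOne M} := by
  simp only [NearOne, Set.ofPred_forall]
  refine isOpen_iInter_of_finite fun i => isOpen_iInter_of_finite fun j => ?_
  exact isOpen_lt (by fun_prop) continuous_const

theorem nearOne_one : NearOne 1 := fun i j => by simp

/-- The affine group is countable: it embeds as a discrete subset into the second countable space
of possible images of the centre and possible linear parts (together with their inverses). -/
instance : Countable translationSurface.affineGroup := by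
  let Ψ : translationSurface.affineGroup →
      Surface × Matrix (Fin 2) (Fin 2) ℝ × Matrix (Fin 2) (Fin 2) ℝ := fun f =>
    (f.1 (planeProj center), (linearPart f).1.1, (linearPart f)⁻¹.1.1)
  let _ : TopologicalSpace translationSurface.affineGroup :=
    TopologicalSpace.induced Ψ inferInstance
  have : SecondCountableTopology (Matrix (Fin 2) (Fin 2) ℝ) :=
    inferInstanceAs (SecondCountableTopology (Fin 2 → Fin 2 → ℝ))
  have : SecondCountableTopology translationSurface.affineGroup :=
    TopologicalSpace.secondCountableTopology_induced _ _ Ψ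
  have hΨ : Continuous Ψ := continuous_induced_dom
  have : DiscreteTopology translationSurface.affineGroup := by
    refine discreteTopology_iff_singleton_mem_nhds.2 fun f => ?_
    obtain ⟨e, he, ht, hs⟩ := exists_openSquare_chart
    have hcs := hs _ center_mem
    have c1 : Continuous fun h => f.1.symm (Ψ h).1 := f.1.symm.continuous.comp hΨ.fst
    have c2 : Continuous fun h => (linearPart f)⁻¹.1.1 * (Ψ h).2.1 :=
      continuous_const.matrix_mul hΨ.snd.fst
    have c3 : Continuous fun h => (Ψ h).2.2 * (linearPart f).1.1 :=
      hΨ.snd.snd.matrix_mul continuous_const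
    have hval : f.1.symm (Ψ f).1 = planeProj center := f.1.symm_apply_apply _
    have hsrc : f.1.symm (Ψ f).1 ∈ e.source := hval.symm ▸ hcs.1
    have k1 : ∀ᶠ h in 𝓝 f, f.1.symm (Ψ h).1 ∈ e.source :=
      c1.continuousAt.eventually (e.open_source.mem_nhds hsrc)
    have k2 : ∀ᶠ h in 𝓝 f, e (f.1.symm (Ψ h).1) ∈ Metric.ball center (1 / 32) := by
      have c : ContinuousAt (fun h => e (f.1.symm (Ψ h).1)) f :=
        ContinuousAt.comp (g := e) (e.continuousAt hsrc) c1.continuousAt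
      have hmem : e (f.1.symm (Ψ f).1) ∈ Metric.ball center (1 / 32) := by
        rw [hval, hcs.2.1]
        exact Metric.mem_ball_self (by norm_num)
      exact c.preimage_mem_nhds (Metric.isOpen_ball.mem_nhds hmem)
    have e1 : (linearPart f)⁻¹.1.1 * (linearPart f).1.1 = 1 := by simp
    have k3 : ∀ᶠ h in 𝓝 f, NearOne ((linearPart f)⁻¹.1.1 * (Ψ h).2.1) :=
      c2.continuousAt.eventually (isOpen_nearOne.mem_nhds (by
        change NearOne ((linearPart f)⁻¹.1.1 * (linearPart f).1.1)
        rw [e1]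
        exact nearOne_one))
    have k4 : ∀ᶠ h in 𝓝 f, NearOne ((Ψ h).2.2 * (linearPart f).1.1) :=
      c3.continuousAt.eventually (isOpen_nearOne.mem_nhds (by
        change NearOne ((linearPart f)⁻¹.1.1 * (linearPart f).1.1)
        rw [e1]
        exact nearOne_one))
    filter_upwards [k1, k2, k3, k4] with h h1 h2 h3 h4
    rw [center, Metric.mem_ball, dist_vec_lt (by norm_num)] at h2
    have hmem : e (f.1.symm (Ψ h).1) ∈ openSquare := ht ▸ e.map_source h1
    have := eq_one_of_near (f := f.1⁻¹ * h.1) (((hasLinearPart_linearPart f).inv e1).mul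
      (hasLinearPart_linearPart h)) (B := (linearPart h)⁻¹.1.1 * (linearPart f).1.1) (by
        have e2 : (linearPart f)⁻¹ * linearPart h * ((linearPart h)⁻¹ * linearPart f) = 1 := by
          group
        exact congrArg (fun g : GL(2, ℝ)⁺ => g.1.1) e2) h3 h4 h2.1 h2.2 (by
        rw [← (hs _ hmem).2.2, e.left_inv h1]
        rfl)
    exact Subtype.ext (inv_mul_eq_one.1 this).symm
  exact TopologicalSpace.separableSpace_iff_countable.1 inferInstance

/-- A locally constant real function on a subset of the plane has countably many values. -/
theorem countable_image_of_locally_const {s : Set (Fin 2 → ℝ)} {g : (Fin 2 → ℝ) → ℝ}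
    (h : ∀ v ∈ s, ∀ᶠ w in 𝓝[s] v, g w = g v) : (g '' s).Countable := by
  obtain ⟨t, -, ht, hst⟩ := TopologicalSpace.countable_cover_nhdsWithin h
  refine (ht.image g).mono ?_
  rintro _ ⟨v, hv, rfl⟩
  obtain ⟨w, hw, hvw⟩ := mem_iUnion₂.1 (hst hv)
  exact ⟨w, hw, Eq.symm hvw⟩

/-- Near a fixed point of an affine map, the other fixed points differ by fixed vectors of the
linear part. -/
theorem eventually_fixed {f : Surface ≃ₜ Surface} {A : Matrix (Fin 2) (Fin 2) ℝ}
    (hf : translationSurface.HasLinearPart f A) {v : Fin 2 → ℝ} (hv : v ∈ openSquare)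
    (hfv : f (planeProj v) = planeProj v) :
    ∀ᶠ w in 𝓝 v, f (planeProj w) = planeProj w → A *ᵥ (w - v) = w - v := by
  obtain ⟨e, he, ht, hs⟩ := exists_openSquare_chart
  obtain ⟨b, hb⟩ := hf.2 e he e he _ (hs v hv).1 (hfv.symm ▸ (hs v hv).1)
  have hc : ContinuousAt planeProj v :=
    (continuousOn_planeProj.mono openSquare_subset_Q).continuousAt (isOpen_openSquare.mem_nhds hv)
  have h0 := hb.self_of_nhds
  rw [hfv, (hs v hv).2.1] at h0
  filter_upwards [hc.eventually hb, isOpen_openSquare.mem_nhds hv] with w hw hwo hfw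
  rw [hfw, (hs w hwo).2.1] at hw
  rw [Matrix.mulVec_sub, sub_eq_sub_iff_sub_eq_sub, ← neg_inj, neg_sub, neg_sub]
  rw [← sub_eq_iff_eq_add'] at hw h0
  exact hw.trans h0.symm

/-- The fixed points of a nontrivial affine map in the square lie on countably many horizontal
lines, or every horizontal line contains only countably many of them. -/
theorem countable_fixed {f : Surface ≃ₜ Surface} (hf : f ∈ translationSurface.affineGroup)
    (hf1 : f ≠ 1) :
    {y : ℝ | ∃ x : ℝ, ![x, y] ∈ openSquare ∧
      f (planeProj ![x, y]) = planeProj ![x, y]}.Countable ∨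
    ∀ y : ℝ, {x : ℝ | ![x, y] ∈ openSquare ∧
      f (planeProj ![x, y]) = planeProj ![x, y]}.Countable := by
  obtain ⟨A, hA⟩ := hf
  by_cases h : A.1.1 0 0 = 1 ∧ A.1.1 1 0 = 0
  · left
    have key := countable_image_of_locally_const (g := fun v => v 1)
      (s := {v | v ∈ openSquare ∧ f (planeProj v) = planeProj v}) (fun v hv => by
        have h1 : A.1.1 ≠ 1 := fun h1 => hf1 (eq_one_of_hasLinearPart_one (h1 ▸ hA) hv.2)
        filter_upwards [nhdsWithin_le_nhds (eventually_fixed hA hv.1 hv.2), self_mem_nhdsWithin]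
          with w hw hws
        have hw := hw hws.2
        have w0 := congrFun hw 0
        have w1 := congrFun hw 1
        rw [mulVec_apply, h.1] at w0
        rw [mulVec_apply, h.2] at w1
        by_contra hne
        have hne : w 1 - v 1 ≠ 0 := sub_ne_zero.2 hne
        simp only [Pi.sub_apply] at w0 w1
        refine h1 ?_
        have e0 : A.1.1 0 1 = 0 := by
          refine (mul_eq_zero.1 ?_).resolve_right hne
          linarith
        have e1 : A.1.1 1 1 = 1 := by
          refine mul_right_cancel₀ hne ?_
          linarith
        ext i j
        fin_cases i <;> fin_cases j <;> simp [h.1, h.2, e0, e1])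
    refine key.mono ?_
    rintro y ⟨x, hx⟩
    exact ⟨_, hx, rfl⟩
  · right
    intro y
    have key := countable_image_of_locally_const (g := fun v => v 0)
      (s := {v | v ∈ openSquare ∧ f (planeProj v) = planeProj v ∧ v 1 = y}) (fun v hv => by
        filter_upwards [nhdsWithin_le_nhds (eventually_fixed hA hv.1 hv.2.1), self_mem_nhdsWithin]
          with w hw hws
        have hw := hw hws.2.1
        have w0 := congrFun hw 0
        have w1 := congrFun hw 1
        by_contra hne
        have hne : w 0 - v 0 ≠ 0 := sub_ne_zero.2 hne
        rw [mulVec_apply, Pi.sub_apply, Pi.sub_apply, hws.2.2, hv.2.2, sub_self, mul_zero,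
          add_zero] at w0 w1
        exact h ⟨(mul_eq_right₀ hne).1 w0, (mul_eq_zero.1 w1).resolve_right hne⟩)
    refine key.mono ?_
    rintro x hx
    exact ⟨_, ⟨hx.1, hx.2, rfl⟩, rfl⟩

/-- A product of two uncountable sets contains a point with trivial stabiliser. -/
theorem exists_trivial_stabiliser {s t : Set ℝ} (hs : ¬ s.Countable) (ht : ¬ t.Countable)
    (hst : ∀ x ∈ s, ∀ y ∈ t, ![x, y] ∈ openSquare) :
    ∃ x ∈ s, ∃ y ∈ t, ∀ f ∈ translationSurface.affineGroup,
      f (planeProj ![x, y]) = planeProj ![x, y] → f = 1 := by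
  let H : translationSurface.affineGroup → Set ℝ := fun f =>
    {y | ∃ x : ℝ, ![x, y] ∈ openSquare ∧ f.1 (planeProj ![x, y]) = planeProj ![x, y]}
  let V : translationSurface.affineGroup → ℝ → Set ℝ := fun f y =>
    {x | ![x, y] ∈ openSquare ∧ f.1 (planeProj ![x, y]) = planeProj ![x, y]}
  have h1 : (⋃ f : {f // (H f).Countable}, H f).Countable := countable_iUnion fun f => f.2
  obtain ⟨y, hy, hyH⟩ := not_subset.1 fun h => ht (h1.mono h)
  have h2 : (⋃ f : {f // (V f y).Countable}, V f y).Countable := countable_iUnion fun f => f.2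
  obtain ⟨x, hx, hxV⟩ := not_subset.1 fun h => hs (h2.mono h)
  refine ⟨x, hx, y, hy, fun f hf hfx => ?_⟩
  by_contra hf1
  rcases countable_fixed hf hf1 with h | h
  · exact hyH (mem_iUnion.2 ⟨⟨⟨f, hf⟩, h⟩, x, hst x hx y hy, hfx⟩)
  · exact hxV (mem_iUnion.2 ⟨⟨⟨f, hf⟩, h y⟩, hst x hx y hy, hfx⟩)

/-! ### Binary expansions -/

theorem ofDigits_two_eq (a : ℕ → Fin 2) :
    Real.ofDigits a = ((a 0 : ℕ) + Real.ofDigits fun i => a (i + 1)) / 2 := by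
  rw [Real.ofDigits_eq_sum_add_ofDigits a 1]
  simp [Real.ofDigitsTerm]
  ring

theorem ofDigits_rev (a : ℕ → Fin 2) :
    Real.ofDigits (fun i => (a i).rev) = 1 - Real.ofDigits a := by
  rw [eq_sub_iff_add_eq, Real.ofDigits, Real.ofDigits,
    ← Summable.tsum_add Real.summable_ofDigitsTerm Real.summable_ofDigitsTerm,
    ← Real.ofDigits_const_last_eq_one 1, Real.ofDigits]
  refine tsum_congr fun i => ?_
  have h : ∀ c : Fin 2, ((c.rev : ℕ) : ℝ) + (c : ℕ) = 1 := fun c => by fin_cases c <;> simp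
  simp only [Real.ofDigitsTerm, ← add_mul, h]
  simp

theorem ofDigits_pos {a : ℕ → Fin 2} {i : ℕ} (h : a i = 1) : 0 < Real.ofDigits a := by
  refine Real.summable_ofDigitsTerm.tsum_pos (fun _ => Real.ofDigitsTerm_nonneg) i ?_
  simp [Real.ofDigitsTerm, h]

theorem ofDigits_lt_one {a : ℕ → Fin 2} {i : ℕ} (h : a i = 0) : Real.ofDigits a < 1 := by
  have := ofDigits_pos (a := fun i => (a i).rev) (i := i) (by simp [h])
  rw [ofDigits_rev] at this
  linarith

/-- A binary sequence which is not eventually constant. -/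
def Mixed (a : ℕ → Fin 2) : Prop := ∀ c m, ∃ i, m ≤ i ∧ a i = c

theorem Mixed.ofDigits_pos {a : ℕ → Fin 2} (h : Mixed a) : 0 < Real.ofDigits a :=
  let ⟨_, _, hi⟩ := h 1 0
  Chamanara.ofDigits_pos hi

theorem Mixed.ofDigits_lt_one {a : ℕ → Fin 2} (h : Mixed a) : Real.ofDigits a < 1 :=
  let ⟨_, _, hi⟩ := h 0 0
  Chamanara.ofDigits_lt_one hi

theorem Mixed.tail {a : ℕ → Fin 2} (h : Mixed a) : Mixed fun i => a (i + 1) := by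
  intro c m
  obtain ⟨i, hi, hc⟩ := h c (m + 1)
  exact ⟨i - 1, by omega, by
    beta_reduce
    rwa [Nat.sub_add_cancel (by omega)]⟩

theorem Mixed.eq_of_ofDigits_eq {a b : ℕ → Fin 2} (ha : Mixed a) (hb : Mixed b)
    (h : Real.ofDigits a = Real.ofDigits b) : a = b := by
  have key : ∀ (n : ℕ) (a b : ℕ → Fin 2), Mixed a → Mixed b →
      Real.ofDigits a = Real.ofDigits b → a n = b n := by
    have h0 : ∀ a b : ℕ → Fin 2, Mixed a → Mixed b → Real.ofDigits a = Real.ofDigits b →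
        a 0 = b 0 := by
      intro a b ha hb h
      rw [ofDigits_two_eq a, ofDigits_two_eq b] at h
      have h1 := ha.tail.ofDigits_pos
      have h2 := ha.tail.ofDigits_lt_one
      have h3 := hb.tail.ofDigits_pos
      have h4 := hb.tail.ofDigits_lt_one
      generalize a 0 = c at h
      generalize b 0 = d at h
      fin_cases c <;> fin_cases d <;> simp at h ⊢ <;> linarith
    intro n
    induction n with
    | zero => exact h0
    | succ n ih =>
      intro a b ha hb h
      refine ih _ _ ha.tail hb.tail ?_
      have := h0 a b ha hb h
      rw [ofDigits_two_eq a, ofDigits_two_eq b, this] at h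
      linarith
  exact funext fun n => key n a b ha hb h

/-- The value of the sequence `c, …, c, 1 - c, 1 - c, …` that changes at the place `k`. -/
noncomputable def stepValue (c : Fin 2) (k : ℕ) : ℝ :=
  if c = 0 then (1 / 2) ^ k else 1 - (1 / 2) ^ k

theorem ofDigits_step (c : Fin 2) (k : ℕ) :
    Real.ofDigits (fun i => if i < k then c else c.rev) = stepValue c k := by
  induction k with
  | zero =>
    have h1 : Real.ofDigits (fun _ => (1 : Fin 2)) = 1 := Real.ofDigits_const_last_eq_one 1
    have h2 := ofDigits_rev fun _ => (1 : Fin 2)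
    rw [h1] at h2
    fin_cases c
    · simpa [stepValue] using h1
    · simpa [stepValue] using h2
  | succ k ih =>
    rw [ofDigits_two_eq]
    simp only [Nat.zero_lt_succ, if_true, Nat.add_lt_add_iff_right, ih, stepValue]
    fin_cases c
    · simp
      ring
    · simp
      ring

/-- A sequence that changes at most once among its first `L` places has almost the same value as
a sequence that changes exactly once. -/
theorem exists_stepValue {a : ℕ → Fin 2} {c d : Fin 2} {k L : ℕ}
    (h : ∀ i < L, a i = if i < k then c else d) :
    ∃ k', |Real.ofDigits a - stepValue c k'| ≤ (1 / 2) ^ L := by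
  have key : ∀ k', (∀ i < L, a i = if i < k' then c else c.rev) →
      |Real.ofDigits a - stepValue c k'| ≤ (1 / 2) ^ L := by
    intro k' h'
    have := Real.abs_ofDigits_sub_ofDigits_le h'
    rw [ofDigits_step] at this
    simpa using this
  by_cases hcd : d = c
  · refine ⟨L, key L fun i hi => ?_⟩
    rw [h i hi, hcd, ite_self, if_pos hi]
  · refine ⟨k, key k fun i hi => ?_⟩
    have : d = c.rev := by
      revert hcd
      fin_cases c <;> fin_cases d <;> simp
    rw [h i hi, this]

/-! ### Points with given two-sided expansion -/

/-- The point of the square whose second coordinate has the digits `w n, w (n + 1), …` and whose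
first coordinate has the complements of the digits `w (n - 1), w (n - 2), …`. The map `planeMap`
acts as the shift of the two-sided sequence `w`. -/
noncomputable def codePoint (w : ℤ → Fin 2) (n : ℤ) : Fin 2 → ℝ :=
  ![Real.ofDigits fun i : ℕ => (w (n - 1 - i)).rev, Real.ofDigits fun i : ℕ => w (n + i)]

/-- The two-sided sequence with right half `b`, and the complement of `a` as its left half. -/
def twoSided (a b : ℕ → Fin 2) : ℤ → Fin 2
  | Int.ofNat k => b k
  | Int.negSucc k => (a k).rev

theorem codePoint_twoSided_zero (a b : ℕ → Fin 2) :
    codePoint (twoSided a b) 0 = ![Real.ofDigits a, Real.ofDigits b] := by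
  have h1 : ∀ i : ℕ, (0 : ℤ) - 1 - i = Int.negSucc i := fun i => by omega
  have h2 : ∀ i : ℕ, (0 : ℤ) + i = Int.ofNat i := fun i => by simp
  simp only [codePoint, h1, h2, twoSided, Fin.rev_rev]

theorem mixed_right {a b : ℕ → Fin 2} (hb : Mixed b) (n : ℤ) :
    Mixed fun i : ℕ => twoSided a b (n + i) := by
  intro c m
  obtain ⟨j, hj, hc⟩ := hb c (m + n.natAbs)
  refine ⟨(j - n).toNat, by omega, ?_⟩
  have : n + ((j - n).toNat : ℕ) = Int.ofNat j := by
    rw [Int.ofNat_eq_natCast]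
    omega
  simp only [this, twoSided, hc]

theorem mixed_left {a b : ℕ → Fin 2} (ha : Mixed a) (n : ℤ) :
    Mixed fun i : ℕ => (twoSided a b (n - 1 - i)).rev := by
  intro c m
  obtain ⟨j, hj, hc⟩ := ha c (m + n.natAbs)
  refine ⟨(j + n).toNat, by omega, ?_⟩
  have : n - 1 - ((j + n).toNat : ℕ) = Int.negSucc j := by omega
  simp only [this, twoSided, Fin.rev_rev, hc]

theorem codePoint_mem_openSquare {a b : ℕ → Fin 2} (ha : Mixed a) (hb : Mixed b) (n : ℤ) :
    codePoint (twoSided a b) n ∈ openSquare :=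
  ⟨(mixed_left ha n).ofDigits_pos, (mixed_left ha n).ofDigits_lt_one,
    (mixed_right hb n).ofDigits_pos, (mixed_right hb n).ofDigits_lt_one⟩

theorem phi_codePoint {w : ℤ → Fin 2} {n : ℤ} (h : codePoint w n ∈ Q) :
    phi (planeProj (codePoint w n)) = planeProj (codePoint w (n + 1)) := by
  have hx : codePoint w (n + 1) 0 = (((w n).rev : ℕ) + codePoint w n 0) / 2 := by
    simp only [codePoint, Matrix.cons_val_zero]
    rw [ofDigits_two_eq]
    congr 4
    · simp
    · ext i
      congr 3
      push_cast
      ring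
  have hy : codePoint w n 1 = ((w n : ℕ) + codePoint w (n + 1) 1) / 2 := by
    simp only [codePoint, Matrix.cons_val_one]
    rw [ofDigits_two_eq]
    simp only [Matrix.cons_val_fin_one, Nat.cast_zero, add_zero, Nat.cast_add, Nat.cast_one]
    congr 2
    refine congrArg Real.ofDigits (funext fun i => congrArg w ?_)
    ring
  have hy0 : 0 ≤ codePoint w (n + 1) 1 := Real.ofDigits_nonneg _
  have hy1 : codePoint w (n + 1) 1 ≤ 1 := Real.ofDigits_le_one _
  rw [planeProj_of_mem h]
  generalize w n = c at hx hy
  fin_cases c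
  · have hx : codePoint w (n + 1) 0 = (1 + codePoint w n 0) / 2 := by simpa using hx
    have hy : codePoint w n 1 = codePoint w (n + 1) 1 / 2 := by simpa using hy
    refine (phiFun_of_le (by change codePoint w n 1 ≤ _; linarith)).trans ?_
    rw [← planeProj_val]
    congr 1
    refine (vec_ext.2 ⟨?_, ?_⟩).symm <;> linarith
  · have hx : codePoint w (n + 1) 0 = codePoint w n 0 / 2 := by simpa using hx
    have hy : codePoint w n 1 = (1 + codePoint w (n + 1) 1) / 2 := by simpa using hy
    refine (phiFun_of_ge (by change _ ≤ codePoint w n 1; linarith)).trans ?_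
    rw [← planeProj_val]
    congr 1
    refine (vec_ext.2 ⟨?_, ?_⟩).symm <;> linarith

theorem phi_zpow_codePoint {w : ℤ → Fin 2} (h : ∀ n, codePoint w n ∈ Q) (n : ℤ) :
    (phi ^ n) (planeProj (codePoint w 0)) = planeProj (codePoint w n) := by
  induction n with
  | zero => simp
  | succ n ih =>
    rw [add_comm, zpow_one_add, Homeomorph.mul_apply, ih, phi_codePoint (h _), add_comm]
  | pred n ih =>
    refine phi.injective ?_
    rw [phi_codePoint (h _), ← Homeomorph.mul_apply, ← zpow_one_add]
    simpa using ih

theorem ofDigits_const (c : Fin 2) : Real.ofDigits (fun _ => c) = stepValue c.rev 0 := by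
  have := ofDigits_step c.rev 0
  simpa using this

theorem mem_removed_of_stepValue (c : Fin 2) (k : ℕ) :
    ![stepValue c 0, stepValue c k] ∈ removed ∧ ![stepValue c k, stepValue c 0] ∈ removed := by
  fin_cases c <;> simp only [stepValue] <;>
    refine ⟨mem_removed_of_eq k ?_, mem_removed_of_eq k ?_⟩ <;> simp

/-- If `w` changes at most once within distance `L` of the place `n`, then the `n`-th point of
the orbit is near a removed point. -/
theorem infDist_codePoint_le {w : ℤ → Fin 2} {n m : ℤ} {L : ℕ} {c d : Fin 2}
    (h : ∀ j, n - L ≤ j → j < n + L → w j = if j < m then c else d) :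
    Metric.infDist (codePoint w n) removed ≤ (1 / 2) ^ L := by
  have key : ∀ r ∈ removed, |codePoint w n 0 - r 0| ≤ (1 / 2) ^ L →
      |codePoint w n 1 - r 1| ≤ (1 / 2) ^ L →
      Metric.infDist (codePoint w n) removed ≤ (1 / 2) ^ L := fun r hr h0 h1 =>
    (Metric.infDist_le_dist_of_mem hr).trans
      ((dist_pi_le_iff (by positivity)).2 (Fin.forall_fin_two.2 ⟨h0, h1⟩))
  have hconst : ∀ (e : Fin 2) (a : ℕ → Fin 2), (∀ i < L, a i = e) →
      |Real.ofDigits a - stepValue e.rev 0| ≤ (1 / 2) ^ L := by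
    intro e a he
    have := Real.abs_ofDigits_sub_ofDigits_le (y := fun _ => e) he
    rw [ofDigits_const] at this
    simpa using this
  rcases le_or_gt n m with hm | hm
  · have hx := hconst c.rev (fun i => (w (n - 1 - i)).rev) fun i hi => by
      rw [h _ (by omega) (by omega), if_pos (by omega)]
    obtain ⟨k, hk⟩ := exists_stepValue (a := fun i => w (n + i)) (c := c) (d := d)
      (k := (m - n).toNat) (L := L) fun i hi => by
        rw [h _ (by omega) (by omega)]
        exact if_congr (by omega) rfl rfl
    rw [Fin.rev_rev] at hx
    exact key _ (mem_removed_of_stepValue c k).1 hx hk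
  · have hy := hconst d (fun i => w (n + i)) fun i hi => by
      rw [h _ (by omega) (by omega), if_neg (by omega)]
    obtain ⟨k, hk⟩ := exists_stepValue (a := fun i => (w (n - 1 - i)).rev) (c := d.rev)
      (d := c.rev) (k := (n - m).toNat) (L := L) fun i hi => by
        rw [h _ (by omega) (by omega), apply_ite Fin.rev, ← ite_not]
        exact if_congr (by omega) rfl rfl
    exact key _ (mem_removed_of_stepValue d.rev k).2 hk hy

/-! ### A point with closed discrete orbit -/

/-- The sequence that runs through the digits `t 0, 1 - t 0, t 1, 1 - t 1, …` and stays at the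
`r`-th of them from the place `r ^ 2` to the place `(r + 1) ^ 2`. -/
def spread (t : ℕ → Fin 2) (i : ℕ) : Fin 2 :=
  if i.sqrt % 2 = 0 then t (i.sqrt / 2) else (t (i.sqrt / 2)).rev

theorem spread_sq (t : ℕ → Fin 2) (r : ℕ) : spread t (2 * r * (2 * r)) = t r := by
  rw [spread, Nat.sqrt_eq, if_pos (by omega)]
  congr 1
  omega

theorem spread_sq' (t : ℕ → Fin 2) (r : ℕ) :
    spread t ((2 * r + 1) * (2 * r + 1)) = (t r).rev := by
  rw [spread, Nat.sqrt_eq, if_neg (by omega)]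
  congr 2
  omega

theorem mixed_spread (t : ℕ → Fin 2) : Mixed (spread t) := by
  intro c m
  by_cases h : t m = c
  · exact ⟨2 * m * (2 * m), by nlinarith, by rw [spread_sq, h]⟩
  · refine ⟨(2 * m + 1) * (2 * m + 1), by nlinarith, ?_⟩
    rw [spread_sq']
    generalize t m = e at h
    revert h
    fin_cases c <;> fin_cases e <;> simp

theorem spread_injective : Function.Injective spread := fun t t' h =>
  funext fun r => by rw [← spread_sq t, h, spread_sq]

/-- The numbers whose binary expansion is a `spread` sequence. -/
def sparse : Set ℝ := range fun t => Real.ofDigits (spread t)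

theorem not_countable_sparse : ¬ sparse.Countable := by
  have hinj : Function.Injective fun t => Real.ofDigits (spread t) := fun t t' h =>
    spread_injective ((mixed_spread t).eq_of_ofDigits_eq (mixed_spread t') h)
  intro h
  have h1 : Countable (ℕ → Fin 2) := by
    rw [← countable_univ_iff]
    exact countable_of_injective_of_countable_image hinj.injOn (image_univ.symm ▸ h)
  -- Cantor's diagonal argument
  obtain ⟨F, hF⟩ := exists_surjective_nat (ℕ → Fin 2)
  obtain ⟨n, hn⟩ := hF fun n => (F n n).rev
  have := congrFun hn n
  generalize F n n = c at this
  revert this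
  fin_cases c <;> simp

/-- Far from the origin a `spread` sequence has at most one change in each window of length
`2 * L`. -/
theorem exists_spread_eq (t : ℕ → Fin 2) {L n : ℕ} (h : L * L + L ≤ n) :
    ∃ (m : ℕ) (c d : Fin 2), ∀ j, n ≤ j + L → j < n + L →
      spread t j = if j < m then c else d := by
  obtain ⟨q, rfl⟩ := Nat.exists_eq_add_of_le' (le_trans (Nat.le_add_left L (L * L)) h)
  set r := q.sqrt with hr
  have h1 : r * r ≤ q := Nat.sqrt_le q
  have h2 : q < (r + 1) * (r + 1) := Nat.sqrt_lt.1 (Nat.lt_succ_self _)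
  have h3 : L ≤ r := Nat.le_sqrt.2 (by omega)
  refine ⟨(r + 1) * (r + 1), spread t (r * r), spread t ((r + 1) * (r + 1)), fun j hj hj' => ?_⟩
  have key : ∀ s, j.sqrt = s → spread t j = spread t (s * s) := by
    rintro s rfl
    simp only [spread, Nat.sqrt_eq]
  split_ifs with hjm
  · exact key _ (Nat.eq_sqrt.2 ⟨by omega, hjm⟩).symm
  · exact key _ (Nat.eq_sqrt.2 ⟨by omega, by nlinarith⟩).symm

theorem infDist_twoSided_le (t t' : ℕ → Fin 2) {L : ℕ} {n : ℤ} (h : L * L + L ≤ n.natAbs) :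
    Metric.infDist (codePoint (twoSided (spread t) (spread t')) n) removed ≤ (1 / 2) ^ L := by
  have hLL : L ≤ L * L := Nat.le_mul_self L
  rcases n.eq_nat_or_neg with ⟨k, rfl | rfl⟩
  · obtain ⟨m, c, d, hm⟩ := exists_spread_eq t' (L := L) (n := k) (by simpa using h)
    refine infDist_codePoint_le (m := m) (c := c) (d := d) fun j h1 h2 => ?_
    have hj : 0 ≤ j := by
      simp only [Int.natAbs_natCast] at h
      omega
    obtain ⟨i, rfl⟩ := Int.eq_ofNat_of_zero_le hj
    refine (hm i (by omega) (by omega)).trans ?_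
    exact if_congr (by omega) rfl rfl
  · have h : L * L + L ≤ k := by simpa using h
    obtain ⟨m, c, d, hm⟩ := exists_spread_eq t (L := L) (n := k) h
    refine infDist_codePoint_le (m := -m) (c := d.rev) (d := c.rev) fun j h1 h2 => ?_
    -- for `L = 0` the window is empty, otherwise it consists of negative places
    rcases Nat.eq_zero_or_pos L with rfl | hL
    · omega
    obtain ⟨i, rfl⟩ : ∃ i : ℕ, j = Int.negSucc i := ⟨(-1 - j).toNat, by omega⟩
    refine (congrArg Fin.rev (hm i (by omega) (by omega))).trans ?_
    rw [apply_ite Fin.rev, ← ite_not]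
    exact if_congr (by omega) rfl rfl

theorem finite_orbit_inter_core (t t' : ℕ → Fin 2) {ε : ℝ} (hε : 0 < ε) :
    {n : ℤ | planeProj (codePoint (twoSided (spread t) (spread t')) n) ∈ core ε}.Finite := by
  obtain ⟨L, hL⟩ := exists_pow_lt_of_lt_one hε (show (1 / 2 : ℝ) < 1 by norm_num)
  refine (finite_Icc (-(L * L + L : ℤ)) (L * L + L)).subset fun n hn => ?_
  by_contra hn'
  have hN : L * L + L ≤ n.natAbs := by
    zify
    rw [mem_Icc, ← abs_le] at hn'
    omega
  have ho := codePoint_mem_openSquare (mixed_spread t) (mixed_spread t') n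
  rw [Set.mem_ofPred_eq, planeProj_of_mem (openSquare_subset_Q ho)] at hn
  refine notMem_core_iff.2 (fun p' hp' => ?_) hn
  rw [eq_of_proj_eq_of_mem_openSquare ho hp']
  exact (infDist_twoSided_le t t' hN).trans_lt hL

/-- The orbits of the points with `spread` coordinates leave every compact set. -/
theorem isClosed_and_discrete_orbit (t t' : ℕ → Fin 2) {ζ : Surface}
    (hζ : ζ = planeProj ![Real.ofDigits (spread t), Real.ofDigits (spread t')]) :
    IsClosed (orbit phi ζ) ∧ DiscreteTopology (orbit phi ζ) := by
  rw [← isDiscrete_iff_discreteTopology, isClosed_and_discrete_iff]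
  intro x
  obtain ⟨K, hK, hxK⟩ := exists_compact_mem_nhds x
  obtain ⟨ε, hε, hKε⟩ := exists_subset_core hK
  have hfin : (orbit phi ζ ∩ K).Finite := by
    refine ((finite_orbit_inter_core t t' hε).image fun n => (phi ^ n) ζ).subset ?_
    rintro _ ⟨⟨n, rfl⟩, hn⟩
    refine ⟨n, ?_, rfl⟩
    have hQ := fun n => openSquare_subset_Q
      (codePoint_mem_openSquare (mixed_spread t) (mixed_spread t') n)
    rw [Set.mem_ofPred_eq, ← phi_zpow_codePoint hQ, codePoint_twoSided_zero, ← hζ]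
    exact hKε hn
  rw [disjoint_principal_right]
  have hn : K ∩ ((orbit phi ζ ∩ K) \ {x})ᶜ ∈ 𝓝 x :=
    inter_mem hxK ((hfin.subset sdiff_subset).isClosed.isOpen_compl.mem_nhds fun h => h.2 rfl)
  filter_upwards [nhdsWithin_le_nhds hn, self_mem_nhdsWithin] with y hy hyx hyo
  exact hy.2 ⟨⟨hyo, hy.1⟩, hyx⟩

/-- The coordinates of the point are taken from the uncountable set `sparse`, which leaves enough
freedom to avoid the fixed points of all nontrivial affine maps. -/
theorem exists_point : ∃ ζ : Surface, (∀ f ∈ translationSurface.affineGroup, f ζ = ζ → f = 1) ∧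
    IsClosed (orbit phi ζ) ∧ DiscreteTopology (orbit phi ζ) := by
  obtain ⟨_, ⟨t, rfl⟩, _, ⟨t', rfl⟩, h⟩ := exists_trivial_stabiliser not_countable_sparse
    not_countable_sparse (by
      rintro _ ⟨t, rfl⟩ _ ⟨t', rfl⟩
      exact ⟨(mixed_spread t).ofDigits_pos, (mixed_spread t).ofDigits_lt_one,
        (mixed_spread t').ofDigits_pos, (mixed_spread t').ofDigits_lt_one⟩)
  exact ⟨_, h, isClosed_and_discrete_orbit t t' rfl⟩

end Chamanara

/-! ### Linear parts and restriction to open subsets -/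

namespace TranslationSurface

variable {X : Type*} [TopologicalSpace X] {S : TranslationSurface X}

theorem HasLinearPart.unique {f : X ≃ₜ X} {A B : Matrix (Fin 2) (Fin 2) ℝ}
    (hA : S.HasLinearPart f A) (hB : S.HasLinearPart f B) {x : X} (hx : x ∉ S.sing) : A = B := by
  obtain ⟨e, he, hxe⟩ := (S.covers x).2 hx
  obtain ⟨e', he', hxe'⟩ := (S.covers (f x)).2 fun h => hx ((hA.1 x).1 h)
  obtain ⟨b, hb⟩ := hA.2 e he e' he' x hxe hxe'
  obtain ⟨c, hc⟩ := hB.2 e he e' he' x hxe hxe'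
  -- both affine maps express `f` near `e x`, hence have the same derivative there
  have h1 : (fun v => A *ᵥ v + b) =ᶠ[𝓝 (e x)] fun v => B *ᵥ v + c := by
    have hs := e.continuousAt_symm (e.map_source hxe)
    rw [ContinuousAt, e.left_inv hxe] at hs
    filter_upwards [hs.eventually hb, hs.eventually hc,
      e.open_target.mem_nhds (e.map_source hxe)] with v h2 h3 hv
    rw [e.right_inv hv] at h2 h3
    exact h2.symm.trans h3
  have hd : ∀ (M : Matrix (Fin 2) (Fin 2) ℝ) (k : Fin 2 → ℝ),
      HasFDerivAt (fun v => M *ᵥ v + k) (LinearMap.toContinuousLinearMap (Matrix.toLin' M)) (e x) :=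
    fun M k => (LinearMap.toContinuousLinearMap (Matrix.toLin' M)).hasFDerivAt.add_const k
  have h2 := (hd A b).unique ((hd B c).congr_of_eventuallyEq h1)
  exact Matrix.toLin'.injective (LinearMap.toContinuousLinearMap.injective h2)

theorem HasLinearPart.pow {f : X ≃ₜ X} {A : Matrix (Fin 2) (Fin 2) ℝ} (hf : S.HasLinearPart f A) :
    ∀ n : ℕ, S.HasLinearPart (f ^ n) (A ^ n)
  | 0 => by simpa using S.hasLinearPart_one
  | n + 1 => by
    rw [pow_succ, pow_succ]
    exact (hf.pow n).mul hf

theorem HasLinearPart.zpow {f : X ≃ₜ X} {A : GL(2, ℝ)⁺} (hf : S.HasLinearPart f A.1.1) (n : ℤ) :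
    S.HasLinearPart (f ^ n) (A ^ n).1.1 := by
  have hnat : ∀ m : ℕ, S.HasLinearPart (f ^ m) (A ^ m).1.1 := fun m => by
    simpa using hf.pow m
  obtain ⟨m, rfl | rfl⟩ := n.eq_nat_or_neg
  · simpa using hnat m
  · rw [zpow_neg, zpow_neg, zpow_natCast, zpow_natCast]
    refine (hnat m).inv ?_
    simp

variable {U : TopologicalSpace.Opens X} {F : X ≃ₜ X} {f : U ≃ₜ U}
  {A : Matrix (Fin 2) (Fin 2) ℝ}

theorem HasLinearPart.restrict (hF : S.HasLinearPart F A) (hFf : ∀ x : U, F x = f x) :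
    (S.restrict U).HasLinearPart f A := by
  refine ⟨fun x => ?_, ?_⟩
  · change (f x : X) ∈ S.sing ↔ (x : X) ∈ S.sing
    rw [← hFf, hF.1]
  · rintro _ ⟨e, he, h, rfl⟩ _ ⟨e', he', h', rfl⟩ x hx hx'
    obtain ⟨b, hb⟩ := hF.2 e he e' he' x (by simpa using hx) (by rw [hFf]; simpa using hx')
    refine ⟨b, ?_⟩
    filter_upwards [continuous_subtype_val.continuousAt.eventually hb] with y hy
    rw [hFf] at hy
    exact hy

/-- Punctures are removable singularities for affine homeomorphisms: in charts, the difference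
of such a map and its linear part is constant on a connected punctured neighbourhood. -/
theorem HasLinearPart.of_restrict (hf : (S.restrict U).HasLinearPart f A)
    (hFf : ∀ x : U, F x = f x) (hsing : S.sing = ∅)
    (hconn : ∀ c ∉ U, ∀ N ∈ 𝓝 c, ∃ P ⊆ N, P ⊆ U ∧ IsPreconnected P ∧ P ∈ 𝓝[≠] c) :
    S.HasLinearPart F A := by
  have hU : ∀ e ∈ S.charts, ∀ e' ∈ S.charts, ∀ x ∈ U, x ∈ e.source → F x ∈ e'.source →
      ∃ b : Fin 2 → ℝ, ∀ᶠ y in 𝓝 x, e' (F y) = A *ᵥ e y + b := by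
    intro e he e' he' x hxU hx hx'
    obtain ⟨b, hb⟩ := hf.2 _ ⟨e, he, ⟨⟨x, hxU⟩⟩, rfl⟩ _ ⟨e', he', ⟨⟨x, hxU⟩⟩, rfl⟩ ⟨x, hxU⟩
      (by simpa using hx) (by
        rw [hFf ⟨x, hxU⟩] at hx'
        simpa using hx')
    refine ⟨b, ?_⟩
    rw [← U.isOpen.isOpenEmbedding_subtypeVal.map_nhds_eq ⟨x, hxU⟩, eventually_map]
    filter_upwards [hb] with y hy
    rw [hFf]
    exact hy
  refine ⟨fun x => by simp [hsing], fun e he e' he' x hx hx' => ?_⟩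
  by_cases hxU : x ∈ U
  · exact hU e he e' he' x hxU hx hx'
  let g : X → Fin 2 → ℝ := fun y => e' (F y) - A *ᵥ e y
  have hg : ContinuousAt g x := by
    refine ContinuousAt.sub ?_ ?_
    · exact ContinuousAt.comp (g := e') (e'.continuousAt hx') F.continuous.continuousAt
    · exact ContinuousAt.comp (g := fun v => A *ᵥ v) (by fun_prop) (e.continuousAt hx)
  obtain ⟨P, hPN, hPU, hPc, hP⟩ := hconn x hxU (e.source ∩ F ⁻¹' e'.source)
    (inter_mem (e.open_source.mem_nhds hx)
      (F.continuous.continuousAt.preimage_mem_nhds (e'.open_source.mem_nhds hx')))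
  have hconst : ∀ y ∈ P, ∀ z ∈ P, g y = g z := by
    intro y hy z hz
    refine hPc.induction₂ (fun a b => g a = g b) (fun a ha => ?_)
      (fun a b c _ _ _ h h' => h.trans h') (fun a b _ _ h => h.symm) hy hz
    obtain ⟨b, hb⟩ := hU e he e' he' a (hPU ha) (hPN ha).1 (hPN ha).2
    have ha := hb.self_of_nhds
    filter_upwards [nhdsWithin_le_nhds hb] with w hw
    simp only [g, hw, ha, add_sub_cancel_left]
  refine ⟨g x, ?_⟩
  have key : ∀ᶠ y in 𝓝[≠] x, g y = g x := by
    rcases (𝓝[≠] x).eq_or_neBot with h | h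
    · simp [h]
    · obtain ⟨z, hz⟩ := h.nonempty_of_mem hP
      have h1 : Tendsto g (𝓝[≠] x) (𝓝 (g z)) :=
        tendsto_const_nhds.congr' (mem_of_superset hP fun y hy => hconst z hz y hy)
      have h2 := tendsto_nhds_unique h1 (hg.mono_left nhdsWithin_le_nhds)
      exact mem_of_superset hP fun y hy => (hconst y hy z hz).trans h2
  rw [eventually_nhdsWithin_iff] at key
  filter_upwards [key] with y hy
  have : g y = g x := by
    by_cases h : y = x
    · rw [h]
    · exact hy h
  rw [← this, add_sub_cancel]

end TranslationSurface

namespace Chamanara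

/-! ### The Veech group of the punctured surface -/

theorem zpow_apply_injective {ζ : Surface}
    (hζ : ∀ f ∈ translationSurface.affineGroup, f ζ = ζ → f = 1) :
    Function.Injective fun n : ℤ => (phi ^ n) ζ := by
  intro n m h
  have h1 : (phi ^ (n - m)) ζ = ζ := by
    have h : (phi ^ n) ζ = (phi ^ m) ζ := h
    rw [sub_eq_neg_add, zpow_add, Homeomorph.mul_apply, h, ← Homeomorph.mul_apply, ← zpow_add,
      neg_add_cancel, zpow_zero]
    rfl
  have h2 := hasLinearPart_phi.zpow (A := hyperbolic) (n - m)
  have h3 := hζ _ ⟨_, h2⟩ h1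
  rw [h3] at h2
  have h4 := h2.unique translationSurface.hasLinearPart_one (x := ζ) (notMem_empty _)
  have h5 : hyperbolic ^ (n - m) = 1 := Subtype.ext (Units.ext h4)
  exact sub_eq_zero.1 (hyperbolic_zpow_eq_one h5)

variable {ζ : Surface}

theorem not_subset_of_isCompact (hζ : ∀ f ∈ translationSurface.affineGroup, f ζ = ζ → f = 1)
    (hc : IsClosed (orbit phi ζ)) (hd : DiscreteTopology (orbit phi ζ)) {K : Set Surface}
    (hK : IsCompact K) : ∃ c ∈ orbit phi ζ, c ∉ K := by
  refine not_subset.1 fun h => ?_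
  have hfin := (hK.of_isClosed_subset hc h).finite ⟨hd⟩
  exact (infinite_range_of_injective (zpow_apply_injective hζ)) hfin

theorem veechGroup_restrict (hζ : ∀ f ∈ translationSurface.affineGroup, f ζ = ζ → f = 1)
    (hc : IsClosed (orbit phi ζ)) (hd : DiscreteTopology (orbit phi ζ)) :
    (translationSurface.restrict ⟨(orbit phi ζ)ᶜ, hc.isOpen_compl⟩).veechGroup =
      Subgroup.zpowers hyperbolic := by
  set U : TopologicalSpace.Opens Surface := ⟨(orbit phi ζ)ᶜ, hc.isOpen_compl⟩ with hUdef
  have hmem : ∀ x, x ∉ U ↔ x ∈ orbit phi ζ := fun x => not_not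
  have hE : ∀ c ∉ U, ∀ᶠ x in 𝓝[≠] c, x ∈ U := fun c _ =>
    disjoint_principal_right.1 (isClosed_and_discrete_iff.1 ⟨hc, ⟨hd⟩⟩ c)
  have hconn : ∀ c ∉ U, ∀ N ∈ 𝓝 c, ∃ P ⊆ N, P ⊆ U ∧ IsPreconnected P ∧ P ∈ 𝓝[≠] c := by
    intro c hcU N hN
    obtain ⟨V, hV, hVU⟩ := mem_nhdsWithin_iff_exists_mem_nhds_inter.1 (hE c hcU)
    obtain ⟨P, hP, hPc, hPn⟩ := exists_punctured_nhds c (inter_mem hN hV)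
    exact ⟨P, fun x hx => (hP hx).1.1, fun x hx => hVU ⟨(hP hx).1.2, (hP hx).2⟩, hPc, hPn⟩
  ext A
  rw [Subgroup.mem_zpowers_iff]
  constructor
  · rintro ⟨f, hf⟩
    have hdense : Dense (U : Set Surface) := by
      have : Nontrivial Surface := ⟨_, _, (zpow_apply_injective hζ).ne zero_ne_one⟩
      intro x
      by_cases hx : x ∈ U
      · exact subset_closure hx
      · exact mem_closure_iff_frequently.2 ((hE x hx).frequently.filter_mono nhdsWithin_le_nhds)
    have hend : ∀ C : Set Surface, IsCompact C →
        ∃ K, IsCompact K ∧ C ⊆ K ∧ IsPreconnected Kᶜ ∧ ∃ c ∉ U, c ∉ K := by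
      intro C hC
      obtain ⟨ε, hε, hCε⟩ := exists_subset_core hC
      obtain ⟨c, hcE, hcK⟩ := not_subset_of_isCompact hζ hc hd (isCompact_core hε)
      exact ⟨_, isCompact_core hε, hCε, isPreconnected_compl_core hε, c, (hmem c).2 hcE, hcK⟩
    obtain ⟨F, hF⟩ := exists_homeomorph_extension hE hconn hdense hend f
    have hFA := hf.of_restrict hF rfl hconn
    have hζE : ζ ∈ orbit phi ζ := ⟨0, rfl⟩
    -- the extension permutes the punctures
    have hFζ : F ζ ∈ orbit phi ζ := by
      rw [← hmem]
      intro h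
      have h1 : F (f.symm ⟨F ζ, h⟩) = F ζ := by rw [hF, f.apply_symm_apply]
      exact (hmem ζ).2 hζE (F.injective h1 ▸ (f.symm ⟨F ζ, h⟩).2)
    obtain ⟨n, hn⟩ := hFζ
    have hn : (phi ^ n) ζ = F ζ := hn
    have hphi := hasLinearPart_phi.zpow (A := hyperbolic) n
    have h1 : (phi ^ n)⁻¹ * F = 1 := by
      refine hζ _ (mul_mem (inv_mem ⟨_, hphi⟩) ⟨A, hFA⟩) ?_
      rw [Homeomorph.mul_apply, ← hn, ← Homeomorph.mul_apply, inv_mul_cancel]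
      rfl
    rw [← inv_mul_eq_one.1 h1] at hFA
    exact ⟨n, Subtype.ext (Units.ext (hphi.unique hFA (x := ζ) (notMem_empty _)))⟩
  · rintro ⟨n, rfl⟩
    have hU : ∀ x, x ∈ U ↔ (phi ^ n) x ∈ U := by
      intro x
      rw [← not_iff_not, hmem, hmem]
      constructor
      · rintro ⟨m, rfl⟩
        exact ⟨n + m, by simp only [zpow_add, Homeomorph.mul_apply]⟩
      · rintro ⟨m, hm⟩
        have hm : (phi ^ m) ζ = (phi ^ n) x := hm
        refine ⟨-n + m, ?_⟩
        beta_reduce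
        rw [zpow_add, Homeomorph.mul_apply, hm, ← Homeomorph.mul_apply, ← zpow_add,
          neg_add_cancel, zpow_zero]
        rfl
    exact ⟨(phi ^ n).subtype hU, (hasLinearPart_phi.zpow (A := hyperbolic) n).restrict fun x => rfl⟩

theorem infinite_zpowers_hyperbolic : Infinite (Subgroup.zpowers hyperbolic) := by
  refine Infinite.of_injective (fun n : ℤ => (⟨hyperbolic ^ n, n, rfl⟩ :
    Subgroup.zpowers hyperbolic)) fun n m h => ?_
  refine sub_eq_zero.1 (hyperbolic_zpow_eq_one ?_)
  rw [zpow_sub, mul_inv_eq_one]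
  exact congrArg Subtype.val h

end Chamanara

theorem theorem1 :
    -- the Chamanara surface `X` is a translation surface (without singular points)
    ∃ X : TranslationSurface Chamanara.Surface,
      X.charts = Chamanara.charts ∧ X.sing = ∅ ∧
      -- the map `φ` is a well-defined affine homeomorphism with hyperbolic linear part `g`
      ∃ (φ : Chamanara.Surface ≃ₜ Chamanara.Surface) (g : GL(2, ℝ)⁺),
        Chamanara.IsPhi φ ∧
        g.1.1 = !![1 / 2, 0; 0, 2] ∧
        IsHyperbolicElement g ∧
        X.HasLinearPart φ g.1.1 ∧
        -- some point has trivial stabiliser and closed discrete orbit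
        (∃ ζ : Chamanara.Surface,
          (∀ f ∈ X.affineGroup, f ζ = ζ → f = 1) ∧
          IsClosed (Chamanara.orbit φ ζ) ∧ DiscreteTopology (Chamanara.orbit φ ζ)) ∧
        -- removing the orbit of any such point gives a surface as desired
        ∀ ζ : Chamanara.Surface,
          (∀ f ∈ X.affineGroup, f ζ = ζ → f = 1) →
          ∀ hclosed : IsClosed (Chamanara.orbit φ ζ),
          DiscreteTopology (Chamanara.orbit φ ζ) →
          let U : TopologicalSpace.Opens Chamanara.Surface :=
            ⟨(Chamanara.orbit φ ζ)ᶜ, hclosed.isOpen_compl⟩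
          ConnectedSpace U ∧
          (X.restrict U).HasFiniteArea ∧
          (X.restrict U).veechGroup = Subgroup.zpowers g ∧
          Infinite (X.restrict U).veechGroup := by
  refine ⟨Chamanara.translationSurface, rfl, rfl, Chamanara.phi, Chamanara.hyperbolic,
    Chamanara.isPhi_phi, Chamanara.hyperbolic_val, Chamanara.isHyperbolicElement_hyperbolic,
    Chamanara.hasLinearPart_phi, Chamanara.exists_point, fun ζ hζ hc hd => ?_⟩
  have hV := Chamanara.veechGroup_restrict hζ hc hd
  refine ⟨isConnected_iff_connectedSpace.1
    (Chamanara.isConnected_compl_countable (countable_range _)), Chamanara.hasFiniteArea.restrict _,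
    hV, ?_⟩
  exact hV.symm ▸ Chamanara.infinite_zpowers_hyperbolic
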